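/- For every constant $c>0$ there is a constant $K>0$, depending only on $c$, such that the following holds. Let $1\le t\le d\le n$ be integers with $$t\log^6 n\;\le\; n+\frac{d^2}{t}\log^2 n ,$$ where $\log$ is the natural logarithm, and let $A\in\mathbb R^{n\times d}$ be a random matrix with independent $\mathcal N(0,1/n)$ entries and rows $a_1,\dots,a_n\in\mathbb R^d$. For $y=(y_1,\dots,y_d)$ put $$P_t(y)=t!\sum_{S\subseteq[n],\,|S|=t}\ \prod_{i\in S}\langle a_i,y\rangle^4 .$$ Then, with probability at least $1-n^{-c}$ over $A$, the inequality $$P_t(y)\;\le\;\Bigl(K\Bigl(\frac1n+\frac{d^2}{n^2t}\log^2 n\Bigr)\Bigr)^{t}\,\|y\|_2^{4t}$$ has a sum-of-squares proof of degree $4t$ in $y$; that is, the polynomial in $y$ given by the right-hand side minus the left-hand side is a finite sum $\sum_k q_k(y)^2$ of squares of real polynomials $q_k$ with $\deg(q_k^2)\le 4t$. -/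

import Mathlib

open MeasureTheory ProbabilityTheory
open scoped NNReal Nat

noncomputable section

/-- A degree-`k` sum-of-squares proof, in the variables indexed by `σ` and from no constraints, of the
polynomial inequality `f ≤ g`: the polynomial `g - f` is a finite sum of squares of real polynomials, each
square having degree at most `k`. Over `ℝ` leading forms of squares cannot cancel, so the bound on the
squares is the same as `deg (g - f) ≤ k`. -/
def SosLe {σ : Type*} (k : ℕ) (f g : MvPolynomial σ ℝ) : Prop :=
  ∃ (m : ℕ) (q : Fin m → MvPolynomial σ ℝ),
    (∀ i, 2 * (q i).totalDegree ≤ k) ∧ g - f = ∑ i, q i ^ 2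

/-- The linear form `⟨a, y⟩ = ∑ j, a j * y j`, as a polynomial in `y`. -/
def linForm {d : ℕ} (a : Fin d → ℝ) : MvPolynomial (Fin d) ℝ :=
  ∑ j, MvPolynomial.C (a j) * MvPolynomial.X j

/-- The squared Euclidean norm `‖y‖₂²`, as a polynomial in `y`. -/
def normSqPoly (d : ℕ) : MvPolynomial (Fin d) ℝ :=
  ∑ j, MvPolynomial.X j ^ 2

/-- `P_t(y) = t! ∑_{S ⊆ [n], |S| = t} ∏_{i ∈ S} ⟨a_i, y⟩⁴`, as a polynomial in `y`, where `a_i` is the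
`i`-th row of `A`. -/
def distinctProductsPoly {n d : ℕ} (t : ℕ) (A : Fin n → Fin d → ℝ) : MvPolynomial (Fin d) ℝ :=
  MvPolynomial.C (t ! : ℝ) *
    ∑ S ∈ Finset.powersetCard t (Finset.univ : Finset (Fin n)), ∏ i ∈ S, linForm (A i) ^ 4

/-- The law `N(0, 1/n)^{n × d}` of an `n × d` matrix (a family of `n` rows in `ℝ^d`) with independent
centred Gaussian entries of variance `1/n`. -/
def gaussianMatrixLaw (n d : ℕ) : Measure (Fin n → Fin d → ℝ) :=
  Measure.pi fun _ => Measure.pi fun _ => gaussianReal 0 ((n : ℝ≥0)⁻¹)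

end

/-! ### Trace inequalities for pairs of positive semidefinite matrices. -/

section TraceInequalities

open Matrix
variable {ι : Type*} [Fintype ι] [DecidableEq ι]

/-! Multiplying `A` by `√n` makes the rows standard Gaussian vectors `g_i`. Write `ℓ_i = ⟨g_i, y⟩`,
`r = ‖y‖²` and `z_i = ℓ_i² - r`. Since `2 (z_i² + r²) - ℓ_i⁴ = (ℓ_i² - 2r)²`, each `ℓ_i⁴` may be
replaced by `2 (z_i² + r²)`. The `t`-th elementary symmetric polynomial of the shifted quantities
`z_i² + r²` is a combination, with weights `C(n-k, t-k)`, of `r^(2(t-k)) e_k(z_1², …, z_n²)` for `k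
≤ t`. So it suffices to bound each `e_k(z²)` by a multiple of `r^(2k)`, with a sum-of-squares
certificate.

Now `e_k(z²)` is the quadratic form, in the monomials of degree `2k`, of a positive matrix `E_{k,n}
= ∑_{|S| = k} v_S v_Sᵀ`, where `v_S` holds the coordinates of `∏_{i ∈ S} z_i`. In monomials
orthonormal for the Fischer product `⟨f, h⟩ = f(∂) h (0)`, the identity matrix represents `r^(2k) /
(2k)!`. Hence a bound on the largest eigenvalue of `E_{k,n}` is a certificate, with a gain of
`(2k)!` (`isSos_sub_sum_powersetCard`).

The eigenvalue is controlled by `𝔼 tr E_{k,n}^p`. Revealing one row `g` gives `E_{l+1,j+1} =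
E_{l+1,j} + M E_{l,j} Mᵀ`, where `M` is multiplication by `⟨g, y⟩² - r` and is independent of the
rest. A Rosenthal-type inequality (`Matrix.PosSemidef.trace_add_pow_le`) and Lieb–Thirring yield `𝔼
tr (R + M X Mᵀ)^p ≤ (1 + a) tr R^p + Θ tr X^p` for fixed `R`, `X`, and Pascal's rule solves the
recursion: `𝔼 tr E_{k,n}^p ≤ (1 + a)^n C(n,k) Θ^k`.

The step needs three averages at fixed vectors: of `‖Mᵀ u‖²`, of `‖M v‖²`, and of `⟨v, H^(2p) v⟩`
for a self-adjoint `H` with `MᵀM ≤ 2H²`. The choice is `H = ℓ_g ∂_g + 2|g|² + κ`: its powers have a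
normally ordered expansion in `ℓ_g^j ∂_g^j`, and the moments `𝔼 |g|^(2i) ‖∂_g^j f‖²` follow from
Stein's identity. Centring `ℓ_g²` by `r` makes `𝔼 ‖Mᵀ u‖²` independent of the dimension `d`.

Finally `p` is a power of two of order `1 + log(n/k)`, and `a = pk/n`. Then `(1 + a)^n`, `C(n,k)`
and the factor `n^(c+1)` wanted in Markov's inequality are all `e^(O(pk))`, which a `p`-th root
turns into `O(1)^k`, while `Θ^(1/p)` is at most a constant times `nk + d²p²`. A union bound over `k`
and a summation over `k` finish the proof. -/

theorem Matrix.IsHermitian.exists_diagonalization {A : Matrix ι ι ℝ} (hA : A.IsHermitian) :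
    ∃ U : Matrix ι ι ℝ, U * Uᵀ = 1 ∧ Uᵀ * U = 1 ∧ ∀ i : ℕ,
      A ^ i = U * diagonal (fun a => hA.eigenvalues a ^ i) * Uᵀ := by
  have h := hA.spectral_theorem
  set U : Matrix ι ι ℝ := hA.eigenvectorUnitary.1 with hU
  have h1 : U * Uᵀ = 1 := by
    have := Unitary.coe_mul_star_self hA.eigenvectorUnitary
    simpa [hU, star_eq_conjTranspose] using this
  have h2 : Uᵀ * U = 1 := by
    have := Unitary.coe_star_mul_self hA.eigenvectorUnitary
    simpa [hU, star_eq_conjTranspose] using this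
  refine ⟨U, h1, h2, fun i => ?_⟩
  have hA1 : A = U * diagonal hA.eigenvalues * Uᵀ := by
    conv_lhs => rw [h]
    simp [Unitary.conjStarAlgAut_apply, hU, star_eq_conjTranspose]
  induction i with
  | zero => simp [h1]
  | succ i ih =>
    rw [pow_succ, ih]
    refine (congrArg (U * diagonal (fun a => hA.eigenvalues a ^ i) * Uᵀ * ·) hA1).trans ?_
    calc _ = U * diagonal (fun a => hA.eigenvalues a ^ i) * (Uᵀ * U) * diagonal hA.eigenvalues * Uᵀ := by
          simp only [Matrix.mul_assoc]
      _ = _ := by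
          rw [h2, Matrix.mul_one, Matrix.mul_assoc U, diagonal_mul_diagonal]
          simp [pow_succ]

/-- The weights are the squared overlaps of the two eigenbases. Because one set of weights serves
all exponents, a polynomial inequality in two nonnegative scalars becomes a trace inequality for
noncommuting `A`, `B`, as long as every term can be written as `tr (A^i B^j)`. -/
theorem Matrix.PosSemidef.exists_trace_pow_mul_pow {A B : Matrix ι ι ℝ} (hA : A.PosSemidef)
    (hB : B.PosSemidef) : ∃ (α β : ι → ℝ) (w : ι → ι → ℝ), (∀ a, 0 ≤ α a) ∧ (∀ b, 0 ≤ β b) ∧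
      (∀ a b, 0 ≤ w a b) ∧
      ∀ i j : ℕ, (A ^ i * B ^ j).trace = ∑ a, ∑ b, α a ^ i * β b ^ j * w a b := by
  obtain ⟨U, -, -, hU⟩ := hA.1.exists_diagonalization
  obtain ⟨V, -, -, hV⟩ := hB.1.exists_diagonalization
  refine ⟨hA.1.eigenvalues, hB.1.eigenvalues, fun a b => (Uᵀ * V) a b ^ 2, hA.eigenvalues_nonneg,
    hB.eigenvalues_nonneg, fun a b => sq_nonneg _, fun i j => ?_⟩
  rw [hU, hV]
  have : (U * diagonal (fun a => hA.1.eigenvalues a ^ i) * Uᵀ *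
      (V * diagonal (fun a => hB.1.eigenvalues a ^ j) * Vᵀ)).trace =
      ((diagonal (fun a => hA.1.eigenvalues a ^ i) * (Uᵀ * V)) *
      (diagonal (fun a => hB.1.eigenvalues a ^ j) * (Uᵀ * V)ᵀ)).trace := by
    rw [Matrix.mul_assoc, Matrix.mul_assoc, Matrix.trace_mul_comm]
    simp only [Matrix.mul_assoc, transpose_mul, transpose_transpose]
  rw [this]
  simp only [trace, diag_apply, mul_apply (M := diagonal _ * _), diagonal_mul, transpose_apply]
  refine Finset.sum_congr rfl fun a _ => Finset.sum_congr rfl fun b _ => by ring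

theorem pow_add_mul_sub_le_pow {r s : ℝ} (hr : 0 ≤ r) (hs : 0 ≤ s) (n : ℕ) :
    s ^ (n + 1) + (n + 1) * (r - s) * s ^ n ≤ r ^ (n + 1) := by
  induction n with
  | zero => simp
  | succ n ih =>
    have h1 := mul_le_mul_of_nonneg_left ih hr
    have h2 : 0 ≤ (n + 1) * (r - s) ^ 2 * s ^ n := by positivity
    push_cast
    have e1 : r * r ^ (n + 1) = r ^ (n + 1 + 1) := by ring
    have e2 : s ^ (n + 1 + 1) + (↑n + 1 + 1) * (r - s) * s ^ (n + 1) =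
      r * (s ^ (n + 1) + (↑n + 1) * (r - s) * s ^ n) - (n + 1) * (r - s) ^ 2 * s ^ n := by ring
    linarith

/-- The tangent-line inequality bounds the increment `s^(n+1) - r^(n+1)` by its slope at the larger
endpoint. -/
theorem sub_mul_pow_sub_pow_le {r s : ℝ} (hr : 0 ≤ r) (hs : 0 ≤ s) (n : ℕ) :
    (s - r) * (s ^ (n + 1) - r ^ (n + 1)) ≤ (n + 1) * (s - r) ^ 2 * (s ^ n + r ^ n) := by
  have h1 := pow_add_mul_sub_le_pow hr hs n
  have h2 := pow_add_mul_sub_le_pow hs hr n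
  have hrn : 0 ≤ r ^ n := by positivity
  have hsn : 0 ≤ s ^ n := by positivity
  rcases le_total r s with h | h
  · have : s ^ (n + 1) - r ^ (n + 1) ≤ (n + 1) * (s - r) * (s ^ n + r ^ n) := by
      have : 0 ≤ (n + 1) * (s - r) * r ^ n := by have := sub_nonneg.2 h; positivity
      nlinarith
    nlinarith [sub_nonneg.2 h]
  · have : r ^ (n + 1) - s ^ (n + 1) ≤ (n + 1) * (r - s) * (s ^ n + r ^ n) := by
      have : 0 ≤ (n + 1) * (r - s) * s ^ n := by have := sub_nonneg.2 h; positivity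
      nlinarith
    nlinarith [sub_nonneg.2 h]

/-- If `4py ≤ s` the first term on the right suffices; otherwise `s ≤ 4py` and the second does. The
coefficient `1/4` is small enough to be absorbed later. -/
theorem mul_sq_mul_pow_le {p y s : ℝ} (hp : 0 ≤ p) (hy : 0 ≤ y) (hs : 0 ≤ s) (n : ℕ) :
    p * (y ^ 2 * s ^ n) ≤ 1 / 4 * (y * s ^ (n + 1)) + 4 ^ n * p ^ (n + 1) * y ^ (n + 2) := by
  rcases le_total (4 * p * y) s with h | h
  · have h1 : 0 ≤ y * s ^ n := by positivity
    have h2 : 0 ≤ 4 ^ n * p ^ (n + 1) * y ^ (n + 2) := by positivity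
    have h3 := mul_le_mul_of_nonneg_left h h1
    have e1 : p * (y ^ 2 * s ^ n) = 1 / 4 * (y * s ^ n * (4 * p * y)) := by ring
    have e2 : y * s ^ (n + 1) = y * s ^ n * s := by ring
    rw [e1, e2]; linarith
  · have h1 : s ^ n ≤ (4 * p * y) ^ n := by gcongr
    have h2 : 0 ≤ 1 / 4 * (y * s ^ (n + 1)) := by positivity
    have h3 : p * (y ^ 2 * s ^ n) ≤ p * (y ^ 2 * (4 * p * y) ^ n) := by gcongr
    have e : p * (y ^ 2 * (4 * p * y) ^ n) = 4 ^ n * p ^ (n + 1) * y ^ (n + 2) := by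
      rw [mul_pow, mul_pow]; ring
    linarith

namespace Matrix
variable {A B R S Y : Matrix ι ι ℝ}

theorem PosSemidef.trace_pow_add_le (hR : R.PosSemidef) (hS : S.PosSemidef) (n : ℕ) :
    (S ^ (n + 1)).trace + (n + 1) * ((R - S) * S ^ n).trace ≤ (R ^ (n + 1)).trace := by
  obtain ⟨α, β, w, hα, hβ, hw, h⟩ := hR.exists_trace_pow_mul_pow hS
  have e1 := h 0 (n + 1)
  have e2 := h 1 n
  have e3 := h (n + 1) 0
  simp only [pow_zero, pow_one, one_mul, mul_one] at e1 e2 e3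
  rw [Matrix.sub_mul, trace_sub, ← pow_succ', e1, e2, e3, ← Finset.sum_sub_distrib, Finset.mul_sum,
    ← Finset.sum_add_distrib]
  refine Finset.sum_le_sum fun a _ => ?_
  rw [← Finset.sum_sub_distrib, Finset.mul_sum, ← Finset.sum_add_distrib]
  refine Finset.sum_le_sum fun b _ => ?_
  have := mul_le_mul_of_nonneg_right (pow_add_mul_sub_le_pow (hα a) (hβ b) n) (hw a b)
  calc _ = _ := ?_
    _ ≤ _ := this
  ring

theorem PosSemidef.trace_mul_nonneg (hA : A.PosSemidef) (hB : B.PosSemidef) :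
    0 ≤ (A * B).trace := by
  obtain ⟨α, β, w, hα, hβ, hw, h⟩ := hA.exists_trace_pow_mul_pow hB
  have := h 1 1
  simp only [pow_one] at this
  rw [this]
  exact Finset.sum_nonneg fun a _ => Finset.sum_nonneg fun b _ =>
    mul_nonneg (mul_nonneg (hα a) (hβ b)) (hw a b)

theorem PosSemidef.trace_pow_le_trace_pow (hA : A.PosSemidef) (hB : B.PosSemidef)
    (hAB : (B - A).PosSemidef) (n : ℕ) : (A ^ n).trace ≤ (B ^ n).trace := by
  cases n with
  | zero => simp
  | succ n =>
    have h1 := hB.trace_pow_add_le hA n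
    have h2 := hAB.trace_mul_nonneg (hA.pow n)
    nlinarith

theorem PosSemidef.trace_sub_mul_pow_sub_pow_le (hR : R.PosSemidef) (hS : S.PosSemidef) (n : ℕ) :
    ((S - R) * S ^ (n + 1)).trace - ((S - R) * R ^ (n + 1)).trace ≤
      (n + 1) * (((S - R) ^ 2 * S ^ n).trace + ((S - R) ^ 2 * R ^ n).trace) := by
  obtain ⟨α, β, w, hα, hβ, hw, h⟩ := hR.exists_trace_pow_mul_pow hS
  have x1 : ((S - R) * S ^ (n + 1)).trace =
      (R ^ 0 * S ^ (n + 2)).trace - (R ^ 1 * S ^ (n + 1)).trace := by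
    rw [Matrix.sub_mul, trace_sub, ← pow_succ']; simp
  have x2 : ((S - R) * R ^ (n + 1)).trace =
      (R ^ (n + 1) * S ^ 1).trace - (R ^ (n + 2) * S ^ 0).trace := by
    rw [Matrix.sub_mul, trace_sub, ← pow_succ', trace_mul_comm]; simp
  have x3 : ((S - R) ^ 2 * S ^ n).trace = (R ^ 0 * S ^ (n + 2)).trace
      - 2 * (R ^ 1 * S ^ (n + 1)).trace + (R ^ 2 * S ^ n).trace := by
    have : (S - R) ^ 2 * S ^ n = S ^ (n + 2) - S * R * S ^ n - R * S ^ (n + 1) + R ^ 2 * S ^ n := by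
      rw [pow_succ' S (n + 1), pow_succ' S n]; noncomm_ring
    rw [this, trace_add, trace_sub, trace_sub, Matrix.mul_assoc S R, trace_mul_comm S, Matrix.mul_assoc,
      ← pow_succ]
    simp; ring
  have x4 : ((S - R) ^ 2 * R ^ n).trace = (R ^ (n + 2) * S ^ 0).trace
      - 2 * (R ^ (n + 1) * S ^ 1).trace + (R ^ n * S ^ 2).trace := by
    have : (S - R) ^ 2 * R ^ n = R ^ (n + 2) - R * S * R ^ n - S * R ^ (n + 1) + S ^ 2 * R ^ n := by
      rw [pow_succ' R (n + 1), pow_succ' R n]; noncomm_ring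
    rw [this, trace_add, trace_sub, trace_sub, Matrix.mul_assoc R S, trace_mul_comm R, Matrix.mul_assoc,
      ← pow_succ, trace_mul_comm S, trace_mul_comm (S ^ 2)]
    simp; ring
  rw [x1, x2, x3, x4]
  simp only [h]
  simp only [← Finset.sum_sub_distrib, Finset.mul_sum, ← Finset.sum_add_distrib]
  refine Finset.sum_le_sum fun a _ => Finset.sum_le_sum fun b _ => ?_
  have := mul_le_mul_of_nonneg_right (sub_mul_pow_sub_pow_le (hα a) (hβ b) n) (hw a b)
  calc _ = _ := ?_
    _ ≤ _ := this
    _ = _ := ?_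
  · ring
  · ring

theorem PosSemidef.mul_trace_sq_mul_pow_le (hY : Y.PosSemidef) (hS : S.PosSemidef) {p : ℝ}
    (hp : 0 ≤ p) (n : ℕ) : p * (Y ^ 2 * S ^ n).trace ≤
      1 / 4 * (Y * S ^ (n + 1)).trace + 4 ^ n * p ^ (n + 1) * (Y ^ (n + 2)).trace := by
  obtain ⟨α, β, w, hα, hβ, hw, h⟩ := hY.exists_trace_pow_mul_pow hS
  have e1 := h 1 (n + 1)
  have e3 := h (n + 2) 0
  simp only [pow_zero, pow_one, mul_one] at e1 e3
  rw [h, e1, e3]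
  simp only [Finset.mul_sum, ← Finset.sum_add_distrib]
  refine Finset.sum_le_sum fun a _ => Finset.sum_le_sum fun b _ => ?_
  have := mul_le_mul_of_nonneg_right (mul_sq_mul_pow_le hp (hα a) (hβ b) n) (hw a b)
  calc _ = _ := ?_
    _ ≤ _ := this
    _ = _ := ?_
  · ring
  · ring

/-- A Rosenthal-type perturbation bound for Schatten norms of sums of positive matrices. -/
theorem PosSemidef.trace_add_pow_le (hR : R.PosSemidef) (hY : Y.PosSemidef) (n : ℕ) :
    ((R + Y) ^ (n + 2)).trace ≤ (R ^ (n + 2)).trace + 3 * (n + 2) * (Y * R ^ (n + 1)).trace +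
      (4 * (n + 2)) ^ (n + 2) * (Y ^ (n + 2)).trace := by
  have hS := hR.add hY
  have h1 := hR.trace_pow_add_le hS (n + 1)
  have h2 := hR.trace_sub_mul_pow_sub_pow_le hS n
  have h3 := hY.mul_trace_sq_mul_pow_le hS (p := n + 2) (by positivity) n
  have h4 := hY.mul_trace_sq_mul_pow_le hR (p := n + 2) (by positivity) n
  have hYp : 0 ≤ (Y ^ (n + 2)).trace := (hY.pow _).trace_nonneg
  have p1 : 0 ≤ (Y ^ 2 * (R + Y) ^ n).trace := (hY.pow 2).trace_mul_nonneg (hS.pow n)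
  have p2 : 0 ≤ (Y ^ 2 * R ^ n).trace := (hY.pow 2).trace_mul_nonneg (hR.pow n)
  have p3 : 0 ≤ (Y * R ^ (n + 1)).trace := hY.trace_mul_nonneg (hR.pow _)
  rw [add_sub_cancel_left] at h2
  rw [show R - (R + Y) = -Y by abel, Matrix.neg_mul, trace_neg] at h1
  push_cast at h1
  set A := (Y * (R + Y) ^ (n + 1)).trace
  set B := (Y * R ^ (n + 1)).trace
  set Z := (Y ^ (n + 2)).trace
  set c : ℝ := 4 ^ n * (n + 2) ^ (n + 1)
  have hc : 0 ≤ c := by positivity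
  -- Adding up gives `A - B ≤ A/4 + B/4 + 2cZ`; the quarter of `A` is moved to the left and the
  -- result divided by `3/4`.
  have h5 : A ≤ 5 / 3 * B + 8 / 3 * (c * Z) := by nlinarith
  have h6 : (n + 2 : ℝ) * A ≤ (n + 2) * (5 / 3 * B + 8 / 3 * (c * Z)) := by gcongr
  have h7 : (4 * (n + 2 : ℝ)) ^ (n + 2) = 16 * (n + 2) * c := by
    rw [mul_pow]; simp only [c]; ring
  have h8 : 0 ≤ (n + 2) * (c * Z) := by positivity
  have h9 : 0 ≤ (n + 2) * B := by positivity
  rw [h7]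
  nlinarith

theorem trace_mul_self_le (C : Matrix ι ι ℝ) : (C ^ 2).trace ≤ (C * Cᵀ).trace := by
  have : 0 ≤ ((C - Cᵀ) * (C - Cᵀ)ᵀ).trace := by
    have := (posSemidef_self_mul_conjTranspose (C - Cᵀ)).trace_nonneg
    simpa using this
  have e : (C - Cᵀ) * (C - Cᵀ)ᵀ = C * Cᵀ - C ^ 2 - (C ^ 2)ᵀ + Cᵀ * C := by
    rw [transpose_sub, transpose_transpose, transpose_pow]; noncomm_ring
  rw [e, trace_add, trace_sub, trace_sub, trace_transpose, trace_mul_comm Cᵀ] at this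
  linarith

theorem trace_mul_pow_comm {κ : Type*} [Fintype κ] [DecidableEq κ] (A : Matrix ι κ ℝ)
    (B : Matrix κ ι ℝ) (n : ℕ) : ((A * B) ^ (n + 1)).trace = ((B * A) ^ (n + 1)).trace := by
  have h : ∀ n : ℕ, (A * B) ^ (n + 1) = A * (B * A) ^ n * B := by
    intro n
    induction n with
    | zero => simp
    | succ n ih => rw [pow_succ, ih, pow_succ (B * A)]; simp only [Matrix.mul_assoc]
  rw [h, trace_mul_comm, ← Matrix.mul_assoc, ← pow_succ']

theorem PosSemidef.trace_pow_mul_pow_le (hA : A.PosSemidef) (hB : B.PosSemidef) (n : ℕ) :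
    2 * (A ^ n * B ^ n).trace ≤ (A ^ (2 * n)).trace + (B ^ (2 * n)).trace := by
  obtain ⟨α, β, w, hα, hβ, hw, h⟩ := hA.exists_trace_pow_mul_pow hB
  have e1 := h (2 * n) 0
  have e2 := h 0 (2 * n)
  simp only [pow_zero, mul_one, one_mul] at e1 e2
  rw [h, e1, e2]
  simp only [Finset.mul_sum, ← Finset.sum_add_distrib]
  refine Finset.sum_le_sum fun a _ => Finset.sum_le_sum fun b _ => ?_
  have := mul_nonneg (sq_nonneg (α a ^ n - β b ^ n)) (hw a b)
  have e : (α a ^ n - β b ^ n) ^ 2 * w a b = α a ^ (2 * n) * w a b + β b ^ (2 * n) * w a b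
    - 2 * (α a ^ n * β b ^ n * w a b) := by ring
  linarith

/-- The two statements feed each other. For `AB`, the second one replaces `AB` by `(AB)(AB)ᵀ = A B²
A`, which is cyclically `A² B²`, so the exponent halves while the matrices are squared. For `C`, the
second one applied to `C²` leads cyclically to `(CᵀC)(CCᵀ)`; the first one and `2xy ≤ x² + y²` then
finish, as `CᵀC` and `CCᵀ` have the same trace powers. -/
theorem lieb_thirring_aux (j : ℕ) :
    (∀ A B : Matrix ι ι ℝ, A.PosSemidef → B.PosSemidef →
      ((A * B) ^ 2 ^ j).trace ≤ (A ^ 2 ^ j * B ^ 2 ^ j).trace) ∧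
    (∀ C : Matrix ι ι ℝ, (C ^ 2 ^ (j + 1)).trace ≤ ((C * Cᵀ) ^ 2 ^ j).trace) := by
  induction j with
  | zero => exact ⟨fun A B _ _ => by simp, fun C => by simpa using trace_mul_self_le C⟩
  | succ j ih =>
    obtain ⟨hLT, hK⟩ := ih
    refine ⟨fun A B hA hB => ?_, fun C => ?_⟩
    · refine (hK (A * B)).trans ?_
      obtain ⟨m, hm⟩ : ∃ m, 2 ^ j = m + 1 := ⟨2 ^ j - 1, (Nat.sub_add_cancel Nat.one_le_two_pow).symm⟩
      have hAt : Aᵀ = A := by simpa [IsHermitian] using hA.1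
      have hBt : Bᵀ = B := by simpa [IsHermitian] using hB.1
      have e : A * B * (A * B)ᵀ = A * (B ^ 2 * A) := by
        rw [transpose_mul, hAt, hBt, pow_two]; simp only [Matrix.mul_assoc]
      have e2 : ((A * (B ^ 2 * A)) ^ 2 ^ j).trace = ((A ^ 2 * B ^ 2) ^ 2 ^ j).trace := by
        rw [hm, trace_mul_pow_comm, Matrix.mul_assoc, ← pow_two, trace_mul_pow_comm]
      rw [e, e2]
      refine (hLT _ _ (hA.pow 2) (hB.pow 2)).trans_eq ?_
      rw [← pow_mul, ← pow_mul, ← pow_succ']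
    · rw [pow_succ' 2 (j + 1), pow_mul]
      refine (hK (C ^ 2)).trans ?_
      obtain ⟨m, hm⟩ : ∃ m, 2 ^ j = m + 1 := ⟨2 ^ j - 1, (Nat.sub_add_cancel Nat.one_le_two_pow).symm⟩
      have hP : (Cᵀ * C).PosSemidef := by simpa using posSemidef_conjTranspose_mul_self C
      have hQ : (C * Cᵀ).PosSemidef := by simpa using posSemidef_self_mul_conjTranspose C
      have e : ((C ^ 2 * (C ^ 2)ᵀ) ^ 2 ^ j).trace = ((Cᵀ * C * (C * Cᵀ)) ^ 2 ^ j).trace := by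
        rw [hm, trace_mul_pow_comm, transpose_pow, pow_two, pow_two]
        rw [show Cᵀ * Cᵀ * (C * C) = Cᵀ * (Cᵀ * C * C) by simp only [Matrix.mul_assoc],
          trace_mul_pow_comm]
        simp only [Matrix.mul_assoc]
      have h1 := hLT _ _ hP hQ
      have h2 := hP.trace_pow_mul_pow_le hQ (2 ^ j)
      rw [← pow_succ'] at h2
      have e3 : ((Cᵀ * C) ^ 2 ^ (j + 1)).trace = ((C * Cᵀ) ^ 2 ^ (j + 1)).trace := by
        obtain ⟨m, hm⟩ : ∃ m, 2 ^ (j + 1) = m + 1 :=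
          ⟨2 ^ (j + 1) - 1, (Nat.sub_add_cancel Nat.one_le_two_pow).symm⟩
        rw [hm, trace_mul_pow_comm]
      rw [e]; linarith

/-- The Lieb–Thirring trace inequality for exponents that are powers of two. -/
theorem PosSemidef.trace_mul_pow_two_pow_le (hA : A.PosSemidef) (hB : B.PosSemidef) (j : ℕ) :
    ((A * B) ^ 2 ^ j).trace ≤ (A ^ 2 ^ j * B ^ 2 ^ j).trace := (lieb_thirring_aux j).1 A B hA hB

end Matrix

end TraceInequalities

/-! ### Adding a random conjugate `M X Mᵀ` to a fixed positive matrix. -/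

namespace Matrix
variable {ι κ : Type*} [Fintype ι] [DecidableEq ι] [Fintype κ] [DecidableEq κ]

theorem PosSemidef.exists_transpose_mul_self {X : Matrix ι ι ℝ} (hX : X.PosSemidef) :
    ∃ Z : Matrix ι ι ℝ, Zᵀ * Z = X := by
  obtain ⟨V, -, -, hV⟩ := hX.1.exists_diagonalization
  refine ⟨diagonal (fun a => √(hX.1.eigenvalues a)) * Vᵀ, ?_⟩
  have h1 := hV 1
  simp only [pow_one] at h1
  refine Eq.trans ?_ h1.symm
  rw [transpose_mul, transpose_transpose, diagonal_transpose, Matrix.mul_assoc V,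
    ← Matrix.mul_assoc (diagonal _), diagonal_mul_diagonal, Matrix.mul_assoc]
  simp only [Real.mul_self_sqrt (hX.eigenvalues_nonneg _)]

/-- With `X = ZᵀZ`, cyclicity turns `M X Mᵀ` into `Z (MᵀM) Zᵀ`, where `MᵀM` may be replaced by `2H²`
by monotonicity of `tr (·)^m`; cycling back, Lieb–Thirring separates `X` from `H²`. The result is
linear in `H^(2m)`, so it can be averaged over `H`. -/
theorem PosSemidef.trace_conj_pow_two_pow_le {X H : Matrix ι ι ℝ} {M : Matrix κ ι ℝ}
    (hX : X.PosSemidef) (hH : Hᵀ = H) (hM : ((2 : ℝ) • (H * H) - Mᵀ * M).PosSemidef) (s : ℕ) :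
    ((M * X * Mᵀ) ^ 2 ^ s).trace ≤ 2 ^ 2 ^ s * (X ^ 2 ^ s * H ^ (2 * 2 ^ s)).trace := by
  obtain ⟨m, hm⟩ : ∃ m, 2 ^ s = m + 1 := ⟨2 ^ s - 1, (Nat.sub_add_cancel Nat.one_le_two_pow).symm⟩
  obtain ⟨Z, hZ⟩ := hX.exists_transpose_mul_self
  have hHH : (H * H).PosSemidef := by
    have := posSemidef_conjTranspose_mul_self H
    rwa [conjTranspose_eq_transpose_of_trivial, hH] at this
  have e1 : ((M * X * Mᵀ) ^ 2 ^ s).trace = ((Z * (Mᵀ * M) * Zᵀ) ^ 2 ^ s).trace := by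
    rw [hm, ← hZ, show M * (Zᵀ * Z) * Mᵀ = (M * Zᵀ) * (Z * Mᵀ) by simp only [Matrix.mul_assoc],
      trace_mul_pow_comm]
    simp only [Matrix.mul_assoc]
  have e2 : ((Z * ((2 : ℝ) • (H * H)) * Zᵀ) ^ 2 ^ s).trace =
      2 ^ 2 ^ s * ((X * (H * H)) ^ 2 ^ s).trace := by
    rw [Matrix.mul_smul, Matrix.smul_mul, smul_pow, trace_smul, smul_eq_mul, hm, Matrix.mul_assoc,
      trace_mul_pow_comm Z, ← hZ]
    congr 1
    rw [Matrix.mul_assoc (H * H), trace_mul_pow_comm]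
  have hpsd : ∀ {Q : Matrix ι ι ℝ}, Q.PosSemidef → (Z * Q * Zᵀ).PosSemidef := fun hQ => by
    simpa using hQ.mul_mul_conjTranspose_same Z
  have hMM : (Mᵀ * M).PosSemidef := by simpa using posSemidef_conjTranspose_mul_self M
  have h1 := (hpsd hMM).trace_pow_le_trace_pow (hpsd (hHH.smul (zero_le_two (α := ℝ))))
    (by rw [← Matrix.sub_mul, ← Matrix.mul_sub]; exact hpsd hM) (2 ^ s)
  rw [e1]
  refine h1.trans ?_
  rw [e2, pow_mul, pow_two H]
  gcongr
  exact hX.trace_mul_pow_two_pow_le hHH s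

theorem dotProduct_self_mulVec_of_mul_transpose_eq_one {V : Matrix ι ι ℝ} (hV : V * Vᵀ = 1)
    (x : ι → ℝ) : (Vᵀ *ᵥ x) ⬝ᵥ (Vᵀ *ᵥ x) = x ⬝ᵥ x := by
  rw [dotProduct_mulVec, vecMul_transpose, mulVec_mulVec, hV, one_mulVec]

theorem mul_pow_le_of_pos {l x r : ℝ} (hl : 0 < l) (hx : 0 ≤ x) (hr : 0 ≤ r) (n : ℕ) :
    x * r ^ n ≤ l * r ^ (n + 1) + (l⁻¹) ^ n * x ^ (n + 1) := by
  rcases le_total x (l * r) with h | h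
  · have h1 : x * r ^ n ≤ l * r * r ^ n := by gcongr
    have h2 : 0 ≤ (l⁻¹) ^ n * x ^ (n + 1) := by positivity
    rw [pow_succ' r]; linarith
  · have h0 : r ≤ l⁻¹ * x := by rwa [inv_mul_eq_div, le_div_iff₀' hl]
    have h1 : x * r ^ n ≤ x * (l⁻¹ * x) ^ n := by gcongr
    have h2 : 0 ≤ l * r ^ (n + 1) := by positivity
    rw [mul_pow] at h1
    rw [pow_succ x]; linarith

/-- In eigenbases `u` of `R` and `v` of `X` the trace is `∑ ξ_j ρ_i^n ⟨u_i, M v_j⟩²`. A Young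
inequality with weight `l` separates `ξ` from `ρ`, and Parseval sums out the free index. Neither
eigenbasis depends on `M`, so the bound can be averaged over a random `M` term by term. -/
theorem PosSemidef.mul_trace_conj_mul_pow_le {X : Matrix ι ι ℝ} {R : Matrix κ κ ℝ}
    (hX : X.PosSemidef) (hR : R.PosSemidef) :
    ∃ (ρ : κ → ℝ) (u : κ → κ → ℝ) (ξ : ι → ℝ) (v : ι → ι → ℝ),
      (∀ i, 0 ≤ ρ i) ∧ (∀ j, 0 ≤ ξ j) ∧ (∀ i, u i ⬝ᵥ u i = 1) ∧ (∀ j, v j ⬝ᵥ v j = 1) ∧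
      (∀ n : ℕ, (R ^ n).trace = ∑ i, ρ i ^ n) ∧ (∀ n : ℕ, (X ^ n).trace = ∑ j, ξ j ^ n) ∧
      (∀ (n : ℕ) (H : Matrix ι ι ℝ), (X ^ n * H).trace = ∑ j, ξ j ^ n * (v j ⬝ᵥ (H *ᵥ v j))) ∧
      ∀ (M : Matrix κ ι ℝ) (n : ℕ) (l : ℝ), 0 < l → (M * X * Mᵀ * R ^ n).trace ≤
        l * ∑ i, ρ i ^ (n + 1) * ((Mᵀ *ᵥ u i) ⬝ᵥ (Mᵀ *ᵥ u i)) +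
        (l⁻¹) ^ n * ∑ j, ξ j ^ (n + 1) * ((M *ᵥ v j) ⬝ᵥ (M *ᵥ v j)) := by
  obtain ⟨U, hU1, hU2, hU⟩ := hR.1.exists_diagonalization
  obtain ⟨V, hV1, hV2, hV⟩ := hX.1.exists_diagonalization
  have hdot : ∀ {W : Matrix ι ι ℝ}, Wᵀ * W = 1 → ∀ i, Wᵀ i ⬝ᵥ Wᵀ i = 1 := fun {W} hW i => by
    have := congrFun₂ hW i i
    simpa [mul_apply, dotProduct] using this
  have hdot' : ∀ {W : Matrix κ κ ℝ}, Wᵀ * W = 1 → ∀ i, Wᵀ i ⬝ᵥ Wᵀ i = 1 := fun {W} hW i => by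
    have := congrFun₂ hW i i
    simpa [mul_apply, dotProduct] using this
  have htr : ∀ (n : ℕ) (H : Matrix ι ι ℝ), (X ^ n * H).trace =
      ∑ j, hX.1.eigenvalues j ^ n * (Vᵀ j ⬝ᵥ (H *ᵥ Vᵀ j)) := fun n H => by
    rw [hV n, Matrix.mul_assoc, Matrix.mul_assoc, trace_mul_comm, Matrix.mul_assoc]
    simp only [trace, diag_apply, diagonal_mul]
    refine Finset.sum_congr rfl fun j _ => ?_
    rw [Matrix.mul_assoc, mul_apply]
    simp [dotProduct, mul_apply, mulVec]
  have htr' : ∀ (n : ℕ), (R ^ n).trace = ∑ j, hR.1.eigenvalues j ^ n := fun n => by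
    rw [hU n, trace_mul_comm, ← Matrix.mul_assoc, hU2, Matrix.one_mul, trace_diagonal]
  refine ⟨hR.1.eigenvalues, Uᵀ, hX.1.eigenvalues, Vᵀ, hR.eigenvalues_nonneg, hX.eigenvalues_nonneg,
    hdot' hU2, hdot hV2, htr', fun n => ?_, htr, fun M n l hl => ?_⟩
  · have := htr n 1
    rw [Matrix.mul_one] at this
    simp [this, hdot hV2]
  · have key : (M * X * Mᵀ * R ^ n).trace = ∑ i, ∑ j, hX.1.eigenvalues j *
        hR.1.eigenvalues i ^ n * (Uᵀ * M * V) i j ^ 2 := by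
      have : (M * X * Mᵀ * R ^ n).trace = ((diagonal (fun a => hR.1.eigenvalues a ^ n) * (Uᵀ * M * V))
          * (diagonal (fun a => hX.1.eigenvalues a ^ 1) * (Uᵀ * M * V)ᵀ)).trace := by
        rw [hU n]
        conv_lhs => rw [← pow_one X, hV 1]
        rw [trace_mul_comm]
        simp only [Matrix.mul_assoc, transpose_mul, transpose_transpose]
        rw [trace_mul_comm]
        simp only [Matrix.mul_assoc]
      rw [this]
      simp only [trace, diag_apply, mul_apply (M := diagonal _ * _), diagonal_mul, transpose_apply]
      refine Finset.sum_congr rfl fun a _ => Finset.sum_congr rfl fun b _ => by ring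
    have r1 : ∀ i, (Mᵀ *ᵥ Uᵀ i) ⬝ᵥ (Mᵀ *ᵥ Uᵀ i) = ∑ j, (Uᵀ * M * V) i j ^ 2 := fun i => by
      rw [← dotProduct_self_mulVec_of_mul_transpose_eq_one hV1, dotProduct]
      refine Finset.sum_congr rfl fun j _ => ?_
      have : (Vᵀ *ᵥ (Mᵀ *ᵥ Uᵀ i)) j = (Uᵀ * M * V) i j := by
        rw [mulVec_mulVec, ← transpose_apply (Uᵀ * M * V), transpose_mul, transpose_mul,
          transpose_transpose, ← Matrix.mul_assoc]
        simp [mulVec, dotProduct, mul_apply (M := Vᵀ * Mᵀ)]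
      rw [this, sq]
    have r2 : ∀ j, (M *ᵥ Vᵀ j) ⬝ᵥ (M *ᵥ Vᵀ j) = ∑ i, (Uᵀ * M * V) i j ^ 2 := fun j => by
      rw [← dotProduct_self_mulVec_of_mul_transpose_eq_one hU1, dotProduct]
      refine Finset.sum_congr rfl fun i _ => ?_
      have : (Uᵀ *ᵥ (M *ᵥ Vᵀ j)) i = (Uᵀ * M * V) i j := by
        rw [mulVec_mulVec]
        simp [mulVec, dotProduct, mul_apply (M := Uᵀ * M)]
      rw [this, sq]
    rw [key]
    simp only [r1, r2]
    have e : ∑ j, hX.1.eigenvalues j ^ (n + 1) * ∑ i, (Uᵀ * M * V) i j ^ 2 =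
        ∑ i, ∑ j, hX.1.eigenvalues j ^ (n + 1) * (Uᵀ * M * V) i j ^ 2 := by
      simp only [Finset.mul_sum]; rw [Finset.sum_comm]
    rw [e]
    simp only [Finset.mul_sum, ← Finset.sum_add_distrib]
    refine Finset.sum_le_sum fun i _ => Finset.sum_le_sum fun j _ => ?_
    have := mul_le_mul_of_nonneg_right (mul_pow_le_of_pos hl (hX.eigenvalues_nonneg j)
      (hR.eigenvalues_nonneg i) n) (sq_nonneg ((Uᵀ * M * V) i j))
    linarith

/-- One step of the moment recursion: adding to a positive matrix `R` a random conjugate of a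
positive matrix `X`. -/
theorem lintegral_trace_add_conj_pow_le {Ω : Type*} [MeasurableSpace Ω] {μ : Measure Ω}
    [IsProbabilityMeasure μ] {X : Matrix ι ι ℝ} {R : Matrix κ κ ℝ} (hX : X.PosSemidef)
    (hR : R.PosSemidef) {M : Ω → Matrix κ ι ℝ} {H : Ω → Matrix ι ι ℝ} (hH : ∀ ω, (H ω)ᵀ = H ω)
    (hM : ∀ ω, ((2 : ℝ) • (H ω * H ω) - (M ω)ᵀ * M ω).PosSemidef) {s p : ℕ} (hp : p = 2 ^ s)
    (hp2 : 2 ≤ p) {l a b B : ℝ} (hl : 0 < l)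
    (i1 : ∀ u, Integrable (fun ω => ((M ω)ᵀ *ᵥ u) ⬝ᵥ ((M ω)ᵀ *ᵥ u)) μ)
    (i2 : ∀ v, Integrable (fun ω => (M ω *ᵥ v) ⬝ᵥ (M ω *ᵥ v)) μ)
    (i3 : ∀ v, Integrable (fun ω => v ⬝ᵥ (H ω ^ (2 * p) *ᵥ v)) μ)
    (h1 : ∀ u, ∫ ω, ((M ω)ᵀ *ᵥ u) ⬝ᵥ ((M ω)ᵀ *ᵥ u) ∂μ ≤ a * (u ⬝ᵥ u))
    (h2 : ∀ v, ∫ ω, (M ω *ᵥ v) ⬝ᵥ (M ω *ᵥ v) ∂μ ≤ b * (v ⬝ᵥ v))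
    (h3 : ∀ v, ∫ ω, v ⬝ᵥ (H ω ^ (2 * p) *ᵥ v) ∂μ ≤ B * (v ⬝ᵥ v)) :
    ∫⁻ ω, ENNReal.ofReal ((R + M ω * X * (M ω)ᵀ) ^ p).trace ∂μ ≤
      ENNReal.ofReal ((1 + 3 * p * l * a) * (R ^ p).trace +
        (3 * p * (l⁻¹) ^ (p - 1) * b + (8 * p) ^ p * B) * (X ^ p).trace) := by
  obtain ⟨n, rfl⟩ : ∃ n, p = n + 2 := ⟨p - 2, by omega⟩
  obtain ⟨ρ, u, ξ, v, hρ, hξ, hu, hv, tR, tX, tXH, key⟩ := hX.mul_trace_conj_mul_pow_le hR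
  -- A majorant that is linear in quadratic forms evaluated at deterministic eigenvectors: only the
  -- three averages assumed in the hypotheses enter. The base `8 (n + 2)` is `4 (n + 2)` from the
  -- Rosenthal bound times `2` from `MᵀM ≤ 2H²`.
  set F : Ω → ℝ := fun ω => ∑ i, ρ i ^ (n + 2) + (3 * (n + 2) * (
      l * ∑ i, ρ i ^ (n + 2) * (((M ω)ᵀ *ᵥ u i) ⬝ᵥ ((M ω)ᵀ *ᵥ u i)) +
        (l⁻¹) ^ (n + 1) * ∑ j, ξ j ^ (n + 2) * ((M ω *ᵥ v j) ⬝ᵥ (M ω *ᵥ v j))) +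
      (8 * (n + 2)) ^ (n + 2) * ∑ j, ξ j ^ (n + 2) * (v j ⬝ᵥ (H ω ^ (2 * (n + 2)) *ᵥ v j))) with hF
  have hpsd : ∀ ω, (M ω * X * (M ω)ᵀ).PosSemidef := fun ω => by
    simpa using hX.mul_mul_conjTranspose_same (M ω)
  have hle : ∀ ω, ((R + M ω * X * (M ω)ᵀ) ^ (n + 2)).trace ≤ F ω := fun ω => by
    have e1 := hR.trace_add_pow_le (hpsd ω) n
    have e2 := hX.trace_conj_pow_two_pow_le (hH ω) (hM ω) s
    rw [← hp, tXH] at e2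
    have e3 := key (M ω) (n + 1) l hl
    have e4 : (4 * (n + 2 : ℝ)) ^ (n + 2) * ((M ω * X * (M ω)ᵀ) ^ (n + 2)).trace ≤
        (4 * (n + 2 : ℝ)) ^ (n + 2) * (2 ^ (n + 2) * ∑ j, ξ j ^ (n + 2) *
          (v j ⬝ᵥ (H ω ^ (2 * (n + 2)) *ᵥ v j))) := by gcongr
    have e5 : (8 * (n + 2 : ℝ)) ^ (n + 2) = (4 * (n + 2 : ℝ)) ^ (n + 2) * 2 ^ (n + 2) := by
      rw [← mul_pow]; ring
    have e6 := mul_le_mul_of_nonneg_left e3 (show (0 : ℝ) ≤ 3 * (n + 2) by positivity)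
    rw [tR] at e1
    simp only [hF, e5]
    linarith
  have hi1 : Integrable (fun ω => ∑ i, ρ i ^ (n + 2) *
      (((M ω)ᵀ *ᵥ u i) ⬝ᵥ ((M ω)ᵀ *ᵥ u i))) μ :=
    integrable_finsetSum _ fun i _ => (i1 (u i)).const_mul _
  have hi2 : Integrable (fun ω => ∑ j, ξ j ^ (n + 2) * ((M ω *ᵥ v j) ⬝ᵥ (M ω *ᵥ v j))) μ :=
    integrable_finsetSum _ fun i _ => (i2 (v i)).const_mul _
  have hi3 : Integrable (fun ω => ∑ j, ξ j ^ (n + 2) *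
      (v j ⬝ᵥ (H ω ^ (2 * (n + 2)) *ᵥ v j))) μ :=
    integrable_finsetSum _ fun i _ => (i3 (v i)).const_mul _
  have hFi : Integrable F μ :=
    (integrable_const _).add (((((hi1.const_mul l).add (hi2.const_mul _)).const_mul _)).add
      (hi3.const_mul _))
  have hF0 : ∀ ω, 0 ≤ F ω := fun ω => le_trans ((hR.add (hpsd ω)).pow _).trace_nonneg (hle ω)
  calc _ ≤ ∫⁻ ω, ENNReal.ofReal (F ω) ∂μ :=
        lintegral_mono fun ω => ENNReal.ofReal_le_ofReal (hle ω)
    _ = ENNReal.ofReal (∫ ω, F ω ∂μ) :=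
        (ofReal_integral_eq_lintegral_ofReal hFi (Filter.Eventually.of_forall hF0)).symm
    _ ≤ _ := ENNReal.ofReal_le_ofReal ?_
  have j1 : ∫ ω, ∑ i, ρ i ^ (n + 2) * (((M ω)ᵀ *ᵥ u i) ⬝ᵥ ((M ω)ᵀ *ᵥ u i)) ∂μ ≤
      a * ∑ i, ρ i ^ (n + 2) := by
    rw [integral_finsetSum _ fun i _ => (i1 (u i)).const_mul _, Finset.mul_sum]
    refine Finset.sum_le_sum fun i _ => ?_
    rw [integral_const_mul]
    have := mul_le_mul_of_nonneg_left (h1 (u i)) (pow_nonneg (hρ i) (n + 2))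
    rw [hu, mul_one] at this; linarith
  have j2 : ∫ ω, ∑ j, ξ j ^ (n + 2) * ((M ω *ᵥ v j) ⬝ᵥ (M ω *ᵥ v j)) ∂μ ≤
      b * ∑ j, ξ j ^ (n + 2) := by
    rw [integral_finsetSum _ fun i _ => (i2 (v i)).const_mul _, Finset.mul_sum]
    refine Finset.sum_le_sum fun i _ => ?_
    rw [integral_const_mul]
    have := mul_le_mul_of_nonneg_left (h2 (v i)) (pow_nonneg (hξ i) (n + 2))
    rw [hv, mul_one] at this; linarith
  have j3 : ∫ ω, ∑ j, ξ j ^ (n + 2) * (v j ⬝ᵥ (H ω ^ (2 * (n + 2)) *ᵥ v j)) ∂μ ≤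
      B * ∑ j, ξ j ^ (n + 2) := by
    rw [integral_finsetSum _ fun i _ => (i3 (v i)).const_mul _, Finset.mul_sum]
    refine Finset.sum_le_sum fun i _ => ?_
    rw [integral_const_mul]
    have := mul_le_mul_of_nonneg_left (h3 (v i)) (pow_nonneg (hξ i) (n + 2))
    rw [hv, mul_one] at this; linarith
  have hI : ∀ {f g h : Ω → ℝ} (c₀ c₁ c₂ c₃ c₄ : ℝ), Integrable f μ → Integrable g μ →
      Integrable h μ → ∫ ω, (c₀ + (c₁ * (c₂ * f ω + c₃ * g ω) + c₄ * h ω)) ∂μ =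
        c₀ + (c₁ * (c₂ * ∫ ω, f ω ∂μ + c₃ * ∫ ω, g ω ∂μ) + c₄ * ∫ ω, h ω ∂μ) :=
    fun {f g h} c₀ c₁ c₂ c₃ c₄ hf hg hh => by
      have k12 : Integrable (fun ω => c₂ * f ω + c₃ * g ω) μ := (hf.const_mul _).add (hg.const_mul _)
      have k3 : Integrable (fun ω => c₁ * (c₂ * f ω + c₃ * g ω) + c₄ * h ω) μ :=
        (k12.const_mul _).add (hh.const_mul _)
      rw [integral_add (integrable_const _) k3,
        integral_add (k12.const_mul _) (hh.const_mul _), integral_const_mul,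
        integral_add (hf.const_mul _) (hg.const_mul _), integral_const_mul, integral_const_mul,
        integral_const_mul, integral_const]
      simp
  rw [hF, hI _ _ _ _ _ hi1 hi2 hi3]
  rw [tR, tX]
  have k1 := mul_le_mul_of_nonneg_left j1 (show 0 ≤ 3 * (n + 2 : ℝ) * l by positivity)
  have k2 := mul_le_mul_of_nonneg_left j2 (show 0 ≤ 3 * (n + 2 : ℝ) * (l⁻¹) ^ (n + 1) by positivity)
  have k3 := mul_le_mul_of_nonneg_left j3 (show 0 ≤ (8 * (n + 2 : ℝ)) ^ (n + 2) by positivity)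
  push_cast [show n + 2 - 1 = n + 1 by omega]
  linarith

end Matrix

/-! ### The Fischer inner product: multiplication and differentiation as adjoint operators. -/

section Fischer
open MvPolynomial
variable {d : ℕ}

/-- The Fischer inner product `⟨f, h⟩ = f(∂) h (0)` on real polynomials. -/
noncomputable def fischer : MvPolynomial (Fin d) ℝ →ₗ[ℝ] MvPolynomial (Fin d) ℝ →ₗ[ℝ] ℝ :=
  (basisMonomials (Fin d) ℝ).constr ℝ fun β => (∏ i, ((β i)! : ℝ)) • lcoeff ℝ β

theorem fischer_monomial_left (β : Fin d →₀ ℕ) (b : ℝ) (h : MvPolynomial (Fin d) ℝ) :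
    fischer (monomial β b) h = b * ((∏ i, ((β i)! : ℝ)) * coeff β h) := by
  have e : monomial β b = b • basisMonomials (Fin d) ℝ β := by
    rw [coe_basisMonomials, smul_monomial, smul_eq_mul, mul_one]
  rw [e, map_smul, fischer, Module.Basis.constr_basis]
  simp [lcoeff]

theorem fischer_eq_sum (f h : MvPolynomial (Fin d) ℝ) :
    fischer f h = ∑ β ∈ f.support, coeff β f * ((∏ i, ((β i)! : ℝ)) * coeff β h) := by
  conv_lhs => rw [f.as_sum]
  simp only [map_sum, LinearMap.sum_apply, fischer_monomial_left]

theorem fischer_eq_sum_of_subset {f h : MvPolynomial (Fin d) ℝ} {T : Finset (Fin d →₀ ℕ)}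
    (hT : f.support ⊆ T) :
    fischer f h = ∑ β ∈ T, coeff β f * ((∏ i, ((β i)! : ℝ)) * coeff β h) := by
  rw [fischer_eq_sum]
  refine Finset.sum_subset hT fun β _ hβ => ?_
  rw [notMem_support_iff.1 hβ, zero_mul]

theorem fischer_comm (f h : MvPolynomial (Fin d) ℝ) : fischer f h = fischer h f := by
  classical
  rw [fischer_eq_sum_of_subset (Finset.subset_union_left (s₂ := h.support)),
    fischer_eq_sum_of_subset (Finset.subset_union_right (s₁ := f.support))]
  exact Finset.sum_congr rfl fun β _ => by ring

theorem fischer_self_nonneg (f : MvPolynomial (Fin d) ℝ) : 0 ≤ fischer f f := by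
  rw [fischer_eq_sum]
  refine Finset.sum_nonneg fun β _ => ?_
  have : 0 ≤ (∏ i, ((β i)! : ℝ)) := by positivity
  nlinarith [mul_nonneg this (sq_nonneg (coeff β f))]

theorem fischer_le_add (f h : MvPolynomial (Fin d) ℝ) (s : ℝ) (hs : 0 < s) :
    2 * fischer f h ≤ s * fischer f f + s⁻¹ * fischer h h := by
  have := fischer_self_nonneg (s • f - h)
  simp only [map_sub, LinearMap.sub_apply, map_smul, LinearMap.smul_apply, smul_eq_mul,
    fischer_comm h f] at this
  have h2 := mul_nonneg (inv_nonneg.2 hs.le) this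
  have e : s⁻¹ * (s * (s * fischer f f) - s * fischer f h - (s * fischer f h - fischer h h)) =
    s * fischer f f - 2 * fischer f h + s⁻¹ * fischer h h := by field_simp; ring
  linarith

theorem fischer_add_self_le (f h : MvPolynomial (Fin d) ℝ) :
    fischer (f - h) (f - h) ≤ 2 * fischer f f + 2 * fischer h h := by
  have := fischer_self_nonneg (f + h)
  simp only [map_sub, map_add, LinearMap.sub_apply, LinearMap.add_apply] at *
  linarith

theorem fischer_X_mul (i : Fin d) (f h : MvPolynomial (Fin d) ℝ) :
    fischer (X i * f) h = fischer f (pderiv i h) := by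
  induction f using MvPolynomial.induction_on' with
  | monomial β b =>
    rw [mul_comm, X, monomial_mul, mul_one, fischer_monomial_left, fischer_monomial_left, coeff_pderiv]
    have : (∏ j, (((β + Finsupp.single i 1 : Fin d →₀ ℕ) j)! : ℝ)) = (β i + 1) * ∏ j, ((β j)! : ℝ) := by
      rw [← Finset.mul_prod_erase _ _ (Finset.mem_univ i),
        ← Finset.mul_prod_erase _ (fun j => ((β j)! : ℝ)) (Finset.mem_univ i), ← mul_assoc]
      congr 1
      · simp [Nat.factorial_succ]
      · refine Finset.prod_congr rfl fun j hj => ?_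
        rw [Finsupp.add_apply, Finsupp.single_apply, if_neg (Finset.ne_of_mem_erase hj).symm, add_zero]
    rw [this]; ring
  | add f g hf hg => simp only [mul_add, map_add, LinearMap.add_apply, hf, hg]

/-- The derivative in direction `g`. -/
noncomputable def dirDeriv (g : Fin d → ℝ) :
    Derivation ℝ (MvPolynomial (Fin d) ℝ) (MvPolynomial (Fin d) ℝ) := ∑ α, g α • pderiv α

theorem dirDeriv_apply (g : Fin d → ℝ) (f : MvPolynomial (Fin d) ℝ) :
    dirDeriv g f = ∑ α, g α • pderiv α f := by
  refine (congrFun (map_sum Derivation.coeFnAddMonoidHom (fun α => g α • pderiv α) Finset.univ)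
    f).trans ?_
  rw [Finset.sum_apply]
  rfl

theorem linForm_mul (g : Fin d → ℝ) (f : MvPolynomial (Fin d) ℝ) :
    linForm g * f = ∑ α, g α • (X α * f) := by
  simp [linForm, Finset.sum_mul, smul_eq_C_mul, mul_assoc]

theorem fischer_linForm_mul (g : Fin d → ℝ) (f h : MvPolynomial (Fin d) ℝ) :
    fischer (linForm g * f) h = fischer f (dirDeriv g h) := by
  simp [linForm_mul, dirDeriv_apply, fischer_X_mul]

/-- The Laplacian on polynomials. -/
noncomputable def laplacePoly : MvPolynomial (Fin d) ℝ →ₗ[ℝ] MvPolynomial (Fin d) ℝ :=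
  ∑ α, (pderiv α).toLinearMap ∘ₗ (pderiv α).toLinearMap

theorem laplacePoly_apply (f : MvPolynomial (Fin d) ℝ) :
    laplacePoly f = ∑ α, pderiv α (pderiv α f) := by
  simp [laplacePoly]

theorem fischer_normSqPoly_mul (f h : MvPolynomial (Fin d) ℝ) :
    fischer (normSqPoly d * f) h = fischer f (laplacePoly h) := by
  simp only [normSqPoly, Finset.sum_mul, map_sum, LinearMap.sum_apply, laplacePoly_apply, pow_two,
    mul_assoc, fischer_X_mul]

theorem pderiv_comm_apply (α β : Fin d) (f : MvPolynomial (Fin d) ℝ) :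
    pderiv α (pderiv β f) = pderiv β (pderiv α f) := by
  ext m
  simp only [coeff_pderiv]
  by_cases h : α = β
  · subst h; rfl
  · rw [add_right_comm]
    have h1 : (Finsupp.single α 1 : Fin d →₀ ℕ) β = 0 := by simp [h]
    have h2 : (Finsupp.single β 1 : Fin d →₀ ℕ) α = 0 := by simp [Ne.symm h]
    simp [h1, h2]; ring

theorem dirDeriv_linForm (g : Fin d → ℝ) : dirDeriv g (linForm g) = C (∑ α, g α ^ 2) := by
  classical
  simp only [dirDeriv_apply, linForm, map_sum, pderiv_C_mul, pderiv_X, Pi.single_apply]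
  refine Finset.sum_congr rfl fun α _ => ?_
  simp [smul_eq_C_mul, pow_two]

theorem IsHomogeneous.smul' {f : MvPolynomial (Fin d) ℝ} {m : ℕ} (hf : f.IsHomogeneous m) (a : ℝ) :
    (a • f).IsHomogeneous m := by
  rw [smul_eq_C_mul]; exact hf.C_mul a

theorem isHomogeneous_linForm (g : Fin d → ℝ) : (linForm g).IsHomogeneous 1 :=
  IsHomogeneous.sum _ _ _ fun _ _ => isHomogeneous_C_mul_X _ _

theorem isHomogeneous_normSqPoly : (normSqPoly d).IsHomogeneous 2 :=
  IsHomogeneous.sum _ _ _ fun _ _ => isHomogeneous_X_pow _ _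

theorem MvPolynomial.IsHomogeneous.dirDeriv {f : MvPolynomial (Fin d) ℝ} {m : ℕ}
    (hf : f.IsHomogeneous m) (g : Fin d → ℝ) : (dirDeriv g f).IsHomogeneous (m - 1) := by
  rw [dirDeriv_apply]
  exact IsHomogeneous.sum _ _ _ fun α _ => IsHomogeneous.smul' hf.pderiv _

theorem MvPolynomial.IsHomogeneous.laplacePoly {f : MvPolynomial (Fin d) ℝ} {m : ℕ}
    (hf : f.IsHomogeneous m) : (laplacePoly f).IsHomogeneous (m - 2) := by
  rw [laplacePoly_apply]
  exact IsHomogeneous.sum _ _ _ fun α _ => hf.pderiv.pderiv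

theorem sum_fischer_pderiv {f : MvPolynomial (Fin d) ℝ} {m : ℕ} (hf : f.IsHomogeneous m) :
    ∑ α, fischer (pderiv α f) (pderiv α f) = m * fischer f f := by
  simp only [← fischer_X_mul]
  rw [← LinearMap.sum_apply, ← map_sum, hf.sum_X_mul_pderiv, map_nsmul]
  simp

theorem MvPolynomial.IsHomogeneous.pderiv_eq_zero {f : MvPolynomial (Fin d) ℝ}
    (hf : f.IsHomogeneous 0) (α : Fin d) : pderiv α f = 0 := by
  rw [totalDegree_eq_zero_iff_eq_C.1 ((totalDegree_zero_iff_isHomogeneous _).2 hf), pderiv_C]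

/-- The commutator of `Δ` with multiplication by `‖y‖²` is four times the Euler operator plus `2d`.
-/
theorem laplacePoly_normSqPoly_mul {h : MvPolynomial (Fin d) ℝ} {m : ℕ} (hh : h.IsHomogeneous m) :
    laplacePoly (normSqPoly d * h) =
      normSqPoly d * laplacePoly h + ((4 * m + 2 * d : ℕ) : ℝ) • h := by
  classical
  have h1 : ∀ α : Fin d, pderiv α (normSqPoly d) = (2 : ℝ) • X α := fun α => by
    simp only [normSqPoly, map_sum, pderiv_pow, pderiv_X, Pi.single_apply, smul_eq_C_mul]
    simp [map_ofNat]
  have h2 : ∀ α : Fin d, pderiv α (pderiv α (normSqPoly d * h)) =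
      normSqPoly d * pderiv α (pderiv α h) + (4 : ℝ) • (X α * pderiv α h) + (2 : ℝ) • h := fun α => by
    simp only [pderiv_mul, map_add, h1, Derivation.map_smul, pderiv_X_self]
    simp only [smul_eq_C_mul, map_ofNat]
    ring
  simp only [laplacePoly_apply, h2, Finset.sum_add_distrib, ← Finset.mul_sum, ← Finset.smul_sum,
    hh.sum_X_mul_pderiv]
  simp only [Finset.sum_const, Finset.card_univ, Fintype.card_fin, add_assoc, ← Nat.cast_smul_eq_nsmul ℝ,
    smul_smul, ← add_smul]
  push_cast
  rw [mul_comm (4 : ℝ), mul_comm (2 : ℝ)]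

theorem fischer_normSqPoly_mul_self {h : MvPolynomial (Fin d) ℝ} {m : ℕ} (hh : h.IsHomogeneous m) :
    fischer (normSqPoly d * h) (normSqPoly d * h) =
      fischer (laplacePoly h) (laplacePoly h) + (4 * m + 2 * d) * fischer h h := by
  rw [fischer_normSqPoly_mul, laplacePoly_normSqPoly_mul hh, map_add, fischer_comm h,
    fischer_normSqPoly_mul, map_smul]
  simp

/-- With `h = Δf` one has `‖h‖² = ⟨f, ‖y‖² h⟩`, and the commutator relation gives `‖‖y‖² h‖² = ‖Δh‖²
+ (4m + 2d) ‖h‖²`. The bound in degree `m` therefore gives the one in degree `m + 2`, because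
`m(m+d) + 4m + 2d ≤ (m+2)(m+2+d)`. -/
theorem fischer_laplacePoly_le : ∀ {m : ℕ} {f : MvPolynomial (Fin d) ℝ}, f.IsHomogeneous m →
    fischer (laplacePoly f) (laplacePoly f) ≤ (m * (m + d) : ℝ) * fischer f f
  | 0, f, hf => by simp [laplacePoly_apply, hf.pderiv_eq_zero]
  | 1, f, hf => by
    have : laplacePoly f = 0 := by
      rw [laplacePoly_apply]
      exact Finset.sum_eq_zero fun α _ => (IsHomogeneous.pderiv_eq_zero (hf.pderiv (i := α)) α)
    rw [this]
    have := fischer_self_nonneg f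
    simp only [map_zero]
    positivity
  | m + 2, f, hf => by
    set h := laplacePoly f with hdef
    have hh : h.IsHomogeneous m := hf.laplacePoly
    have ih := fischer_laplacePoly_le hh
    have h1 : fischer h h = fischer f (normSqPoly d * h) := by
      rw [fischer_comm f, fischer_normSqPoly_mul]
    have h2 := fischer_normSqPoly_mul_self hh
    set s : ℝ := (m + 2) * (m + 2 + d) with hs
    have hs0 : 0 < s := by positivity
    have h3 := fischer_le_add f (normSqPoly d * h) s hs0
    have hh0 := fischer_self_nonneg h
    have h4 : fischer (normSqPoly d * h) (normSqPoly d * h) ≤ s * fischer h h := by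
      rw [h2, hs]; nlinarith
    have h5 : s⁻¹ * fischer (normSqPoly d * h) (normSqPoly d * h) ≤ fischer h h := by
      rw [inv_mul_le_iff₀ hs0]; exact h4
    push_cast
    linarith

theorem fischer_normSqPoly_mul_self_le {h : MvPolynomial (Fin d) ℝ} {m : ℕ}
    (hh : h.IsHomogeneous m) : fischer (normSqPoly d * h) (normSqPoly d * h) ≤
      ((m + 2) * (m + 2 + d) : ℝ) * fischer h h := by
  have h1 := fischer_normSqPoly_mul_self hh
  have h2 := fischer_laplacePoly_le hh
  have h3 := fischer_self_nonneg h
  nlinarith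

theorem dirDeriv_linForm_mul (g : Fin d → ℝ) (f : MvPolynomial (Fin d) ℝ) :
    dirDeriv g (linForm g * f) = (∑ α, g α ^ 2) • f + linForm g * dirDeriv g f := by
  rw [Derivation.leibniz, dirDeriv_linForm, smul_eq_mul, smul_eq_mul, smul_eq_C_mul]; ring

/-- `∂_g` is adjoint to multiplication by `ℓ_g`, and their commutator is the scalar `|g|²`. -/
theorem fischer_linForm_mul_self (g : Fin d → ℝ) (f : MvPolynomial (Fin d) ℝ) :
    fischer (linForm g * f) (linForm g * f) =
      fischer (dirDeriv g f) (dirDeriv g f) + (∑ α, g α ^ 2) * fischer f f := by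
  rw [fischer_linForm_mul, dirDeriv_linForm_mul, map_add, fischer_comm f (linForm g * _),
    fischer_linForm_mul, map_smul, smul_eq_mul, add_comm]

/-- The operator `ℓ_g ∂_g + (2 |g|² + κ)`. -/
noncomputable def numberOp (g : Fin d → ℝ) (κ : ℝ) :
    MvPolynomial (Fin d) ℝ →ₗ[ℝ] MvPolynomial (Fin d) ℝ :=
  LinearMap.mulLeft ℝ (linForm g) ∘ₗ (dirDeriv g).toLinearMap +
    (2 * ∑ α, g α ^ 2 + κ) • LinearMap.id

theorem numberOp_apply (g : Fin d → ℝ) (κ : ℝ) (f : MvPolynomial (Fin d) ℝ) :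
    numberOp g κ f = linForm g * dirDeriv g f + (2 * ∑ α, g α ^ 2 + κ) • f := by
  simp [numberOp]

theorem fischer_numberOp_comm (g : Fin d → ℝ) (κ : ℝ) (f h : MvPolynomial (Fin d) ℝ) :
    fischer (numberOp g κ f) h = fischer f (numberOp g κ h) := by
  rw [numberOp_apply, numberOp_apply, map_add, map_add, LinearMap.add_apply, fischer_linForm_mul,
    fischer_comm f (linForm g * _), fischer_linForm_mul, fischer_comm (dirDeriv g f)]
  simp

/-- This is the operator inequality `MᵀM ≤ 2H²`. In `H = ℓ_g ∂_g + 2|g|² + κ` the shift `2|g|²` pays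
for the commutators produced by `‖ℓ_g² f‖²`, and `κ` pays for multiplication by `‖y‖²`; the factor
`2` comes from splitting the difference. -/
theorem fischer_linForm_sq_sub_normSqPoly_mul_le (g : Fin d → ℝ) {κ : ℝ} (hκ : 0 ≤ κ)
    {f : MvPolynomial (Fin d) ℝ} {m : ℕ} (hf : f.IsHomogeneous m)
    (hm : ((m + 2) * (m + 2 + d) : ℝ) ≤ κ ^ 2) :
    fischer ((linForm g ^ 2 - normSqPoly d) * f) ((linForm g ^ 2 - normSqPoly d) * f) ≤
      2 * fischer (numberOp g κ f) (numberOp g κ f) := by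
  have h0 := fischer_self_nonneg f
  have h00 := fischer_self_nonneg (dirDeriv g f)
  have h1 := fischer_normSqPoly_mul_self_le hf
  have h2 : fischer (linForm g ^ 2 * f) (linForm g ^ 2 * f) + κ ^ 2 * fischer f f ≤
      fischer (numberOp g κ f) (numberOp g κ f) := by
    have e1 : linForm g ^ 2 * f = linForm g * (linForm g * f) := by ring
    rw [e1, fischer_linForm_mul_self, fischer_linForm_mul_self g f, dirDeriv_linForm_mul, numberOp_apply]
    simp only [map_add, LinearMap.add_apply, map_smul, LinearMap.smul_apply, smul_eq_mul,
      fischer_comm f (linForm g * _), fischer_linForm_mul g (dirDeriv g f) f]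
    have hc : 0 ≤ ∑ α, g α ^ 2 := Finset.sum_nonneg fun α _ => sq_nonneg _
    generalize ∑ α, g α ^ 2 = c at *
    have t1 : 0 ≤ c * fischer (dirDeriv g f) (dirDeriv g f) := mul_nonneg hc h00
    have t2 : 0 ≤ κ * fischer (dirDeriv g f) (dirDeriv g f) := mul_nonneg hκ h00
    have t3 : 0 ≤ c * c * fischer f f := by positivity
    have t4 : 0 ≤ c * κ * fischer f f := by positivity
    nlinarith
  rw [sub_mul]
  have h3 := fischer_add_self_le (linForm g ^ 2 * f) (normSqPoly d * f)
  nlinarith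

/-- Coefficients of the normally ordered expansion of powers of `numberOp`. -/
noncomputable def orderCoeff (c κ : ℝ) : ℕ → ℕ → ℝ
  | 0, 0 => 1
  | 0, _ + 1 => 0
  | q + 1, 0 => (2 * c + κ) * orderCoeff c κ q 0
  | q + 1, j + 1 => orderCoeff c κ q j + ((j + 3) * c + κ) * orderCoeff c κ q (j + 1)

theorem orderCoeff_eq_zero (c κ : ℝ) : ∀ {q j : ℕ}, q < j → orderCoeff c κ q j = 0
  | 0, _ + 1, _ => rfl
  | q + 1, j + 1, h => by
    rw [orderCoeff, orderCoeff_eq_zero c κ (by omega), orderCoeff_eq_zero c κ (by omega)]; simp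

theorem numberOp_linForm_pow_mul (g : Fin d → ℝ) (κ : ℝ) (f : MvPolynomial (Fin d) ℝ) (j : ℕ) :
    numberOp g κ (linForm g ^ j * f) = ((j + 2) * (∑ α, g α ^ 2) + κ) • (linForm g ^ j * f) +
      linForm g ^ (j + 1) * dirDeriv g f := by
  have : dirDeriv g (linForm g ^ j * f) * linForm g =
      (j * ∑ α, g α ^ 2) • (linForm g ^ j * f) + linForm g ^ (j + 1) * dirDeriv g f := by
    rw [Derivation.leibniz, Derivation.leibniz_pow, dirDeriv_linForm]
    simp only [smul_eq_mul, smul_eq_C_mul, C_mul, ← Nat.cast_smul_eq_nsmul ℝ]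
    cases j with
    | zero => simp; ring
    | succ j => simp only [Nat.add_sub_cancel]; ring
  rw [numberOp_apply, mul_comm, this, add_right_comm, ← add_smul]
  congr 2
  ring

/-- Normal ordering: every `∂_g` is moved to the right of every `ℓ_g`. The coefficients depend on
`g` only through `|g|²`. -/
theorem numberOp_pow_apply (g : Fin d → ℝ) (κ : ℝ) (f : MvPolynomial (Fin d) ℝ) (q : ℕ) :
    (numberOp g κ ^ q) f = ∑ j ∈ Finset.range (q + 1), orderCoeff (∑ α, g α ^ 2) κ q j •
      (linForm g ^ j * (dirDeriv g)^[j] f) := by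
  induction q with
  | zero => simp [orderCoeff]
  | succ q ih =>
    rw [pow_succ', Module.End.mul_apply, ih, map_sum]
    simp only [map_smul, numberOp_linForm_pow_mul, smul_add (orderCoeff _ _ _ _), ← Function.iterate_succ_apply',
      Finset.sum_add_distrib]
    rw [Finset.sum_range_succ' _ (q + 1)]
    have eo : ∀ j : ℕ, orderCoeff (∑ α, g α ^ 2) κ (q + 1) (j + 1) •
        (linForm g ^ (j + 1) * (dirDeriv g)^[j + 1] f) =
        orderCoeff (∑ α, g α ^ 2) κ q j • (linForm g ^ (j + 1) * (dirDeriv g)^[j + 1] f) +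
        (((j + 3 : ℝ) * (∑ α, g α ^ 2) + κ) * orderCoeff (∑ α, g α ^ 2) κ q (j + 1)) •
          (linForm g ^ (j + 1) * (dirDeriv g)^[j + 1] f) := fun j => by
      rw [orderCoeff, add_smul]
    have eo0 : orderCoeff (∑ α, g α ^ 2) κ (q + 1) 0 =
      (2 * (∑ α, g α ^ 2) + κ) * orderCoeff (∑ α, g α ^ 2) κ q 0 := rfl
    simp only [eo, eo0, Finset.sum_add_distrib]
    -- The added term with `j = q + 1` vanishes; it makes the unshifted sum as long as the shifted
    -- one.
    have e : ∑ j ∈ Finset.range (q + 1), orderCoeff (∑ α, g α ^ 2) κ q j •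
        ((j + 2 : ℝ) * (∑ α, g α ^ 2) + κ) • (linForm g ^ j * (dirDeriv g)^[j] f) =
      ∑ j ∈ Finset.range (q + 1 + 1), orderCoeff (∑ α, g α ^ 2) κ q j •
        ((j + 2 : ℝ) * (∑ α, g α ^ 2) + κ) • (linForm g ^ j * (dirDeriv g)^[j] f) := by
      rw [Finset.sum_range_succ _ (q + 1), orderCoeff_eq_zero _ _ (Nat.lt_succ_self q), zero_smul,
        add_zero]
    rw [e, Finset.sum_range_succ' _ (q + 1)]
    have e1 : ∀ j : ℕ, orderCoeff (∑ α, g α ^ 2) κ q (j + 1) • (((j + 1 : ℕ) + 2 : ℝ) * (∑ α, g α ^ 2) + κ) •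
        (linForm g ^ (j + 1) * (dirDeriv g)^[j + 1] f) = (((j + 3 : ℝ) * (∑ α, g α ^ 2) + κ) *
        orderCoeff (∑ α, g α ^ 2) κ q (j + 1)) • (linForm g ^ (j + 1) * (dirDeriv g)^[j + 1] f) := fun j => by
      rw [smul_smul]; push_cast; congr 1; ring
    have e0 : orderCoeff (∑ α, g α ^ 2) κ q 0 • (((0 : ℕ) + 2 : ℝ) * (∑ α, g α ^ 2) + κ) •
        (linForm g ^ 0 * (dirDeriv g)^[0] f) = ((2 * (∑ α, g α ^ 2) + κ) *
        orderCoeff (∑ α, g α ^ 2) κ q 0) • (linForm g ^ 0 * (dirDeriv g)^[0] f) := by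
      rw [smul_smul]; push_cast; congr 1; ring
    rw [e0]
    simp only [e1]
    abel

theorem fischer_linForm_pow_mul (g : Fin d → ℝ) (f h : MvPolynomial (Fin d) ℝ) (j : ℕ) :
    fischer (linForm g ^ j * f) h = fischer f ((dirDeriv g)^[j] h) := by
  induction j generalizing h with
  | zero => simp
  | succ j ih => rw [pow_succ', mul_assoc, fischer_linForm_mul, ih, Function.iterate_succ_apply]

/-- A normally ordered monomial `ℓ_g^j ∂_g^j` has quadratic form `‖∂_g^j f‖²`, by adjointness. -/
theorem fischer_numberOp_pow (g : Fin d → ℝ) (κ : ℝ) (f : MvPolynomial (Fin d) ℝ) (q : ℕ) :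
    fischer f ((numberOp g κ ^ q) f) = ∑ j ∈ Finset.range (q + 1),
      orderCoeff (∑ α, g α ^ 2) κ q j * fischer ((dirDeriv g)^[j] f) ((dirDeriv g)^[j] f) := by
  rw [numberOp_pow_apply, map_sum]
  refine Finset.sum_congr rfl fun j _ => ?_
  rw [map_smul, fischer_comm f, fischer_linForm_pow_mul, smul_eq_mul]

end Fischer

/-! ### Gaussian integration by parts for polynomial functions. -/

section GaussianPolynomials
open MvPolynomial

theorem integrable_pow_gaussianReal (k : ℕ) :
    Integrable (fun x : ℝ => x ^ k) (gaussianReal 0 1) :=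
  integrable_pow_of_mem_interior_integrableExpSet (X := id) (by simp) k

theorem integrable_pow_mul_gaussianPDFReal (k : ℕ) :
    Integrable (fun x : ℝ => x ^ k * gaussianPDFReal 0 1 x) := by
  have h := integrable_pow_gaussianReal k
  rw [gaussianReal_of_var_ne_zero _ one_ne_zero, gaussianPDF_def,
    integrable_withDensity_iff_integrable_smul₀' (by fun_prop) (by simp)] at h
  refine h.congr (Filter.Eventually.of_forall fun x => ?_)
  simp only
  rw [ENNReal.toReal_ofReal (gaussianPDFReal_nonneg _ _ _), smul_eq_mul, mul_comm]

/-- Integration by parts, using that `-φ` is an antiderivative of `x φ(x)`. At `k = 0` the truncated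
exponent `k - 1` is multiplied by zero. -/
theorem integral_mul_pow_gaussianReal (k : ℕ) :
    ∫ x, x * x ^ k ∂gaussianReal 0 1 = k * ∫ x, x ^ (k - 1) ∂gaussianReal 0 1 := by
  simp only [integral_gaussianReal_eq_integral_smul one_ne_zero, smul_eq_mul]
  have hv : ∀ x, HasDerivAt (fun x => -gaussianPDFReal 0 1 x) (x * gaussianPDFReal 0 1 x) x := by
    intro x
    simp only [gaussianPDFReal_def, NNReal.coe_one, mul_one, sub_zero]
    have h1 : HasDerivAt (fun x : ℝ => -x ^ 2 / 2) (-x) x := by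
      refine (((hasDerivAt_pow 2 x).fun_neg).div_const 2).congr_deriv ?_
      push_cast; ring
    refine (((h1.exp).const_mul (√(2 * Real.pi))⁻¹).fun_neg).congr_deriv ?_
    ring
  have hu : ∀ x : ℝ, HasDerivAt (fun x => x ^ k) (k * x ^ (k - 1)) x := fun x => hasDerivAt_pow k x
  have i1 : Integrable ((fun x : ℝ => x ^ k) * fun x => x * gaussianPDFReal 0 1 x) := by
    refine (integrable_pow_mul_gaussianPDFReal (k + 1)).congr (Filter.Eventually.of_forall fun x => ?_)
    simp only [Pi.mul_apply]; ring
  have i2 : Integrable ((fun x : ℝ => k * x ^ (k - 1)) * fun x => -gaussianPDFReal 0 1 x) := by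
    refine ((integrable_pow_mul_gaussianPDFReal (k - 1)).const_mul (-k : ℝ)).congr
      (Filter.Eventually.of_forall fun x => ?_)
    simp only [Pi.mul_apply]; ring
  have i3 : Integrable ((fun x : ℝ => x ^ k) * fun x => -gaussianPDFReal 0 1 x) := by
    refine ((integrable_pow_mul_gaussianPDFReal k).neg).congr
      (Filter.Eventually.of_forall fun x => ?_)
    simp only [Pi.mul_apply, Pi.neg_apply]; ring
  have := integral_mul_deriv_eq_deriv_mul_of_integrable (fun x _ => hu x) (fun x _ => hv x) i1 i2 i3
  have e1 : ∫ x : ℝ, gaussianPDFReal 0 1 x * (x * x ^ k) =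
      ∫ x : ℝ, x ^ k * (x * gaussianPDFReal 0 1 x) := by
    congr 1; ext x; ring
  rw [e1, this, ← integral_neg, ← integral_const_mul]
  congr 1; ext x; ring

/-- The standard Gaussian measure on `ℝ^d`. -/
noncomputable abbrev stdGaussianPi (d : ℕ) : Measure (Fin d → ℝ) :=
  Measure.pi fun _ => gaussianReal 0 1

variable {d : ℕ}

theorem eval_monomial_eq_prod (g : Fin d → ℝ) (β : Fin d →₀ ℕ) (b : ℝ) :
    eval g (monomial β b) = b * ∏ i, g i ^ β i := by
  rw [eval_monomial, Finsupp.prod_fintype _ _ fun i => pow_zero _]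

theorem integrable_eval_stdGaussianPi (P : MvPolynomial (Fin d) ℝ) :
    Integrable (fun g => eval g P) (stdGaussianPi d) := by
  induction P using MvPolynomial.induction_on' with
  | monomial β b =>
    simp only [eval_monomial_eq_prod]
    exact (Integrable.fintype_prod fun i => integrable_pow_gaussianReal (β i)).const_mul b
  | add P Q hP hQ => simp only [map_add]; exact hP.add hQ

theorem integral_coord_mul_eval (α : Fin d) (P : MvPolynomial (Fin d) ℝ) :
    ∫ g, g α * eval g P ∂stdGaussianPi d = ∫ g, eval g (pderiv α P) ∂stdGaussianPi d := by
  have hi : ∀ Q : MvPolynomial (Fin d) ℝ, Integrable (fun g => g α * eval g Q) (stdGaussianPi d) :=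
    fun Q => by
      have := integrable_eval_stdGaussianPi (X α * Q)
      simp only [map_mul, eval_X] at this
      exact this
  induction P using MvPolynomial.induction_on' with
  | monomial β b =>
    have h1 : ∀ (γ : Fin d →₀ ℕ) (a : ℝ), ∫ g, eval g (monomial γ a) ∂stdGaussianPi d =
        a * ∏ i, ∫ x, x ^ γ i ∂gaussianReal 0 1 := fun γ a => by
      simp only [eval_monomial_eq_prod]
      rw [integral_const_mul, integral_fintype_prod_eq_prod (fun i x => x ^ γ i)]
    have h2 : ∀ g : Fin d → ℝ, g α * eval g (monomial β b) =
        eval g (monomial (β + Finsupp.single α 1) b) := fun g => by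
      have : (monomial (β + Finsupp.single α 1) b : MvPolynomial (Fin d) ℝ) =
        X α * monomial β b := by rw [mul_comm, X, monomial_mul, mul_one]
      rw [this, map_mul, eval_X]
    simp only [h2]
    rw [pderiv_monomial, h1, h1, ← Finset.mul_prod_erase _ _ (Finset.mem_univ α),
      ← Finset.mul_prod_erase _ (fun i => ∫ x, x ^ (β - Finsupp.single α 1 : Fin d →₀ ℕ) i
        ∂gaussianReal 0 1) (Finset.mem_univ α)]
    have e : ∀ γ : Fin d →₀ ℕ, (∀ i, i ≠ α → γ i = β i) → ∏ i ∈ Finset.univ.erase α,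
        ∫ x, x ^ γ i ∂gaussianReal 0 1 = ∏ i ∈ Finset.univ.erase α, ∫ x, x ^ β i ∂gaussianReal 0 1 :=
      fun γ hγ => Finset.prod_congr rfl fun i hi => by rw [hγ i (Finset.ne_of_mem_erase hi)]
    rw [e (β + Finsupp.single α 1) fun i hi => by simp [hi.symm],
      e (β - Finsupp.single α 1) fun i hi => by simp [hi.symm]]
    have := integral_mul_pow_gaussianReal (β α)
    simp only [← pow_succ'] at this
    simp only [Finsupp.add_apply, Finsupp.single_eq_same, Finsupp.tsub_apply]
    rw [this]; ring
  | add P Q hP hQ =>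
    simp only [map_add, mul_add]
    rw [integral_add (hi P) (hi Q), hP, hQ, integral_add (integrable_eval_stdGaussianPi _)
      (integrable_eval_stdGaussianPi _)]

/-- Polynomial functions on `ℝ^d`. -/
def IsPolyFun (F : (Fin d → ℝ) → ℝ) : Prop := ∃ P : MvPolynomial (Fin d) ℝ, ∀ g, F g = eval g P

namespace IsPolyFun
variable {F G : (Fin d → ℝ) → ℝ}

theorem const (a : ℝ) : IsPolyFun fun _ : Fin d → ℝ => a := ⟨C a, fun g => by simp⟩

theorem coord (α : Fin d) : IsPolyFun fun g : Fin d → ℝ => g α := ⟨X α, fun g => by simp⟩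

theorem add (hF : IsPolyFun F) (hG : IsPolyFun G) : IsPolyFun fun g => F g + G g := by
  obtain ⟨P, hP⟩ := hF
  obtain ⟨Q, hQ⟩ := hG
  exact ⟨P + Q, fun g => by simp [hP, hQ]⟩

theorem mul (hF : IsPolyFun F) (hG : IsPolyFun G) : IsPolyFun fun g => F g * G g := by
  obtain ⟨P, hP⟩ := hF
  obtain ⟨Q, hQ⟩ := hG
  exact ⟨P * Q, fun g => by simp [hP, hQ]⟩

theorem pow (hF : IsPolyFun F) (n : ℕ) : IsPolyFun fun g => F g ^ n := by
  obtain ⟨P, hP⟩ := hF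
  exact ⟨P ^ n, fun g => by simp [hP]⟩

theorem sum {ι : Type*} {s : Finset ι} {F : ι → (Fin d → ℝ) → ℝ} (hF : ∀ i ∈ s, IsPolyFun (F i)) :
    IsPolyFun fun g => ∑ i ∈ s, F i g := by
  classical
  induction s using Finset.induction_on with
  | empty => simpa using const 0
  | insert a s ha ih =>
    simp only [Finset.sum_insert ha]
    exact (hF a (Finset.mem_insert_self a s)).add
      (ih fun i hi => hF i (Finset.mem_insert_of_mem hi))

theorem integrable (hF : IsPolyFun F) : Integrable F (stdGaussianPi d) := by
  obtain ⟨P, hP⟩ := hF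
  rw [funext hP]
  exact integrable_eval_stdGaussianPi P

theorem continuous (hF : IsPolyFun F) : Continuous F := by
  obtain ⟨P, hP⟩ := hF
  rw [funext hP]
  exact MvPolynomial.continuous_eval P

/-- It identifies the formal partial derivative with the analytic one, so that Stein's identity can
be applied to any derivative computed by the rules of calculus. -/
theorem hasDerivAt_eval (P : MvPolynomial (Fin d) ℝ) (α : Fin d) (g : Fin d → ℝ) :
    HasDerivAt (fun s : ℝ => eval (g + s • Pi.single α 1) P) (eval g (pderiv α P)) 0 := by
  classical
  induction P using MvPolynomial.induction_on with
  | C a => simpa using hasDerivAt_const (0 : ℝ) a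
  | add P Q hP hQ => simpa only [map_add] using hP.fun_add hQ
  | mul_X P i hP =>
    have h1 : HasDerivAt (fun s : ℝ => g i + s * (Pi.single α 1 : Fin d → ℝ) i)
        ((Pi.single α 1 : Fin d → ℝ) i) 0 := by
      simpa using ((hasDerivAt_id (0 : ℝ)).mul_const ((Pi.single α 1 : Fin d → ℝ) i)).const_add (g i)
    have := hP.fun_mul h1
    simp only [zero_smul, add_zero, zero_mul] at this
    have e : eval g (pderiv α (P * X i)) = eval g (pderiv α P) * g i +
        eval g P * (Pi.single α 1 : Fin d → ℝ) i := by
      rw [pderiv_mul, pderiv_X]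
      by_cases h : i = α
      · subst h; simp
      · simp [h]
    rw [e]
    simpa only [map_mul, eval_X, Pi.add_apply, Pi.smul_apply, smul_eq_mul] using this

/-- Stein's identity for polynomial functions. -/
theorem integral_coord_mul (hF : IsPolyFun F) {α : Fin d} (hFG : ∀ g, HasDerivAt
    (fun s : ℝ => F (g + s • Pi.single α 1)) (G g) 0) :
    ∫ g, g α * F g ∂stdGaussianPi d = ∫ g, G g ∂stdGaussianPi d := by
  obtain ⟨P, hP⟩ := hF
  have : ∀ g, G g = eval g (pderiv α P) := fun g =>
    (hFG g).unique (by simpa only [hP] using hasDerivAt_eval P α g)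
  simp only [hP, this]
  exact integral_coord_mul_eval α P

theorem integral_add_add {F G H : (Fin d → ℝ) → ℝ} (hF : IsPolyFun F) (hG : IsPolyFun G)
    (hH : IsPolyFun H) (a b c : ℝ) :
    ∫ g, (a * F g + b * G g + c * H g) ∂stdGaussianPi d = a * ∫ g, F g ∂stdGaussianPi d +
      b * ∫ g, G g ∂stdGaussianPi d + c * ∫ g, H g ∂stdGaussianPi d := by
  have h1 := hF.integrable.const_mul a
  have h2 := hG.integrable.const_mul b
  have h12 : Integrable (fun g => a * F g + b * G g) (stdGaussianPi d) := h1.add h2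
  rw [integral_add h12 (hH.integrable.const_mul c), integral_add h1 h2, integral_const_mul,
    integral_const_mul, integral_const_mul]

end IsPolyFun

end GaussianPolynomials

/-! ### Stein's identity for iterated derivatives in a Gaussian direction. -/

section GaussianDerivatives
open MvPolynomial
variable {d : ℕ}

theorem iterate_dirDeriv_sum (g a : Fin d → ℝ) (x : Fin d → MvPolynomial (Fin d) ℝ) (j : ℕ) :
    (dirDeriv g)^[j] (∑ α, a α • x α) = ∑ α, a α • (dirDeriv g)^[j] (x α) := by
  have h : ∀ y, (dirDeriv g)^[j] y = ((dirDeriv g).toLinearMap ^ j) y := fun y => by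
    rw [Module.End.pow_apply]; rfl
  simp only [h, map_sum, map_smul]

theorem iterate_dirDeriv_succ (g : Fin d → ℝ) (f : MvPolynomial (Fin d) ℝ) (j : ℕ) :
    (dirDeriv g)^[j + 1] f = ∑ α, g α • (dirDeriv g)^[j] (pderiv α f) := by
  rw [Function.iterate_succ_apply, dirDeriv_apply, iterate_dirDeriv_sum]

theorem isPolyFun_linearMap_iterate_dirDeriv (L : MvPolynomial (Fin d) ℝ →ₗ[ℝ] ℝ)
    (f : MvPolynomial (Fin d) ℝ) (j : ℕ) : IsPolyFun fun g => L ((dirDeriv g)^[j] f) := by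
  induction j generalizing f with
  | zero => exact .const (L f)
  | succ j ih =>
    simp only [iterate_dirDeriv_succ, map_sum, map_smul, smul_eq_mul]
    exact .sum fun α _ => (IsPolyFun.coord α).mul (ih _)

theorem isPolyFun_fischer_iterate_dirDeriv (f h : MvPolynomial (Fin d) ℝ) (j k : ℕ) :
    IsPolyFun fun g => fischer ((dirDeriv g)^[j] f) ((dirDeriv g)^[k] h) := by
  induction j generalizing f with
  | zero => exact isPolyFun_linearMap_iterate_dirDeriv (fischer f) h k
  | succ j ih =>
    simp only [iterate_dirDeriv_succ, map_sum, map_smul, smul_eq_mul, LinearMap.sum_apply,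
      LinearMap.smul_apply]
    exact .sum fun α _ => (IsPolyFun.coord α).mul (by simpa [iterate_dirDeriv_succ] using ih _)

theorem isPolyFun_normSq : IsPolyFun fun g : Fin d → ℝ => ∑ α, g α ^ 2 :=
  .sum fun α _ => (IsPolyFun.coord α).pow 2

theorem hasDerivAt_coord (g : Fin d → ℝ) (α β : Fin d) :
    HasDerivAt (fun s : ℝ => (g + s • Pi.single α 1 : Fin d → ℝ) β) ((Pi.single α 1 : Fin d → ℝ) β) 0 := by
  simpa using ((hasDerivAt_id (0 : ℝ)).mul_const ((Pi.single α 1 : Fin d → ℝ) β)).const_add (g β)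

theorem hasDerivAt_normSq_pow (g : Fin d → ℝ) (α : Fin d) (i : ℕ) :
    HasDerivAt (fun s : ℝ => (∑ β, (g + s • Pi.single α 1 : Fin d → ℝ) β ^ 2) ^ i)
      (i * (∑ β, g β ^ 2) ^ (i - 1) * (2 * g α)) 0 := by
  classical
  have h1 : HasDerivAt (fun s : ℝ => ∑ β, (g + s • Pi.single α 1 : Fin d → ℝ) β ^ 2) (2 * g α) 0 := by
    have := HasDerivAt.fun_sum (u := Finset.univ) fun β _ => (hasDerivAt_coord g α β).fun_pow 2
    refine this.congr_deriv ?_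
    simp [Pi.single_apply]
  simpa using h1.fun_pow i

/-- `∂_g^j` is the `j`-th power of a form linear in `g` with commuting coefficients `∂_α`, so it is
differentiated in `g` like an ordinary power. -/
theorem hasDerivAt_linearMap_iterate_dirDeriv (L : MvPolynomial (Fin d) ℝ →ₗ[ℝ] ℝ)
    (f : MvPolynomial (Fin d) ℝ) (j : ℕ) (g : Fin d → ℝ) (α : Fin d) :
    HasDerivAt (fun s : ℝ => L ((dirDeriv (g + s • Pi.single α 1))^[j] f))
      (j * L ((dirDeriv g)^[j - 1] (pderiv α f))) 0 := by
  classical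
  induction j generalizing f with
  | zero => simpa using hasDerivAt_const (0 : ℝ) (L f)
  | succ j ih =>
    simp only [iterate_dirDeriv_succ, map_sum, map_smul, smul_eq_mul]
    have := HasDerivAt.fun_sum (u := Finset.univ) fun β _ =>
      (hasDerivAt_coord g α β).fun_mul (ih (pderiv β f))
    refine this.congr_deriv ?_
    rw [Finset.sum_add_distrib]
    have e1 : ∑ β, (Pi.single α 1 : Fin d → ℝ) β *
        L ((dirDeriv (g + (0 : ℝ) • Pi.single α 1))^[j] (pderiv β f)) =
        L ((dirDeriv g)^[j] (pderiv α f)) := by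
      simp [Pi.single_apply]
    rw [e1]
    have e2 : ∑ β, (g + (0 : ℝ) • Pi.single α 1 : Fin d → ℝ) β *
        (j * L ((dirDeriv g)^[j - 1] (pderiv α (pderiv β f)))) =
        j * L ((dirDeriv g)^[j] (pderiv α f)) := by
      cases j with
      | zero => simp
      | succ j =>
        simp only [zero_smul, add_zero, iterate_dirDeriv_succ, map_sum, map_smul, smul_eq_mul,
          Finset.mul_sum, Nat.add_sub_cancel, pderiv_comm_apply α]
        exact Finset.sum_congr rfl fun β _ => by ring
    rw [e2]
    push_cast
    try simp only [Nat.add_sub_cancel]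
    ring

theorem hasDerivAt_fischer_iterate_dirDeriv (f h : MvPolynomial (Fin d) ℝ) (j k : ℕ)
    (g : Fin d → ℝ) (α : Fin d) :
    HasDerivAt (fun s : ℝ => fischer ((dirDeriv (g + s • Pi.single α 1))^[j] f)
        ((dirDeriv (g + s • Pi.single α 1))^[k] h))
      (j * fischer ((dirDeriv g)^[j - 1] (pderiv α f)) ((dirDeriv g)^[k] h) +
        k * fischer ((dirDeriv g)^[j] f) ((dirDeriv g)^[k - 1] (pderiv α h))) 0 := by
  classical
  induction j generalizing f with
  | zero => simpa using hasDerivAt_linearMap_iterate_dirDeriv (fischer f) h k g α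
  | succ j ih =>
    have e : ∀ g' : Fin d → ℝ, fischer ((dirDeriv g')^[j + 1] f) ((dirDeriv g')^[k] h) =
        ∑ β, g' β * fischer ((dirDeriv g')^[j] (pderiv β f)) ((dirDeriv g')^[k] h) := fun g' => by
      simp only [iterate_dirDeriv_succ g' f, map_sum, map_smul, smul_eq_mul, LinearMap.sum_apply,
        LinearMap.smul_apply]
    simp only [e]
    have := HasDerivAt.fun_sum (u := Finset.univ) fun β _ =>
      (hasDerivAt_coord g α β).fun_mul (ih (pderiv β f))
    refine this.congr_deriv ?_
    rw [Finset.sum_add_distrib]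
    have e1 : ∑ β, (Pi.single α 1 : Fin d → ℝ) β *
        fischer ((dirDeriv (g + (0 : ℝ) • Pi.single α 1))^[j] (pderiv β f))
          ((dirDeriv (g + (0 : ℝ) • Pi.single α 1))^[k] h) =
        fischer ((dirDeriv g)^[j] (pderiv α f)) ((dirDeriv g)^[k] h) := by
      simp [Pi.single_apply]
    have e2 : ∑ β, (g + (0 : ℝ) • Pi.single α 1 : Fin d → ℝ) β *
        (j * fischer ((dirDeriv g)^[j - 1] (pderiv α (pderiv β f))) ((dirDeriv g)^[k] h) +
          k * fischer ((dirDeriv g)^[j] (pderiv β f)) ((dirDeriv g)^[k - 1] (pderiv α h))) =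
        j * fischer ((dirDeriv g)^[j] (pderiv α f)) ((dirDeriv g)^[k] h) +
          k * fischer ((dirDeriv g)^[j + 1] f) ((dirDeriv g)^[k - 1] (pderiv α h)) := by
      simp only [zero_smul, add_zero, mul_add, Finset.sum_add_distrib]
      congr 1
      · cases j with
        | zero => simp
        | succ j =>
          simp only [iterate_dirDeriv_succ g (pderiv α f) j, map_sum, map_smul, smul_eq_mul,
            LinearMap.sum_apply, LinearMap.smul_apply, Finset.mul_sum, Nat.add_sub_cancel,
            pderiv_comm_apply α]
          exact Finset.sum_congr rfl fun β _ => by ring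
      · simp only [iterate_dirDeriv_succ g f, map_sum, map_smul, smul_eq_mul, LinearMap.sum_apply,
          LinearMap.smul_apply, Finset.mul_sum]
        exact Finset.sum_congr rfl fun β _ => by ring
    rw [e1, e2]
    push_cast
    try simp only [Nat.add_sub_cancel]
    ring

theorem sum_iterate_dirDeriv_pderiv_pderiv (g : Fin d → ℝ) (f : MvPolynomial (Fin d) ℝ) (j : ℕ) :
    ∑ α, (dirDeriv g)^[j] (pderiv α (pderiv α f)) = (dirDeriv g)^[j] (laplacePoly f) := by
  have := iterate_dirDeriv_sum g (fun _ => 1) (fun α => pderiv α (pderiv α f)) j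
  simpa [laplacePoly_apply] using this.symm

/-- The Gaussian moments `E |g|^{2i} ‖∂_g^j f‖²`. -/
noncomputable def dirMoment (i j : ℕ) (f : MvPolynomial (Fin d) ℝ) : ℝ :=
  ∫ g, (∑ α, g α ^ 2) ^ i * fischer ((dirDeriv g)^[j] f) ((dirDeriv g)^[j] f) ∂stdGaussianPi d

theorem isPolyFun_normSq_pow_mul_fischer (i j k : ℕ) (f h : MvPolynomial (Fin d) ℝ) :
    IsPolyFun fun g => (∑ α, g α ^ 2) ^ i *
      fischer ((dirDeriv g)^[j] f) ((dirDeriv g)^[k] h) :=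
  (isPolyFun_normSq.pow i).mul (isPolyFun_fischer_iterate_dirDeriv f h j k)

/-- One factor `∂_g` is written as `∑ g_α ∂_α` and `g_α` is integrated by parts. The derivative
falls on `|g|^(2i)`, on the remaining `∂_g^j` (where the two `∂_α` combine into `Δ`), or on `∂_g^k`.
-/
theorem integral_fischer_dirDeriv_succ (i j k : ℕ) (f h : MvPolynomial (Fin d) ℝ) :
    ∫ g, (∑ α, g α ^ 2) ^ i * fischer ((dirDeriv g)^[j + 1] f) ((dirDeriv g)^[k] h)
        ∂stdGaussianPi d =
      2 * i * ∫ g, (∑ α, g α ^ 2) ^ (i - 1) *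
        fischer ((dirDeriv g)^[j + 1] f) ((dirDeriv g)^[k] h) ∂stdGaussianPi d +
      j * ∫ g, (∑ α, g α ^ 2) ^ i *
        fischer ((dirDeriv g)^[j - 1] (laplacePoly f)) ((dirDeriv g)^[k] h) ∂stdGaussianPi d +
      k * ∑ α, ∫ g, (∑ α, g α ^ 2) ^ i * fischer ((dirDeriv g)^[j] (pderiv α f))
        ((dirDeriv g)^[k - 1] (pderiv α h)) ∂stdGaussianPi d := by
  have e : ∀ g : Fin d → ℝ, (∑ α, g α ^ 2) ^ i *
      fischer ((dirDeriv g)^[j + 1] f) ((dirDeriv g)^[k] h) = ∑ α, g α * ((∑ α, g α ^ 2) ^ i *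
        fischer ((dirDeriv g)^[j] (pderiv α f)) ((dirDeriv g)^[k] h)) := fun g => by
    simp only [iterate_dirDeriv_succ g f, map_sum, map_smul, smul_eq_mul, LinearMap.sum_apply,
        LinearMap.smul_apply, Finset.mul_sum]
    exact Finset.sum_congr rfl fun β _ => by ring
  have hP := fun α => isPolyFun_normSq_pow_mul_fischer i j k (pderiv α f) h
  have hS : ∀ α : Fin d, ∫ g, g α * ((∑ α, g α ^ 2) ^ i *
      fischer ((dirDeriv g)^[j] (pderiv α f)) ((dirDeriv g)^[k] h)) ∂stdGaussianPi d = _ := fun α =>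
    (hP α).integral_coord_mul fun g => (hasDerivAt_normSq_pow g α i).fun_mul
      (hasDerivAt_fischer_iterate_dirDeriv (pderiv α f) h j k g α)
  calc _ = ∑ α, ∫ g, g α * ((∑ α, g α ^ 2) ^ i *
      fischer ((dirDeriv g)^[j] (pderiv α f)) ((dirDeriv g)^[k] h)) ∂stdGaussianPi d := by
        rw [← integral_finsetSum _ fun α _ => ((IsPolyFun.coord α).mul (hP α)).integrable]
        exact integral_congr_ae (Filter.Eventually.of_forall e)
    _ = ∫ g, (2 * i * ((∑ α, g α ^ 2) ^ (i - 1) *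
          fischer ((dirDeriv g)^[j + 1] f) ((dirDeriv g)^[k] h)) +
        j * ((∑ α, g α ^ 2) ^ i *
          fischer ((dirDeriv g)^[j - 1] (laplacePoly f)) ((dirDeriv g)^[k] h)) +
        k * ∑ α, (∑ α, g α ^ 2) ^ i * fischer ((dirDeriv g)^[j] (pderiv α f))
          ((dirDeriv g)^[k - 1] (pderiv α h))) ∂stdGaussianPi d := by
        simp only [hS]
        rw [← integral_finsetSum]
        · refine integral_congr_ae (Filter.Eventually.of_forall fun g => ?_)
          simp only [zero_smul, add_zero, mul_add, Finset.sum_add_distrib]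
          rw [← add_assoc]
          congr 1
          · congr 1
            · simp only [iterate_dirDeriv_succ g f, map_sum, map_smul, smul_eq_mul,
                LinearMap.sum_apply, LinearMap.smul_apply, Finset.mul_sum]
              exact Finset.sum_congr rfl fun β _ => by ring
            · simp only [← sum_iterate_dirDeriv_pderiv_pderiv, map_sum, LinearMap.sum_apply,
                Finset.mul_sum]
              exact Finset.sum_congr rfl fun β _ => by ring
          · rw [Finset.mul_sum]
            exact Finset.sum_congr rfl fun β _ => by ring
        · intro α _
          simp only [zero_smul, add_zero]
          refine IsPolyFun.integrable (.add (.mul (.mul (.mul (.const _) (isPolyFun_normSq.pow _))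
            (.mul (.const _) (.coord α))) (isPolyFun_fischer_iterate_dirDeriv _ _ _ _))
            (.mul (isPolyFun_normSq.pow _) (.add (.mul (.const _)
              (isPolyFun_fischer_iterate_dirDeriv _ _ _ _)) (.mul (.const _)
              (isPolyFun_fischer_iterate_dirDeriv _ _ _ _)))))
    _ = _ := by
        rw [(isPolyFun_normSq_pow_mul_fischer _ _ _ _ _).integral_add_add
          (isPolyFun_normSq_pow_mul_fischer _ _ _ _ _)
          (.sum fun α _ => isPolyFun_normSq_pow_mul_fischer _ _ _ _ _), integral_finsetSum _ fun α _ =>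
            (isPolyFun_normSq_pow_mul_fischer _ _ _ _ _).integrable]

end GaussianDerivatives

/-! ### Gaussian moments of `∂_g^j f`, of powers of `H`, and of the adjoint of `M`. -/

section MomentBounds
open MvPolynomial
variable {d : ℕ}

theorem integral_normSq_pow_succ (i : ℕ) :
    ∫ g, (∑ α : Fin d, g α ^ 2) ^ (i + 1) ∂stdGaussianPi d =
      (d + 2 * i) * ∫ g, (∑ α : Fin d, g α ^ 2) ^ i ∂stdGaussianPi d := by
  have e : ∀ g : Fin d → ℝ, (∑ α, g α ^ 2) ^ (i + 1) =
      ∑ α, g α * (g α * (∑ α, g α ^ 2) ^ i) := fun g => by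
    rw [pow_succ', Finset.sum_mul]
    exact Finset.sum_congr rfl fun α _ => by ring
  have hP : ∀ α : Fin d, IsPolyFun fun g : Fin d → ℝ => g α * (∑ α, g α ^ 2) ^ i :=
    fun α => (IsPolyFun.coord α).mul (isPolyFun_normSq.pow i)
  have hS : ∀ α : Fin d, ∫ g, g α * (g α * (∑ α, g α ^ 2) ^ i) ∂stdGaussianPi d = _ := fun α =>
    (hP α).integral_coord_mul fun g => (hasDerivAt_coord g α α).fun_mul (hasDerivAt_normSq_pow g α i)
  simp only [e]
  rw [integral_finsetSum _ fun α _ => ((IsPolyFun.coord α).mul (hP α)).integrable]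
  simp only [hS, zero_smul, add_zero, Pi.single_eq_same, one_mul]
  rw [← integral_finsetSum, ← integral_const_mul]
  · refine integral_congr_ae (Filter.Eventually.of_forall fun g => ?_)
    simp only [Finset.sum_add_distrib, Finset.sum_const, Finset.card_univ, Fintype.card_fin,
      nsmul_eq_mul]
    have : ∑ α, g α * (i * (∑ β, g β ^ 2) ^ (i - 1) * (2 * g α)) =
        2 * i * ((∑ β, g β ^ 2) ^ (i - 1) * ∑ α, g α ^ 2) := by
      simp only [Finset.mul_sum]
      exact Finset.sum_congr rfl fun α _ => by ring
    rw [this]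
    cases i with
    | zero => simp
    | succ i => rw [Nat.add_sub_cancel, ← pow_succ]; ring
  · exact fun α _ => IsPolyFun.integrable (.add (isPolyFun_normSq.pow _) (.mul (.coord α)
      (.mul (.mul (.const _) (isPolyFun_normSq.pow _)) (.mul (.const _) (.coord α)))))

theorem integral_normSq_pow_le {B : ℝ} {Q : ℕ} (hB : (d : ℝ) + 2 * Q ≤ B) {i : ℕ} (hi : i ≤ Q) :
    ∫ g, (∑ α : Fin d, g α ^ 2) ^ i ∂stdGaussianPi d ≤ B ^ i := by
  induction i with
  | zero => simp
  | succ i ih =>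
    have h0 : 0 ≤ ∫ g, (∑ α : Fin d, g α ^ 2) ^ i ∂stdGaussianPi d :=
      integral_nonneg fun _ => pow_nonneg (Finset.sum_nonneg fun _ _ => sq_nonneg _) _
    have hiQ : (i : ℝ) ≤ Q := by exact_mod_cast (by omega : i ≤ Q)
    have h1 : (d : ℝ) + 2 * i ≤ B := by linarith
    rw [integral_normSq_pow_succ, pow_succ']
    exact mul_le_mul h1 (ih (by omega)) h0 (le_trans (by positivity) h1)

theorem dirMoment_zero (i : ℕ) (f : MvPolynomial (Fin d) ℝ) :
    dirMoment i 0 f = (∫ g, (∑ α : Fin d, g α ^ 2) ^ i ∂stdGaussianPi d) * fischer f f := by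
  simp [dirMoment, integral_mul_const]

theorem dirMoment_succ_le (i j : ℕ) (f : MvPolynomial (Fin d) ℝ) :
    dirMoment i (j + 1) f ≤ 4 * i * dirMoment (i - 1) (j + 1) f +
      j ^ 2 * dirMoment i (j - 1) (laplacePoly f) +
      2 * (j + 1) * ∑ α, dirMoment i j (pderiv α f) := by
  have h := integral_fischer_dirDeriv_succ i j (j + 1) f f
  -- The cross term between `∂_g^(j-1) Δf` and `∂_g^(j+1) f` is split by `2 ⟨jx, y⟩ ≤ j² ‖x‖² +
  -- ‖y‖²`. Half of the left side is absorbed, which doubles the other coefficients.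
  have hc : j * ∫ g, (∑ α, g α ^ 2) ^ i * fischer ((dirDeriv g)^[j - 1] (laplacePoly f))
        ((dirDeriv g)^[j + 1] f) ∂stdGaussianPi d ≤
      1 / 2 * j ^ 2 * dirMoment i (j - 1) (laplacePoly f) + 1 / 2 * dirMoment i (j + 1) f := by
    rw [dirMoment, dirMoment, ← integral_const_mul, ← integral_const_mul, ← integral_const_mul,
      ← integral_add
        ((isPolyFun_normSq_pow_mul_fischer _ _ _ _ _).integrable.const_mul _)
        ((isPolyFun_normSq_pow_mul_fischer _ _ _ _ _).integrable.const_mul _)]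
    refine integral_mono ((isPolyFun_normSq_pow_mul_fischer _ _ _ _ _).integrable.const_mul _)
      (((isPolyFun_normSq_pow_mul_fischer _ _ _ _ _).integrable.const_mul _).add
        ((isPolyFun_normSq_pow_mul_fischer _ _ _ _ _).integrable.const_mul _)) fun g => ?_
    have h0 : 0 ≤ (∑ α, g α ^ 2) ^ i := pow_nonneg (Finset.sum_nonneg fun _ _ => sq_nonneg _) _
    set x := (dirDeriv g)^[j - 1] (laplacePoly f)
    set y := (dirDeriv g)^[j + 1] f
    have h1 := fischer_self_nonneg ((j : ℝ) • x - y)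
    simp only [map_sub, LinearMap.sub_apply, map_smul, LinearMap.smul_apply, smul_eq_mul,
      fischer_comm y x] at h1
    have h2 := mul_nonneg h0 h1
    simp only
    linarith
  simp only [Nat.add_sub_cancel] at h
  change dirMoment i (j + 1) f = 2 * i * dirMoment (i - 1) (j + 1) f + _ +
    ((j + 1 : ℕ) : ℝ) * ∑ α, dirMoment i j (pderiv α f) at h
  push_cast at h
  linarith

/-- The shared induction step. Relative to the target, the three terms of the recursion cost `1/10`
(by hypothesis), `1/16` (from `‖Δf‖² ≤ D² ‖f‖²`) and `1/2` (from `∑ ‖∂_α f‖² = m ‖f‖² ≤ D ‖f‖²`),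
together less than one. -/
theorem dirMoment_succ_le_of_le {B D : ℝ} (hB : 0 ≤ B) (hD : 0 ≤ D) {i j m : ℕ}
    {f : MvPolynomial (Fin d) ℝ} (h₀ : 4 * (i : ℝ) * dirMoment (i - 1) (j + 1) f ≤
      1 / 10 * (B ^ i * (4 * D) ^ (j + 1) * (j + 1)! * fischer f f)) (hf : f.IsHomogeneous m)
    (hm : (m * (m + d) : ℝ) ≤ D ^ 2)
    (h₁ : ∀ (f' : MvPolynomial (Fin d) ℝ) (m' : ℕ), f'.IsHomogeneous m' →
      (m' * (m' + d) : ℝ) ≤ D ^ 2 → dirMoment i j f' ≤ B ^ i * (4 * D) ^ j * j ! * fischer f' f')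
    (h₂ : ∀ j' < j, ∀ (f' : MvPolynomial (Fin d) ℝ) (m' : ℕ), f'.IsHomogeneous m' →
      (m' * (m' + d) : ℝ) ≤ D ^ 2 →
        dirMoment i j' f' ≤ B ^ i * (4 * D) ^ j' * j' ! * fischer f' f') :
    dirMoment i (j + 1) f ≤ B ^ i * (4 * D) ^ (j + 1) * (j + 1)! * fischer f f := by
  have key := dirMoment_succ_le i j f
  have hm1 : (m : ℝ) ≤ D := by
    refine abs_le_of_sq_le_sq' ?_ hD |>.2
    nlinarith [mul_nonneg (Nat.cast_nonneg (α := ℝ) m) (Nat.cast_nonneg (α := ℝ) d)]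
  have hm2 : ((m - 1 : ℕ) * ((m - 1 : ℕ) + d) : ℝ) ≤ D ^ 2 := le_trans (by gcongr <;> simp) hm
  have hm3 : ((m - 2 : ℕ) * ((m - 2 : ℕ) + d) : ℝ) ≤ D ^ 2 := le_trans (by gcongr <;> simp) hm
  have hf0 := fischer_self_nonneg f
  set T := B ^ i * (4 * D) ^ (j + 1) * (j + 1)! * fischer f f with hT
  have hT0 : 0 ≤ T := by positivity
  have t3 : 2 * (j + 1 : ℝ) * ∑ α, dirMoment i j (pderiv α f) ≤ 1 / 2 * T := by
    have h3 : ∑ α, dirMoment i j (pderiv α f) ≤ B ^ i * (4 * D) ^ j * j ! * (D * fischer f f) := by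
      refine (Finset.sum_le_sum fun α _ => h₁ _ _ hf.pderiv hm2).trans ?_
      rw [← Finset.mul_sum, sum_fischer_pderiv hf]
      gcongr
    refine (mul_le_mul_of_nonneg_left h3 (by positivity)).trans_eq ?_
    rw [hT, Nat.factorial_succ]; push_cast; ring
  have t2 : (j : ℝ) ^ 2 * dirMoment i (j - 1) (laplacePoly f) ≤ 1 / 16 * T := by
    cases j with
    | zero => simpa using hT0
    | succ j =>
      have h4 := h₂ j (Nat.lt_succ_self j) _ _ hf.laplacePoly hm3
      have h5 : fischer (laplacePoly f) (laplacePoly f) ≤ D ^ 2 * fischer f f :=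
        (fischer_laplacePoly_le hf).trans (mul_le_mul_of_nonneg_right hm hf0)
      have h6 : dirMoment i j (laplacePoly f) ≤
          B ^ i * (4 * D) ^ j * j ! * (D ^ 2 * fischer f f) := h4.trans (by gcongr)
      set Z := B ^ i * (4 * D) ^ j * j ! * (D ^ 2 * fischer f f) with hZ
      have hZ0 : 0 ≤ Z := by positivity
      have hTZ : T = 16 * ((j + 2) * (j + 1)) * Z := by
        rw [hT, hZ, Nat.factorial_succ, Nat.factorial_succ]; push_cast; ring
      rw [hTZ, Nat.add_sub_cancel]
      refine (mul_le_mul_of_nonneg_left h6 (by positivity)).trans ?_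
      push_cast
      have : (0 : ℝ) ≤ j * Z := by positivity
      nlinarith
  linarith

/-- Strong induction on `j`, then induction on `i`. The condition `d + 2Q ≤ B` handles the moments
of `|g|²` at `j = 0`; `40 Q ≤ B` makes the term with a lowered power of `|g|²` cost at most `4i/B ≤
1/10`. -/
theorem dirMoment_le {B D : ℝ} {Q : ℕ} (hB1 : (d : ℝ) + 2 * Q ≤ B) (hB2 : 40 * (Q : ℝ) ≤ B)
    (hD : 0 ≤ D) (j : ℕ) : ∀ (i m : ℕ) (f : MvPolynomial (Fin d) ℝ), i ≤ Q → f.IsHomogeneous m →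
      (m * (m + d) : ℝ) ≤ D ^ 2 → dirMoment i j f ≤ B ^ i * (4 * D) ^ j * j ! * fischer f f := by
  have hB : 0 ≤ B := le_trans (by positivity) hB2
  induction j using Nat.strong_induction_on with
  | _ j ihj =>
  cases j with
  | zero =>
    intro i m f hi _ _
    rw [dirMoment_zero]
    simpa using mul_le_mul_of_nonneg_right (integral_normSq_pow_le hB1 hi) (fischer_self_nonneg f)
  | succ j =>
    intro i
    induction i with
    | zero =>
      intro m f hi hf hm
      have hf0 := fischer_self_nonneg f
      exact dirMoment_succ_le_of_le hB hD (by simp only [Nat.cast_zero, mul_zero, zero_mul]; positivity) hf hm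
        (fun f' m' hf' hm' => ihj j (Nat.lt_succ_self j) 0 m' f' hi hf' hm')
        fun j' hj' f' m' hf' hm' => ihj j' (by omega) 0 m' f' hi hf' hm'
    | succ i ihi =>
      intro m f hi hf hm
      refine dirMoment_succ_le_of_le hB hD ?_ hf hm
        (fun f' m' hf' hm' => ihj j (Nat.lt_succ_self j) (i + 1) m' f' hi hf' hm')
        fun j' hj' f' m' hf' hm' => ihj j' (by omega) (i + 1) m' f' hi hf' hm'
      have h1 := ihi m f (by omega) hf hm
      have hiQ : ((i + 1 : ℕ) : ℝ) ≤ Q := by exact_mod_cast hi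
      have h2 : 40 * ((i + 1 : ℕ) : ℝ) ≤ B := by linarith
      set Z := (4 * D) ^ (j + 1) * (j + 1)! * fischer f f with hZ
      have hZ0 : 0 ≤ Z := by have := fischer_self_nonneg f; positivity
      have e1 : B ^ i * (4 * D) ^ (j + 1) * (j + 1)! * fischer f f = B ^ i * Z := by rw [hZ]; ring
      have e2 : B ^ (i + 1) * (4 * D) ^ (j + 1) * (j + 1)! * fischer f f = B * (B ^ i * Z) := by
        rw [hZ]; ring
      rw [e1] at h1
      rw [e2, Nat.add_sub_cancel]
      have h3 : 0 ≤ B ^ i * Z := by positivity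
      calc 4 * ((i + 1 : ℕ) : ℝ) * dirMoment i (j + 1) f ≤ 4 * ((i + 1 : ℕ) : ℝ) * (B ^ i * Z) := by gcongr
        _ ≤ 1 / 10 * (B * (B ^ i * Z)) := by nlinarith

theorem orderCoeff_succ_zero (c κ : ℝ) (q : ℕ) :
    orderCoeff c κ (q + 1) 0 = (2 * c + κ) * orderCoeff c κ q 0 := rfl

theorem orderCoeff_succ_succ (c κ : ℝ) (q j : ℕ) : orderCoeff c κ (q + 1) (j + 1) =
    orderCoeff c κ q j + ((j + 3) * c + κ) * orderCoeff c κ q (j + 1) := rfl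

/-- Coefficients `E |g|^{2i} c_{q,j}(|g|²) Y` of the normally ordered expansion are controlled by
the moments of `Y`. -/
theorem integral_orderCoeff_mul_le {B κ y : ℝ} {Q : ℕ} (hB : 0 < B) (hκ0 : 0 ≤ κ) (hκ : κ ≤ B)
    {Y : (Fin d → ℝ) → ℝ} (hY : IsPolyFun Y) (hy : 0 ≤ y)
    (hYi : ∀ i ≤ Q, ∫ g, (∑ α, g α ^ 2) ^ i * Y g ∂stdGaussianPi d ≤ B ^ i * y) (q : ℕ) :
    ∀ j i : ℕ, i + q ≤ Q →
      (IsPolyFun fun g : Fin d → ℝ => orderCoeff (∑ α, g α ^ 2) κ q j) ∧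
      (∫ g, (∑ α, g α ^ 2) ^ i * (orderCoeff (∑ α, g α ^ 2) κ q j * Y g) ∂stdGaussianPi d) * j ! ≤
        2 ^ q * (j + 3) ^ q * B ^ (i + q) * (B⁻¹) ^ j * y := by
  induction q with
  | zero =>
    intro j i hi
    cases j with
    | zero => exact ⟨.const 1, by simpa [orderCoeff] using hYi i hi⟩
    | succ j => exact ⟨.const 0, by simp only [orderCoeff, zero_mul, mul_zero, integral_zero]; positivity⟩
  | succ q ih =>
    intro j i hi
    have hc : IsPolyFun fun g : Fin d → ℝ => ∑ α, g α ^ 2 := isPolyFun_normSq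
    cases j with
    | zero =>
      obtain ⟨hp, h1⟩ := ih 0 (i + 1) (by omega)
      obtain ⟨-, h2⟩ := ih 0 i (by omega)
      refine ⟨((hc.mul (.const 2)).add (.const κ)).mul hp |> fun h => ?_, ?_⟩
      · obtain ⟨P, hP⟩ := h
        exact ⟨P, fun g => (orderCoeff_succ_zero ..).trans (Eq.trans (by ring) (hP g))⟩
      · have e : ∀ g : Fin d → ℝ, (∑ α, g α ^ 2) ^ i * (orderCoeff (∑ α, g α ^ 2) κ (q + 1) 0 * Y g) =
            2 * ((∑ α, g α ^ 2) ^ (i + 1) * (orderCoeff (∑ α, g α ^ 2) κ q 0 * Y g)) +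
            κ * ((∑ α, g α ^ 2) ^ i * (orderCoeff (∑ α, g α ^ 2) κ q 0 * Y g)) + 0 * Y g := fun g => by
          rw [orderCoeff_succ_zero]; ring
        simp only [e]
        rw [((hc.pow _).mul (hp.mul hY)).integral_add_add ((hc.pow _).mul (hp.mul hY)) hY]
        simp only [Nat.factorial_zero, Nat.cast_one, mul_one, Nat.cast_zero, zero_add, pow_zero,
          zero_mul, add_zero] at h1 h2 ⊢
        have h3 := mul_le_mul_of_nonneg_left h2 hκ0
        have h4 : κ * (2 ^ q * 3 ^ q * B ^ (i + q) * y) ≤ B * (2 ^ q * 3 ^ q * B ^ (i + q) * y) := by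
          gcongr
        have e2 : 2 ^ q * 3 ^ q * B ^ (i + 1 + q) * y = B * (2 ^ q * 3 ^ q * B ^ (i + q) * y) := by
          rw [show i + 1 + q = i + q + 1 by ring, pow_succ B]; ring
        have e3 : 2 ^ (q + 1) * 3 ^ (q + 1) * B ^ (i + (q + 1)) * y =
            6 * (B * (2 ^ q * 3 ^ q * B ^ (i + q) * y)) := by
          rw [show i + (q + 1) = i + q + 1 by ring]; ring
        have h5 : 0 ≤ B * (2 ^ q * 3 ^ q * B ^ (i + q) * y) := by positivity
        rw [e2] at h1
        rw [e3]
        linarith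
    | succ j =>
      obtain ⟨hp, h1⟩ := ih j i (by omega)
      obtain ⟨hp', h2⟩ := ih (j + 1) (i + 1) (by omega)
      obtain ⟨-, h3⟩ := ih (j + 1) i (by omega)
      refine ⟨hp.add (((hc.mul (.const (j + 3))).add (.const κ)).mul hp') |> fun h => ?_, ?_⟩
      · obtain ⟨P, hP⟩ := h
        exact ⟨P, fun g => (orderCoeff_succ_succ ..).trans (Eq.trans (by ring) (hP g))⟩
      · have e : ∀ g : Fin d → ℝ,
            (∑ α, g α ^ 2) ^ i * (orderCoeff (∑ α, g α ^ 2) κ (q + 1) (j + 1) * Y g) =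
            1 * ((∑ α, g α ^ 2) ^ i * (orderCoeff (∑ α, g α ^ 2) κ q j * Y g)) +
            (j + 3) * ((∑ α, g α ^ 2) ^ (i + 1) * (orderCoeff (∑ α, g α ^ 2) κ q (j + 1) * Y g)) +
            κ * ((∑ α, g α ^ 2) ^ i * (orderCoeff (∑ α, g α ^ 2) κ q (j + 1) * Y g)) := fun g => by
          rw [orderCoeff_succ_succ]; ring
        simp only [e]
        rw [((hc.pow _).mul (hp.mul hY)).integral_add_add ((hc.pow _).mul (hp'.mul hY))
          ((hc.pow _).mul (hp'.mul hY))]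
        set W := 2 ^ q * B ^ (i + q) * (B⁻¹) ^ j * y with hW
        have hW0 : 0 ≤ W := by positivity
        have e1 : 2 ^ q * (j + 3 : ℝ) ^ q * B ^ (i + q) * (B⁻¹) ^ j * y = (j + 3) ^ q * W := by
          rw [hW]; ring
        have e2 : 2 ^ q * (((j + 1 : ℕ) : ℝ) + 3) ^ q * B ^ (i + 1 + q) * (B⁻¹) ^ (j + 1) * y =
            (j + 4) ^ q * W := by
          rw [hW, show i + 1 + q = i + q + 1 by ring, pow_succ B, pow_succ B⁻¹]; push_cast
          field_simp; ring
        have e3 : κ * (2 ^ q * (((j + 1 : ℕ) : ℝ) + 3) ^ q * B ^ (i + q) * (B⁻¹) ^ (j + 1) * y) ≤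
            (j + 4) ^ q * W := by
          have : κ * (2 ^ q * (((j + 1 : ℕ) : ℝ) + 3) ^ q * B ^ (i + q) * (B⁻¹) ^ (j + 1) * y) =
              κ * B⁻¹ * ((j + 4) ^ q * W) := by rw [hW, pow_succ B⁻¹]; push_cast; ring
          rw [this]
          have h7 : κ * B⁻¹ ≤ 1 := by rw [← div_eq_mul_inv]; exact (div_le_one hB).2 hκ
          exact mul_le_of_le_one_left (by positivity) h7
        have e4 : 2 ^ (q + 1) * (((j + 1 : ℕ) : ℝ) + 3) ^ (q + 1) * B ^ (i + (q + 1)) *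
            (B⁻¹) ^ (j + 1) * y = 2 * ((j + 4) * ((j + 4) ^ q * W)) := by
          rw [hW, show i + (q + 1) = i + q + 1 by ring, pow_succ B, pow_succ B⁻¹]; push_cast
          field_simp; ring
        have h3' := (mul_le_mul_of_nonneg_left h3 hκ0).trans e3
        rw [e1] at h1
        rw [e2] at h2
        rw [e4]
        have e5 : (j + 3 : ℝ) ^ q * W ≤ (j + 4) ^ q * W := by gcongr; linarith
        have h1' := mul_le_mul_of_nonneg_left (h1.trans e5) (by positivity : (0 : ℝ) ≤ j + 1)
        have h2' := mul_le_mul_of_nonneg_left h2 (by positivity : (0 : ℝ) ≤ j + 3)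
        rw [Nat.factorial_succ] at h2' h3' ⊢
        push_cast at h2' h3' ⊢
        -- The three terms of the recursion cost `j + 1`, `j + 3` and `1` times `(j + 4)^q W`, and
        -- `2j + 5 ≤ 2 (j + 4)`.
        have h8 : 0 ≤ (j + 4 : ℝ) ^ q * W := by positivity
        linarith

theorem isPolyFun_fischer_numberOp_pow (κ : ℝ) (f : MvPolynomial (Fin d) ℝ) (q : ℕ) :
    IsPolyFun fun g => fischer f ((numberOp g κ ^ q) f) := by
  simp only [fischer_numberOp_pow]
  refine .sum fun j _ => .mul ?_ (isPolyFun_fischer_iterate_dirDeriv _ _ _ _)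
  have hc : ∀ (a : ℝ), IsPolyFun fun g : Fin d → ℝ => a * ∑ α, g α ^ 2 + κ := fun a =>
    ((IsPolyFun.const a).mul isPolyFun_normSq).add (.const κ)
  induction q generalizing j with
  | zero => cases j <;> exact .const _
  | succ q ih =>
    have ih' : ∀ j, IsPolyFun fun g : Fin d → ℝ => orderCoeff (∑ α, g α ^ 2) κ q j := fun j => by
      by_cases h : j < q + 1
      · exact ih j (Finset.mem_range.2 h)
      · simp only [orderCoeff_eq_zero _ κ (by omega : q < j)]; exact .const 0
    cases j with
    | zero => exact (hc 2).mul (ih' 0)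
    | succ j => exact (ih' j).add ((hc (j + 3)).mul (ih' (j + 1)))

/-- The `j!` growing in the moments of `∂_g^j f` is cancelled by the `1/j!` in the bound for the
normal-ordering coefficients, leaving powers of the ratio `4D/B`. -/
theorem integral_fischer_numberOp_pow_le {B D κ : ℝ} {Q : ℕ} (hB1 : (d : ℝ) + 2 * Q ≤ B)
    (hB2 : 40 * (Q : ℝ) ≤ B) (hB : 0 < B) (hD : 0 ≤ D) (hκ0 : 0 ≤ κ) (hκ : κ ≤ B) {q m : ℕ}
    (hq : q ≤ Q) {f : MvPolynomial (Fin d) ℝ} (hf : f.IsHomogeneous m)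
    (hm : (m * (m + d) : ℝ) ≤ D ^ 2) :
    ∫ g, fischer f ((numberOp g κ ^ q) f) ∂stdGaussianPi d ≤
      ((2 * B) ^ q * ∑ j ∈ Finset.range (q + 1), (j + 3) ^ q * (4 * D / B) ^ j) * fischer f f := by
  simp only [fischer_numberOp_pow]
  have hf0 := fischer_self_nonneg f
  have key := fun j => integral_orderCoeff_mul_le (Q := Q) hB hκ0 hκ
    (isPolyFun_fischer_iterate_dirDeriv f f j j)
    (show 0 ≤ (4 * D) ^ j * j ! * fischer f f by positivity) (fun i hi =>
      (dirMoment_le hB1 hB2 hD j i m f hi hf hm).trans_eq (by ring)) q j 0 (by omega)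
  simp only [pow_zero, one_mul, zero_add] at key
  rw [integral_finsetSum _ fun j _ =>
    ((key j).1.mul (isPolyFun_fischer_iterate_dirDeriv f f j j)).integrable, Finset.mul_sum,
    Finset.sum_mul]
  refine Finset.sum_le_sum fun j _ => ?_
  have h1 := (key j).2
  have hj : (0 : ℝ) < j ! := by positivity
  refine le_of_mul_le_mul_right (h1.trans_eq ?_) hj
  rw [div_pow, mul_pow 2 B, inv_pow]
  field_simp

/-- `∂_g² f` has mean `Δf` and second moment `‖Δf‖² + 2m(m-1) ‖f‖²`. Subtracting the mean removes
`‖Δf‖²`, which could be as large as `m(m+d) ‖f‖²`; what remains does not see the dimension. -/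
theorem integral_fischer_dirDeriv_sq_sub_laplacePoly_le {m : ℕ} {f : MvPolynomial (Fin d) ℝ}
    (hf : f.IsHomogeneous m) :
    (IsPolyFun fun g => fischer ((dirDeriv g)^[2] f - laplacePoly f)
      ((dirDeriv g)^[2] f - laplacePoly f)) ∧
    ∫ g, fischer ((dirDeriv g)^[2] f - laplacePoly f) ((dirDeriv g)^[2] f - laplacePoly f)
      ∂stdGaussianPi d ≤ 2 * m ^ 2 * fischer f f := by
  have e : ∀ g : Fin d → ℝ, fischer ((dirDeriv g)^[2] f - laplacePoly f)
      ((dirDeriv g)^[2] f - laplacePoly f) = 1 * fischer ((dirDeriv g)^[2] f) ((dirDeriv g)^[2] f) +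
      (-2) * fischer ((dirDeriv g)^[2] f) ((dirDeriv g)^[0] (laplacePoly f)) +
      1 * fischer (laplacePoly f) (laplacePoly f) := fun g => by
    simp only [map_sub, LinearMap.sub_apply, fischer_comm (laplacePoly f) ((dirDeriv g)^[2] f),
      Function.iterate_zero, id]
    ring
  have p1 := isPolyFun_fischer_iterate_dirDeriv f f 2 2
  have p2 := isPolyFun_fischer_iterate_dirDeriv f (laplacePoly f) 2 0
  have hv : ∀ v h : MvPolynomial (Fin d) ℝ, ∫ g, fischer ((dirDeriv g)^[2] v) ((dirDeriv g)^[0] h)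
      ∂stdGaussianPi d = fischer (laplacePoly v) h := fun v h => by
    have := integral_fischer_dirDeriv_succ 0 1 0 v h
    simpa using this
  have h1 : ∀ (v : MvPolynomial (Fin d) ℝ) (m : ℕ), v.IsHomogeneous m →
      ∫ g, fischer ((dirDeriv g)^[1] v) ((dirDeriv g)^[1] v) ∂stdGaussianPi d = m * fischer v v :=
    fun v m hv => by
      have := integral_fischer_dirDeriv_succ 0 0 1 v v
      simp only [pow_zero, one_mul, Nat.cast_zero, mul_zero, zero_mul, zero_add, Nat.cast_one,
        Nat.sub_self, Function.iterate_zero, id, integral_const, probReal_univ, one_smul] at this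
      rw [this, sum_fischer_pderiv hv]
  have h2 : ∫ g, fischer ((dirDeriv g)^[2] f) ((dirDeriv g)^[2] f) ∂stdGaussianPi d =
      fischer (laplacePoly f) (laplacePoly f) + 2 * ((m - 1 : ℕ) * (m * fischer f f)) := by
    have := integral_fischer_dirDeriv_succ 0 1 2 f f
    have h3 : ∫ g, fischer (laplacePoly f) ((dirDeriv g)^[2] f) ∂stdGaussianPi d =
        fischer (laplacePoly f) (laplacePoly f) := by
      simp only [fischer_comm (laplacePoly f)]
      have := hv f (laplacePoly f)
      simpa [fischer_comm (laplacePoly f)] using this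
    simp only [pow_zero, one_mul, Nat.cast_zero, mul_zero, zero_mul, zero_add, Nat.cast_one,
        Nat.sub_self, Function.iterate_zero, id, Nat.reduceAdd, Nat.reduceSub, h3,
        h1 _ _ (hf.pderiv)] at this
    rw [this, ← Finset.mul_sum, sum_fischer_pderiv hf]
    norm_num
  refine ⟨?_, ?_⟩
  · simp only [e]
    exact (((IsPolyFun.const 1).mul p1).add ((IsPolyFun.const (-2)).mul p2)).add (.const _)
  · simp only [e]
    rw [p1.integral_add_add p2 (.const _), h2, hv, integral_const]
    have hm : ((m - 1 : ℕ) : ℝ) ≤ m := by simp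
    have hf0 := fischer_self_nonneg f
    have h4 : 0 ≤ m * fischer f f := by positivity
    have := mul_le_mul_of_nonneg_right hm h4
    simp only [probReal_univ, one_smul]
    nlinarith

end MomentBounds

/-! ### Matrices of the operators on homogeneous components, in Fischer-orthonormal monomials. -/

section HomogeneousMatrix
open MvPolynomial Matrix
variable {d : ℕ}

/-- Exponents of monomials of degree `m` in `d` variables. -/
abbrev HomIdx (d m : ℕ) : Type :=
  {β : Fin d →₀ ℕ // β ∈ Finset.finsuppAntidiag (Finset.univ : Finset (Fin d)) m}

theorem mem_homIdx {m : ℕ} {β : Fin d →₀ ℕ} :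
    β ∈ Finset.finsuppAntidiag (Finset.univ : Finset (Fin d)) m ↔ ∑ i, β i = m := by
  simp [Finset.mem_finsuppAntidiag]

/-- Orthonormal monomials for the Fischer inner product. -/
noncomputable def homBasis {m : ℕ} (β : HomIdx d m) : MvPolynomial (Fin d) ℝ :=
  monomial β.1 (√(∏ i, ((β.1 i)! : ℝ)))⁻¹

/-- The homogeneous polynomial with given coordinates. -/
noncomputable def homPoly {m : ℕ} (v : HomIdx d m → ℝ) : MvPolynomial (Fin d) ℝ :=
  ∑ β, v β • homBasis β

theorem isHomogeneous_homBasis {m : ℕ} (β : HomIdx d m) : (homBasis β).IsHomogeneous m :=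
  isHomogeneous_monomial _ (by
    rw [Finsupp.degree_eq_sum]; exact mem_homIdx.1 β.2)

theorem isHomogeneous_homPoly {m : ℕ} (v : HomIdx d m → ℝ) : (homPoly v).IsHomogeneous m :=
  IsHomogeneous.sum _ _ _ fun β _ => IsHomogeneous.smul' (isHomogeneous_homBasis β) _

theorem fischer_homBasis {m : ℕ} (β γ : HomIdx d m) :
    fischer (homBasis β) (homBasis γ) = if β = γ then 1 else 0 := by
  rw [homBasis, fischer_monomial_left, homBasis, coeff_monomial]
  by_cases h : β = γ
  · subst h
    have h0 : (0 : ℝ) < ∏ i, ((β.1 i)! : ℝ) := by positivity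
    rw [if_pos rfl, if_pos rfl, mul_left_comm, ← mul_inv, Real.mul_self_sqrt h0.le,
      mul_inv_cancel₀ h0.ne']
  · rw [if_neg h, if_neg fun h' => h (Subtype.ext h'.symm), mul_zero, mul_zero]

theorem fischer_homBasis_homPoly {m : ℕ} (β : HomIdx d m) (v : HomIdx d m → ℝ) :
    fischer (homBasis β) (homPoly v) = v β := by
  simp [homPoly, map_sum, fischer_homBasis]

theorem fischer_homPoly_left {m : ℕ} (v : HomIdx d m → ℝ) (f : MvPolynomial (Fin d) ℝ) :
    fischer (homPoly v) f = v ⬝ᵥ fun β => fischer (homBasis β) f := by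
  simp [homPoly, map_sum, LinearMap.sum_apply, dotProduct]

theorem fischer_homPoly {m : ℕ} (v w : HomIdx d m → ℝ) :
    fischer (homPoly v) (homPoly w) = v ⬝ᵥ w := by
  simp only [fischer_homPoly_left, fischer_homBasis_homPoly]

theorem MvPolynomial.IsHomogeneous.homPoly_fischer {m : ℕ} {f : MvPolynomial (Fin d) ℝ}
    (hf : f.IsHomogeneous m) : (homPoly fun β : HomIdx d m => fischer (homBasis β) f) = f := by
  have h1 : ∀ β : HomIdx d m, fischer (homBasis β) f • homBasis β = monomial β.1 (coeff β.1 f) := by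
    intro β
    have h0 : (0 : ℝ) < ∏ i, ((β.1 i)! : ℝ) := by positivity
    rw [homBasis, fischer_monomial_left, smul_monomial, smul_eq_mul]
    congr 1
    have := Real.mul_self_sqrt h0.le
    have h2 : √(∏ i, ((β.1 i)! : ℝ)) ≠ 0 := (Real.sqrt_pos.2 h0).ne'
    field_simp
    rw [pow_two, this]
  simp only [homPoly, h1]
  rw [Finset.sum_coe_sort (Finset.finsuppAntidiag (Finset.univ : Finset (Fin d)) m)
    (fun β => monomial β (coeff β f))]
  conv_rhs => rw [f.as_sum]
  refine (Finset.sum_subset (fun β hβ => mem_homIdx.2 ?_) fun β _ hβ => ?_).symm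
  · rw [← Finsupp.degree_eq_sum]; rw [Finsupp.degree_eq_weight_one]; exact hf (mem_support_iff.1 hβ)
  · rw [notMem_support_iff.1 hβ, monomial_zero]

/-- The matrix of a linear operator on polynomials, between homogeneous components. -/
noncomputable def homMatrix (T : MvPolynomial (Fin d) ℝ →ₗ[ℝ] MvPolynomial (Fin d) ℝ) (k m : ℕ) :
    Matrix (HomIdx d k) (HomIdx d m) ℝ :=
  of fun β γ => fischer (homBasis β) (T (homBasis γ))

theorem homMatrix_mulVec (T : MvPolynomial (Fin d) ℝ →ₗ[ℝ] MvPolynomial (Fin d) ℝ) (k m : ℕ)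
    (v : HomIdx d m → ℝ) :
    homMatrix T k m *ᵥ v = fun β => fischer (homBasis β) (T (homPoly v)) := by
  ext β
  simp [homMatrix, mulVec, dotProduct, homPoly, map_sum, mul_comm]

theorem homPoly_homMatrix_mulVec {T : MvPolynomial (Fin d) ℝ →ₗ[ℝ] MvPolynomial (Fin d) ℝ}
    {k m : ℕ} (hT : ∀ f : MvPolynomial (Fin d) ℝ, f.IsHomogeneous m → (T f).IsHomogeneous k)
    (v : HomIdx d m → ℝ) : homPoly (homMatrix T k m *ᵥ v) = T (homPoly v) := by
  rw [homMatrix_mulVec]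
  exact (hT _ (isHomogeneous_homPoly v)).homPoly_fischer

theorem homMatrix_transpose {T T' : MvPolynomial (Fin d) ℝ →ₗ[ℝ] MvPolynomial (Fin d) ℝ}
    (h : ∀ f h, fischer (T f) h = fischer f (T' h)) (k m : ℕ) :
    (homMatrix T k m)ᵀ = homMatrix T' m k := by
  ext β γ
  simp only [homMatrix, transpose_apply, of_apply]
  rw [fischer_comm, h]

/-- Multiplication by `⟨g, y⟩² - ‖y‖²`. -/
noncomputable def mulOp (g : Fin d → ℝ) : MvPolynomial (Fin d) ℝ →ₗ[ℝ] MvPolynomial (Fin d) ℝ :=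
  LinearMap.mulLeft ℝ (linForm g ^ 2 - normSqPoly d)

/-- The adjoint `∂_g² - Δ` of `mulOp g`. -/
noncomputable def mulOpAdj (g : Fin d → ℝ) :
    MvPolynomial (Fin d) ℝ →ₗ[ℝ] MvPolynomial (Fin d) ℝ :=
  (dirDeriv g).toLinearMap ∘ₗ (dirDeriv g).toLinearMap - laplacePoly

theorem mulOp_apply (g : Fin d → ℝ) (f : MvPolynomial (Fin d) ℝ) :
    mulOp g f = (linForm g ^ 2 - normSqPoly d) * f := rfl

theorem mulOpAdj_apply (g : Fin d → ℝ) (f : MvPolynomial (Fin d) ℝ) :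
    mulOpAdj g f = (dirDeriv g)^[2] f - laplacePoly f := rfl

theorem fischer_mulOp (g : Fin d → ℝ) (f h : MvPolynomial (Fin d) ℝ) :
    fischer (mulOp g f) h = fischer f (mulOpAdj g h) := by
  rw [mulOp_apply, mulOpAdj_apply, sub_mul, pow_two, mul_assoc, map_sub, LinearMap.sub_apply,
    fischer_linForm_mul, fischer_linForm_mul, fischer_normSqPoly_mul, map_sub]
  rfl

theorem MvPolynomial.IsHomogeneous.mulOp {f : MvPolynomial (Fin d) ℝ} {m : ℕ}
    (hf : f.IsHomogeneous m) (g : Fin d → ℝ) : (mulOp g f).IsHomogeneous (m + 2) := by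
  rw [mulOp_apply, add_comm]
  exact (((isHomogeneous_linForm g).pow 2).sub isHomogeneous_normSqPoly).mul hf

theorem MvPolynomial.IsHomogeneous.mulOpAdj {f : MvPolynomial (Fin d) ℝ} {m : ℕ}
    (hf : f.IsHomogeneous (m + 2)) (g : Fin d → ℝ) : (mulOpAdj g f).IsHomogeneous m := by
  rw [mulOpAdj_apply]
  exact IsHomogeneous.sub (hf.dirDeriv g |>.dirDeriv g) hf.laplacePoly

theorem MvPolynomial.IsHomogeneous.numberOp {f : MvPolynomial (Fin d) ℝ} {m : ℕ}
    (hf : f.IsHomogeneous m) (g : Fin d → ℝ) (κ : ℝ) : (numberOp g κ f).IsHomogeneous m := by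
  rw [numberOp_apply]
  refine IsHomogeneous.add ?_ (_root_.IsHomogeneous.smul' hf _)
  cases m with
  | zero =>
    have h0 : _root_.dirDeriv g f = 0 := by
      simp [_root_.dirDeriv_apply, hf.pderiv_eq_zero]
    rw [h0, mul_zero]; exact isHomogeneous_zero _ _ _
  | succ m =>
    rw [add_comm m 1]
    exact (isHomogeneous_linForm g).mul (hf.dirDeriv g)

theorem homPoly_numberOp_pow_mulVec (g : Fin d → ℝ) (κ : ℝ) {m : ℕ} (v : HomIdx d m → ℝ) (q : ℕ) :
    homPoly (homMatrix (numberOp g κ) m m ^ q *ᵥ v) = (numberOp g κ ^ q) (homPoly v) := by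
  induction q with
  | zero => simp
  | succ q ih =>
    rw [pow_succ', ← mulVec_mulVec, homPoly_homMatrix_mulVec (fun f hf => hf.numberOp g κ), ih,
      pow_succ']
    rfl

theorem homMatrix_numberOp_transpose (g : Fin d → ℝ) (κ : ℝ) (m : ℕ) :
    (homMatrix (numberOp g κ) m m)ᵀ = homMatrix (numberOp g κ) m m :=
  homMatrix_transpose (fischer_numberOp_comm g κ) m m

theorem posSemidef_two_smul_homMatrix_numberOp_sub (g : Fin d → ℝ) {κ : ℝ} (hκ : 0 ≤ κ) {m : ℕ}
    (hm : ((m + 2) * (m + 2 + d) : ℝ) ≤ κ ^ 2) :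
    ((2 : ℝ) • (homMatrix (numberOp g κ) m m * homMatrix (numberOp g κ) m m) -
      (homMatrix (mulOp g) (m + 2) m)ᵀ * homMatrix (mulOp g) (m + 2) m).PosSemidef := by
  have hH := homMatrix_numberOp_transpose g κ m
  refine PosSemidef.of_dotProduct_mulVec_nonneg ?_ fun v => ?_
  · rw [IsHermitian, conjTranspose_eq_transpose_of_trivial]
    simp only [transpose_sub, transpose_smul, transpose_mul, hH, transpose_transpose]
  · have e1 : v ⬝ᵥ (homMatrix (numberOp g κ) m m * homMatrix (numberOp g κ) m m) *ᵥ v =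
        fischer (numberOp g κ (homPoly v)) (numberOp g κ (homPoly v)) := by
      rw [← homPoly_homMatrix_mulVec (fun f hf => hf.numberOp g κ), fischer_homPoly,
        ← mulVec_mulVec, dotProduct_mulVec, ← mulVec_transpose, hH]
    have e2 : v ⬝ᵥ ((homMatrix (mulOp g) (m + 2) m)ᵀ * homMatrix (mulOp g) (m + 2) m) *ᵥ v =
        fischer (mulOp g (homPoly v)) (mulOp g (homPoly v)) := by
      rw [← homPoly_homMatrix_mulVec (fun f hf => hf.mulOp g), fischer_homPoly,
        ← mulVec_mulVec, dotProduct_mulVec, vecMul_transpose]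
    have := fischer_linForm_sq_sub_normSqPoly_mul_le g hκ (isHomogeneous_homPoly v) hm
    rw [star_trivial, sub_mulVec, dotProduct_sub, smul_mulVec, dotProduct_smul, e1, e2, smul_eq_mul]
    simp only [mulOp_apply]
    linarith

theorem isPolyFun_homMatrix_mulOp (k m : ℕ) (β : HomIdx d k) (γ : HomIdx d m) :
    IsPolyFun fun g => homMatrix (mulOp g) k m β γ := by
  -- Passing to the adjoint expresses the entry through iterates of `∂_g`, whose Fischer products
  -- are already known to be polynomial in `g`.
  have e : ∀ g : Fin d → ℝ, homMatrix (mulOp g) k m β γ =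
      fischer ((dirDeriv g)^[0] (homBasis γ)) ((dirDeriv g)^[2] (homBasis β)) +
        (-fischer (homBasis γ) (laplacePoly (homBasis β))) := fun g => by
    rw [homMatrix, of_apply, fischer_comm, fischer_mulOp, mulOpAdj_apply, map_sub, sub_eq_add_neg]
    rfl
  simp only [e]
  exact (isPolyFun_fischer_iterate_dirDeriv _ _ 0 2).add (.const _)

end HomogeneousMatrix

/-! ### The random matrices `E_{l,j}` and the recursion for their trace moments. -/

section MomentRecursion
open MvPolynomial Matrix
variable {d : ℕ}

/-- Matrix, in the Fischer-orthonormal monomials of degree `2l`, of the sum over `l`-subsets `S` of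
the rows of the rank-one forms attached to `∏_{i ∈ S} (⟨g_i, y⟩² - ‖y‖²)`. -/
noncomputable def esymmMatrix : (l j : ℕ) → (Fin j → Fin d → ℝ) →
    Matrix (HomIdx d (2 * l)) (HomIdx d (2 * l)) ℝ
  | 0, _, _ => 1
  | _ + 1, 0, _ => 0
  | l + 1, j + 1, G => esymmMatrix (l + 1) j (fun i => G i.succ) +
      homMatrix (mulOp (G 0)) (2 * l + 2) (2 * l) * esymmMatrix l j (fun i => G i.succ) *
        (homMatrix (mulOp (G 0)) (2 * l + 2) (2 * l))ᵀ

theorem esymmMatrix_zero (j : ℕ) (G : Fin j → Fin d → ℝ) : esymmMatrix 0 j G = 1 := by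
  cases j <;> rfl

theorem esymmMatrix_succ_zero (l : ℕ) (G : Fin 0 → Fin d → ℝ) : esymmMatrix (l + 1) 0 G = 0 := rfl

theorem esymmMatrix_succ_succ (l j : ℕ) (G : Fin (j + 1) → Fin d → ℝ) :
    esymmMatrix (l + 1) (j + 1) G = esymmMatrix (l + 1) j (fun i => G i.succ) +
      homMatrix (mulOp (G 0)) (2 * l + 2) (2 * l) * esymmMatrix l j (fun i => G i.succ) *
        (homMatrix (mulOp (G 0)) (2 * l + 2) (2 * l))ᵀ := rfl

theorem posSemidef_esymmMatrix (j : ℕ) : ∀ (l : ℕ) (G : Fin j → Fin d → ℝ),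
    (esymmMatrix l j G).PosSemidef := by
  induction j with
  | zero =>
    intro l G
    cases l with
    | zero => rw [esymmMatrix_zero]; exact .one
    | succ l => rw [esymmMatrix_succ_zero]; exact .zero
  | succ j ih =>
    intro l G
    cases l with
    | zero => rw [esymmMatrix_zero]; exact .one
    | succ l =>
      rw [esymmMatrix_succ_succ]
      refine (ih _ _).add ?_
      simpa using (ih l fun i => G i.succ).mul_mul_conjTranspose_same
        (homMatrix (mulOp (G 0)) (2 * l + 2) (2 * l))

theorem continuous_homMatrix_mulOp (k m : ℕ) :
    Continuous fun g : Fin d → ℝ => homMatrix (mulOp g) k m :=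
  continuous_matrix fun β γ => (isPolyFun_homMatrix_mulOp k m β γ).continuous

theorem continuous_esymmMatrix (j : ℕ) : ∀ l : ℕ,
    Continuous fun G : Fin j → Fin d → ℝ => esymmMatrix l j G := by
  induction j with
  | zero =>
    intro l
    cases l with
    | zero => simp only [esymmMatrix_zero]; exact continuous_const
    | succ l => simp only [esymmMatrix_succ_zero]; exact continuous_const
  | succ j ih =>
    intro l
    cases l with
    | zero => simp only [esymmMatrix_zero]; exact continuous_const
    | succ l =>
      simp only [esymmMatrix_succ_succ]
      have ht : Continuous fun G : Fin (j + 1) → Fin d → ℝ => fun i : Fin j => G i.succ :=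
        continuous_pi fun i => continuous_apply i.succ
      have hM : Continuous fun G : Fin (j + 1) → Fin d → ℝ =>
          homMatrix (mulOp (G 0)) (2 * l + 2) (2 * l) :=
        (continuous_homMatrix_mulOp _ _).comp (continuous_apply 0)
      exact ((ih (l + 1)).comp ht).add
        ((hM.matrix_mul ((ih l).comp ht)).matrix_mul hM.matrix_transpose)

theorem measurable_trace_esymmMatrix_pow (l j p : ℕ) :
    Measurable fun G : Fin j → Fin d → ℝ => ENNReal.ofReal ((esymmMatrix l j G) ^ p).trace :=
  (((continuous_esymmMatrix j l).pow p).matrix_trace).measurable.ennreal_ofReal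

theorem lintegral_pi_succ {j : ℕ} {F : (Fin (j + 1) → Fin d → ℝ) → ENNReal} (hF : Measurable F) :
    ∫⁻ G, F G ∂Measure.pi (fun _ => stdGaussianPi d) =
      ∫⁻ G, ∫⁻ g, F (Fin.cons g G) ∂stdGaussianPi d ∂Measure.pi (fun _ : Fin j => stdGaussianPi d) := by
  have h := (measurePreserving_piFinSuccAbove (fun _ : Fin (j + 1) => stdGaussianPi d) 0).symm
  rw [← h.lintegral_comp hF, lintegral_prod_symm]
  · simp [MeasurableEquiv.piFinSuccAbove, Fin.insertNthEquiv, Fin.insertNth_zero']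
  · exact (hF.comp h.measurable).aemeasurable

theorem two_moment_bounds {B D κ : ℝ} {Q : ℕ} (hB1 : (d : ℝ) + 2 * Q ≤ B)
    (hB2 : 40 * (Q : ℝ) ≤ B) (hB : 0 < B) (hD : 0 ≤ D) (hκ0 : 0 ≤ κ) (hκ : κ ≤ B) {q m : ℕ}
    (hq : q ≤ Q) (hm : (m * (m + d) : ℝ) ≤ D ^ 2) (v : HomIdx d m → ℝ) :
    Integrable (fun g => v ⬝ᵥ (homMatrix (numberOp g κ) m m ^ q *ᵥ v)) (stdGaussianPi d) ∧
    ∫ g, v ⬝ᵥ (homMatrix (numberOp g κ) m m ^ q *ᵥ v) ∂stdGaussianPi d ≤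
      ((2 * B) ^ q * ∑ j ∈ Finset.range (q + 1), (j + 3) ^ q * (4 * D / B) ^ j) * (v ⬝ᵥ v) := by
  simp only [← fischer_homPoly, homPoly_numberOp_pow_mulVec]
  exact ⟨(isPolyFun_fischer_numberOp_pow κ _ q).integrable,
    integral_fischer_numberOp_pow_le hB1 hB2 hB hD hκ0 hκ hq (isHomogeneous_homPoly v) hm⟩

/-- The one-step bound with `M` multiplication by `⟨g, y⟩² - ‖y‖²` and `H` the matrix of `numberOp`.
The three averages are `8k²` for `Mᵀ` (from `2 (2l+2)²`), twice the bound for `H²` for `M` itself,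
and the bound for `H^(2p)`. -/
theorem lintegral_trace_esymmMatrix_step {B D κ lam : ℝ} {k p s l : ℕ} (hp : p = 2 ^ s) (hp2 : 2 ≤ p)
    (hB1 : (d : ℝ) + 2 * (2 * p : ℕ) ≤ B) (hB2 : 40 * ((2 * p : ℕ) : ℝ) ≤ B) (hB : 0 < B)
    (hD : 0 ≤ D) (hκ0 : 0 ≤ κ) (hκ : κ ≤ B) (hlam : 0 < lam)
    (hkκ : (2 * k * (2 * k + d) : ℝ) ≤ κ ^ 2) (hkD : (2 * k * (2 * k + d) : ℝ) ≤ D ^ 2)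
    (hl : l + 1 ≤ k) {X : Matrix (HomIdx d (2 * l)) (HomIdx d (2 * l)) ℝ}
    {R : Matrix (HomIdx d (2 * l + 2)) (HomIdx d (2 * l + 2)) ℝ} (hX : X.PosSemidef)
    (hR : R.PosSemidef) :
    ∫⁻ g, ENNReal.ofReal ((R + homMatrix (mulOp g) (2 * l + 2) (2 * l) * X *
        (homMatrix (mulOp g) (2 * l + 2) (2 * l))ᵀ) ^ p).trace ∂stdGaussianPi d ≤
      ENNReal.ofReal ((1 + 24 * p * lam * k ^ 2) * (R ^ p).trace +
        (3 * p * (lam⁻¹) ^ (p - 1) *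
            (2 * ((2 * B) ^ 2 * ∑ j ∈ Finset.range (2 + 1), (j + 3) ^ 2 * (4 * D / B) ^ j)) +
          (8 * p) ^ p * ((2 * B) ^ (2 * p) *
            ∑ j ∈ Finset.range (2 * p + 1), (j + 3) ^ (2 * p) * (4 * D / B) ^ j)) *
          (X ^ p).trace) := by
  have hlk : (l : ℝ) + 1 ≤ k := by exact_mod_cast hl
  have hm : (((2 * l : ℕ) + 2) * ((2 * l : ℕ) + 2 + d) : ℝ) ≤ 2 * k * (2 * k + d) := by
    push_cast; gcongr <;> linarith
  have hm' : ((2 * l : ℕ) * ((2 * l : ℕ) + d) : ℝ) ≤ D ^ 2 := by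
    refine le_trans ?_ (hm.trans hkD)
    gcongr <;> linarith
  have hH := fun g : Fin d → ℝ => homMatrix_numberOp_transpose g κ (2 * l)
  have hM := fun g : Fin d → ℝ =>
    posSemidef_two_smul_homMatrix_numberOp_sub g hκ0 (m := 2 * l) (hm.trans hkκ)
  have h3 := fun (q : ℕ) (hq : q ≤ 2 * p) (v : HomIdx d (2 * l) → ℝ) =>
    two_moment_bounds hB1 hB2 hB hD hκ0 hκ hq hm' v
  have h1 : ∀ u : HomIdx d (2 * l + 2) → ℝ,
      Integrable (fun g => ((homMatrix (mulOp g) (2 * l + 2) (2 * l))ᵀ *ᵥ u) ⬝ᵥ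
        ((homMatrix (mulOp g) (2 * l + 2) (2 * l))ᵀ *ᵥ u)) (stdGaussianPi d) ∧
      ∫ g, ((homMatrix (mulOp g) (2 * l + 2) (2 * l))ᵀ *ᵥ u) ⬝ᵥ
        ((homMatrix (mulOp g) (2 * l + 2) (2 * l))ᵀ *ᵥ u) ∂stdGaussianPi d ≤
          8 * k ^ 2 * (u ⬝ᵥ u) := fun u => by
    have e : ∀ g : Fin d → ℝ, (homMatrix (mulOp g) (2 * l + 2) (2 * l))ᵀ *ᵥ u =
        homMatrix (mulOpAdj g) (2 * l) (2 * l + 2) *ᵥ u := fun g => by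
      rw [homMatrix_transpose (fischer_mulOp g)]
    simp only [e, ← fischer_homPoly, homPoly_homMatrix_mulVec (fun f hf => hf.mulOpAdj _),
      mulOpAdj_apply]
    obtain ⟨k1, k2⟩ := integral_fischer_dirDeriv_sq_sub_laplacePoly_le (isHomogeneous_homPoly u)
    refine ⟨k1.integrable, k2.trans ?_⟩
    refine mul_le_mul_of_nonneg_right ?_ (fischer_self_nonneg _)
    push_cast
    nlinarith [Nat.cast_nonneg (α := ℝ) l]
  have h2 : ∀ v : HomIdx d (2 * l) → ℝ,
      Integrable (fun g => (homMatrix (mulOp g) (2 * l + 2) (2 * l) *ᵥ v) ⬝ᵥ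
        (homMatrix (mulOp g) (2 * l + 2) (2 * l) *ᵥ v)) (stdGaussianPi d) ∧
      ∫ g, (homMatrix (mulOp g) (2 * l + 2) (2 * l) *ᵥ v) ⬝ᵥ
        (homMatrix (mulOp g) (2 * l + 2) (2 * l) *ᵥ v) ∂stdGaussianPi d ≤
        2 * ((2 * B) ^ 2 * ∑ j ∈ Finset.range (2 + 1), (j + 3) ^ 2 * (4 * D / B) ^ j) *
          (v ⬝ᵥ v) := fun v => by
    have hi : Integrable (fun g => (homMatrix (mulOp g) (2 * l + 2) (2 * l) *ᵥ v) ⬝ᵥ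
        (homMatrix (mulOp g) (2 * l + 2) (2 * l) *ᵥ v)) (stdGaussianPi d) := by
      refine IsPolyFun.integrable (.sum fun β _ => ?_)
      have : IsPolyFun fun g : Fin d → ℝ =>
          (homMatrix (mulOp g) (2 * l + 2) (2 * l) *ᵥ v) β :=
        .sum fun γ _ => (isPolyFun_homMatrix_mulOp _ _ β γ).mul (.const _)
      exact this.mul this
    obtain ⟨k1, k2⟩ := h3 2 (by omega) v
    refine ⟨hi, (integral_mono hi (k1.const_mul 2) fun g => ?_).trans ?_⟩
    · have := (hM g).dotProduct_mulVec_nonneg v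
      rw [star_trivial, sub_mulVec, dotProduct_sub, smul_mulVec, dotProduct_smul,
        ← mulVec_mulVec _ (homMatrix (mulOp g) _ _)ᵀ, dotProduct_mulVec _ (homMatrix (mulOp g) _ _)ᵀ,
        vecMul_transpose, smul_eq_mul] at this
      rw [pow_two]
      linarith
    · rw [integral_const_mul]; linarith
  refine (lintegral_trace_add_conj_pow_le hX hR hH hM hp hp2 hlam (fun u => (h1 u).1)
    (fun v => (h2 v).1) (fun v => (h3 (2 * p) le_rfl v).1) (fun u => (h1 u).2) (fun v => (h2 v).2)
    fun v => (h3 (2 * p) le_rfl v).2).trans_eq ?_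
  congr 3
  ring

theorem homIdx_zero_card : Fintype.card (HomIdx d 0) = 1 := by
  rw [Fintype.card_coe, Finset.finsuppAntidiag_zero, Finset.card_singleton]

/-- Moments of the trace of `esymmMatrix` for standard Gaussian rows. -/
theorem lintegral_trace_esymmMatrix_pow_le {p k : ℕ} {a Θ : ℝ} (ha : 0 ≤ a) (hΘ : 0 ≤ Θ)
    (step : ∀ l, l + 1 ≤ k → ∀ {X : Matrix (HomIdx d (2 * l)) (HomIdx d (2 * l)) ℝ}
      {R : Matrix (HomIdx d (2 * l + 2)) (HomIdx d (2 * l + 2)) ℝ}, X.PosSemidef → R.PosSemidef →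
      ∫⁻ g, ENNReal.ofReal ((R + homMatrix (mulOp g) (2 * l + 2) (2 * l) * X *
        (homMatrix (mulOp g) (2 * l + 2) (2 * l))ᵀ) ^ p).trace ∂stdGaussianPi d ≤
      ENNReal.ofReal ((1 + a) * (R ^ p).trace + Θ * (X ^ p).trace)) (hp : p ≠ 0) (j : ℕ) :
    ∀ l ≤ k, ∫⁻ G, ENNReal.ofReal ((esymmMatrix l j G) ^ p).trace
        ∂Measure.pi (fun _ : Fin j => stdGaussianPi d) ≤
      ENNReal.ofReal ((1 + a) ^ j * j.choose l * Θ ^ l) := by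
  have h0 : ∀ j, ∫⁻ G, ENNReal.ofReal ((esymmMatrix 0 j G) ^ p).trace
        ∂Measure.pi (fun _ : Fin j => stdGaussianPi d) ≤
      ENNReal.ofReal ((1 + a) ^ j * j.choose 0 * Θ ^ 0) := fun j => by
    simp only [esymmMatrix_zero, one_pow, trace_one, lintegral_const, measure_univ, mul_one,
      Nat.choose_zero_right, Nat.cast_one, pow_zero]
    refine ENNReal.ofReal_le_ofReal ?_
    rw [show Fintype.card (HomIdx d (2 * 0)) = 1 from homIdx_zero_card, Nat.cast_one]
    exact one_le_pow₀ (by linarith)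
  induction j with
  | zero =>
    intro l hl
    cases l with
    | zero => exact h0 0
    | succ l => simp [esymmMatrix_succ_zero, hp]
  | succ j ih =>
    intro l hl
    cases l with
    | zero => exact h0 _
    | succ l =>
      rw [lintegral_pi_succ (measurable_trace_esymmMatrix_pow _ _ _)]
      simp only [esymmMatrix_succ_succ, Fin.cons_zero, Fin.cons_succ]
      have hn : ∀ (l : ℕ) (G : Fin j → Fin d → ℝ), 0 ≤ ((esymmMatrix l j G) ^ p).trace :=
        fun l G => ((posSemidef_esymmMatrix j l G).pow p).trace_nonneg
      calc _ ≤ ∫⁻ G, (ENNReal.ofReal (1 + a) * ENNReal.ofReal ((esymmMatrix (l + 1) j G) ^ p).trace +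
            ENNReal.ofReal Θ * ENNReal.ofReal ((esymmMatrix l j G) ^ p).trace)
            ∂Measure.pi (fun _ : Fin j => stdGaussianPi d) := by
            refine lintegral_mono fun G => (step l hl (posSemidef_esymmMatrix j l G)
              (posSemidef_esymmMatrix j (l + 1) G)).trans_eq ?_
            rw [← ENNReal.ofReal_mul (by positivity), ← ENNReal.ofReal_mul hΘ, ENNReal.ofReal_add]
            · exact mul_nonneg (by positivity) (hn _ _)
            · exact mul_nonneg hΘ (hn _ _)
        _ ≤ ENNReal.ofReal (1 + a) * ENNReal.ofReal ((1 + a) ^ j * j.choose (l + 1) * Θ ^ (l + 1)) +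
            ENNReal.ofReal Θ * ENNReal.ofReal ((1 + a) ^ j * j.choose l * Θ ^ l) := by
            rw [lintegral_add_left ((measurable_trace_esymmMatrix_pow _ _ _).const_mul _),
              lintegral_const_mul _ (measurable_trace_esymmMatrix_pow _ _ _),
              lintegral_const_mul _ (measurable_trace_esymmMatrix_pow _ _ _)]
            gcongr
            · exact ih _ hl
            · exact ih _ (by omega)
        _ ≤ _ := by
            rw [← ENNReal.ofReal_mul (by positivity), ← ENNReal.ofReal_mul hΘ,
              ← ENNReal.ofReal_add (by positivity) (by positivity)]
            refine ENNReal.ofReal_le_ofReal ?_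
            -- Pascal's rule, after giving the second term a spare factor `1 + a ≥ 1`.
            rw [Nat.choose_succ_succ, pow_succ Θ, pow_succ (1 + a)]
            push_cast
            have h1 : (1 + a) ^ j * j.choose l * Θ ^ l * Θ ≤
              (1 + a) * ((1 + a) ^ j * j.choose l * Θ ^ l * Θ) :=
              le_mul_of_one_le_left (by positivity) (by linarith)
            nlinarith

end MomentRecursion

/-! ### Elementary symmetric polynomials of shifted variables. -/

section ElementarySymmetric
variable {R : Type*} [CommRing R]

theorem sum_powersetCard_univ_succ {j : ℕ} (l : ℕ) (f : Fin (j + 1) → R) :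
    ∑ S ∈ Finset.powersetCard (l + 1) (Finset.univ : Finset (Fin (j + 1))), ∏ i ∈ S, f i =
      ∑ S ∈ Finset.powersetCard (l + 1) (Finset.univ : Finset (Fin j)), ∏ i ∈ S, f i.succ +
      f 0 * ∑ S ∈ Finset.powersetCard l (Finset.univ : Finset (Fin j)), ∏ i ∈ S, f i.succ := by
  have h : (Finset.univ : Finset (Fin (j + 1))).val.map f =
      f 0 ::ₘ (Finset.univ : Finset (Fin j)).val.map fun i => f i.succ := by
    rw [Fin.univ_succ, Finset.cons_val, Multiset.map_cons, Finset.map_val, Multiset.map_map]; rfl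
  rw [← Finset.esymm_map_val, h, ← Finset.esymm_map_val (fun i : Fin j => f i.succ),
    ← Finset.esymm_map_val (fun i : Fin j => f i.succ)]
  simp only [Multiset.esymm, Multiset.powersetCard_cons, Multiset.map_add, Multiset.sum_add,
    Multiset.map_map, Function.comp_def, Multiset.prod_cons, Multiset.sum_map_mul_left]

/-- Both sides are the coefficient of `X^(n-t)` in `∏ (X + x_i + c)`, expanded in powers of `X` and
of `X + c` respectively. -/
theorem sum_powersetCard_prod_add {n t : ℕ} (ht : t ≤ n) (x : Fin n → R) (c : R) :
    ∑ S ∈ Finset.powersetCard t Finset.univ, ∏ i ∈ S, (x i + c) =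
      ∑ k ∈ Finset.range (t + 1), ((n - k).choose (t - k) : R) * c ^ (t - k) *
        ∑ S ∈ Finset.powersetCard k Finset.univ, ∏ i ∈ S, x i := by
  have h := fun (s : Multiset R) => Multiset.prod_X_add_C_eq_sum_esymm s
  have h1 := congrArg (fun q : Polynomial R => q.coeff (n - t)) (h (Finset.univ.val.map fun i => x i + c))
  have h2 := congrArg (fun q : Polynomial R => (q.comp (Polynomial.X + Polynomial.C c)).coeff (n - t))
    (h (Finset.univ.val.map x))
  have e : (((Finset.univ.val.map x).map fun r => Polynomial.X + Polynomial.C r).prod.comp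
      (Polynomial.X + Polynomial.C c)) = ((Finset.univ.val.map fun i => x i + c).map
        fun r => Polynomial.X + Polynomial.C r).prod := by
    simp only [Multiset.map_map, Function.comp_def]
    rw [Finset.prod_map_val, Finset.prod_map_val, Polynomial.prod_comp]
    refine Finset.prod_congr rfl fun i _ => ?_
    simp only [Polynomial.add_comp, Polynomial.X_comp, Polynomial.C_comp, Polynomial.C_add]
    ring
  simp only [e] at h2
  rw [h1] at h2
  simp only [Polynomial.sum_comp, Polynomial.mul_comp, Polynomial.pow_comp,
    Polynomial.X_comp, Polynomial.C_comp, Polynomial.finsetSum_coeff, Polynomial.coeff_C_mul,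
    Polynomial.coeff_X_pow, Polynomial.coeff_X_add_C_pow, Multiset.card_map, Finset.card_val,
    Finset.card_univ, Fintype.card_fin, Finset.esymm_map_val] at h2
  rw [Finset.sum_eq_single t] at h2
  · rw [if_pos rfl, mul_one] at h2
    rw [h2]
    refine (Finset.sum_subset (Finset.range_mono (show t + 1 ≤ n + 1 by omega))
      fun k hk hk' => ?_).symm.trans (Finset.sum_congr rfl fun k hk => ?_)
    · have h3 := Finset.mem_range.1 hk
      have h4 : ¬k < t + 1 := fun h => hk' (Finset.mem_range.2 h)
      rw [Nat.choose_eq_zero_of_lt (show n - k < n - t by omega), Nat.cast_zero, mul_zero, mul_zero]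
    · have h3 : k < t + 1 := Finset.mem_range.1 hk
      have h4 : n - k = n - t + (t - k) := by omega
      rw [Nat.choose_symm_of_eq_add h4,
        show n - k - (n - t) = t - k by omega]
      ring
  · intro k hk hkt
    rw [if_neg, mul_zero]
    have := Finset.mem_range.1 hk
    omega
  · intro hk; exact absurd (Finset.mem_range.2 (by omega)) hk

end ElementarySymmetric

/-! ### From spectral bounds to sum-of-squares certificates. -/

section SumOfSquares
open MvPolynomial Matrix
variable {d : ℕ}

/-- Sums of squares of polynomials, each square of degree at most `k`. -/
def IsSos {σ : Type*} (k : ℕ) (f : MvPolynomial σ ℝ) : Prop :=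
  ∃ (m : ℕ) (q : Fin m → MvPolynomial σ ℝ), (∀ i, 2 * (q i).totalDegree ≤ k) ∧
    f = ∑ i, q i ^ 2

namespace IsSos
variable {σ : Type*} {k l : ℕ} {f g : MvPolynomial σ ℝ}

theorem of_fintype {ι : Type*} [Fintype ι] (q : ι → MvPolynomial σ ℝ)
    (hq : ∀ i, 2 * (q i).totalDegree ≤ k) (hf : f = ∑ i, q i ^ 2) : IsSos k f :=
  ⟨Fintype.card ι, fun i => q ((Fintype.equivFin ι).symm i), fun _ => hq _,
    hf.trans ((Equiv.sum_comp (Fintype.equivFin ι).symm fun i => q i ^ 2).symm)⟩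

theorem zero : IsSos k (0 : MvPolynomial σ ℝ) := ⟨0, fun _ => 0, nofun, by simp⟩

theorem sq (h : 2 * f.totalDegree ≤ k) : IsSos k (f ^ 2) :=
  of_fintype (ι := Unit) (fun _ => f) (fun _ => h) (by simp)

theorem mono (hf : IsSos k f) (hkl : k ≤ l) : IsSos l f := by
  obtain ⟨m, q, hq, h⟩ := hf
  exact ⟨m, q, fun i => (hq i).trans hkl, h⟩

theorem add (hf : IsSos k f) (hg : IsSos k g) : IsSos k (f + g) := by
  obtain ⟨m, q, hq, h⟩ := hf
  obtain ⟨m', q', hq', h'⟩ := hg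
  refine of_fintype (ι := Fin m ⊕ Fin m') (Sum.elim q q') ?_ (by simp [h, h'])
  rintro (i | i)
  exacts [hq i, hq' i]

theorem sum {ι : Type*} {s : Finset ι} {f : ι → MvPolynomial σ ℝ} (h : ∀ i ∈ s, IsSos k (f i)) :
    IsSos k (∑ i ∈ s, f i) := by
  classical
  induction s using Finset.induction_on with
  | empty => simpa using zero
  | insert i s hi ih =>
    rw [Finset.sum_insert hi]
    exact (h i (Finset.mem_insert_self _ _)).add (ih fun j hj => h j (Finset.mem_insert_of_mem hj))

theorem mul (hf : IsSos k f) (hg : IsSos l g) : IsSos (k + l) (f * g) := by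
  obtain ⟨m, q, hq, h⟩ := hf
  obtain ⟨m', q', hq', h'⟩ := hg
  refine of_fintype (ι := Fin m × Fin m') (fun i => q i.1 * q' i.2) (fun i => ?_) ?_
  · have := totalDegree_mul (q i.1) (q' i.2)
    have := hq i.1
    have := hq' i.2
    omega
  · rw [h, h', Finset.sum_mul_sum, Fintype.sum_prod_type]
    simp only [mul_pow]

theorem C {a : ℝ} (ha : 0 ≤ a) : IsSos k (C a : MvPolynomial σ ℝ) := by
  have : (MvPolynomial.C a : MvPolynomial σ ℝ) = MvPolynomial.C √a ^ 2 := by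
    rw [← map_pow, Real.sq_sqrt ha]
  rw [this]
  exact sq (by simp)

theorem C_mul {a : ℝ} (ha : 0 ≤ a) (hf : IsSos k f) : IsSos k (MvPolynomial.C a * f) := by
  simpa using (IsSos.C (k := 0) ha).mul hf

theorem prod {ι : Type*} {s : Finset ι} {a : ι → MvPolynomial σ ℝ} (ha : ∀ i ∈ s, IsSos k (a i)) :
    IsSos (k * s.card) (∏ i ∈ s, a i) := by
  classical
  induction s using Finset.induction_on with
  | empty => simpa using IsSos.C (σ := σ) (k := 0) zero_le_one
  | insert i s hi ih =>
    rw [Finset.prod_insert hi, Finset.card_insert_of_notMem hi, mul_add, mul_one, add_comm]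
    exact (ha i (Finset.mem_insert_self _ _)).mul (ih fun j hj => ha j (Finset.mem_insert_of_mem hj))

/-- Factors are exchanged one at a time; each `b i = (b i - a i) + a i` is itself a sum of squares.
-/
theorem prod_sub_prod {ι : Type*} {s : Finset ι} {a b : ι → MvPolynomial σ ℝ}
    (ha : ∀ i ∈ s, IsSos k (a i)) (hab : ∀ i ∈ s, IsSos k (b i - a i)) :
    IsSos (k * s.card) (∏ i ∈ s, b i - ∏ i ∈ s, a i) := by
  classical
  induction s using Finset.induction_on with
  | empty => simpa using zero
  | insert i s hi ih =>
    rw [Finset.prod_insert hi, Finset.prod_insert hi, Finset.card_insert_of_notMem hi, mul_add,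
      mul_one, add_comm]
    have hb : ∀ j ∈ s, IsSos k (b j) := fun j hj => by
      simpa using (hab j (Finset.mem_insert_of_mem hj)).add (ha j (Finset.mem_insert_of_mem hj))
    have e : b i * ∏ j ∈ s, b j - a i * ∏ j ∈ s, a j = (b i - a i) * ∏ j ∈ s, b j +
      a i * (∏ j ∈ s, b j - ∏ j ∈ s, a j) := by ring
    rw [e]
    exact ((hab i (Finset.mem_insert_self _ _)).mul (prod hb)).add
      ((ha i (Finset.mem_insert_self _ _)).mul (ih (fun j hj => ha j (Finset.mem_insert_of_mem hj))
        fun j hj => hab j (Finset.mem_insert_of_mem hj)))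

end IsSos

/-- The polynomial `eᵀ X e`, for `e` the vector of Fischer-orthonormal monomials. -/
noncomputable def quadPoly {m : ℕ} (X : Matrix (HomIdx d m) (HomIdx d m) ℝ) :
    MvPolynomial (Fin d) ℝ := homBasis ⬝ᵥ (X.map C *ᵥ homBasis)

theorem quadPoly_add {m : ℕ} (X Y : Matrix (HomIdx d m) (HomIdx d m) ℝ) :
    quadPoly (X + Y) = quadPoly X + quadPoly Y := by
  rw [quadPoly, Matrix.map_add _ (fun _ _ => C_add), add_mulVec, dotProduct_add]
  rfl

theorem quadPoly_sub {m : ℕ} (X Y : Matrix (HomIdx d m) (HomIdx d m) ℝ) :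
    quadPoly (X - Y) = quadPoly X - quadPoly Y := by
  rw [eq_sub_iff_add_eq, ← quadPoly_add, sub_add_cancel]

theorem transpose_homMatrix_mulVec_homBasis (g : Fin d → ℝ) (m : ℕ) :
    ((homMatrix (mulOp g) (m + 2) m)ᵀ.map C *ᵥ homBasis : HomIdx d m → MvPolynomial (Fin d) ℝ) =
      (linForm g ^ 2 - normSqPoly d) • homBasis := by
  ext1 γ
  have h := ((isHomogeneous_homBasis γ).mulOp g).homPoly_fischer
  rw [Pi.smul_apply, smul_eq_mul, ← mulOp_apply]
  conv_rhs => rw [← h]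
  simp only [mulVec, dotProduct, homPoly, map_apply, transpose_apply, homMatrix, of_apply,
    smul_eq_C_mul]

/-- The columns of the multiplication matrix are the coordinates of `(ℓ_g² - ‖y‖²) e_γ`, so its
transpose sends the vector `e` of monomials to `(ℓ_g² - ‖y‖²) e`. -/
theorem quadPoly_conj (g : Fin d → ℝ) {m : ℕ} (X : Matrix (HomIdx d m) (HomIdx d m) ℝ) :
    quadPoly (homMatrix (mulOp g) (m + 2) m * X * (homMatrix (mulOp g) (m + 2) m)ᵀ) =
      (linForm g ^ 2 - normSqPoly d) ^ 2 * quadPoly X := by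
  have h := transpose_homMatrix_mulVec_homBasis g m
  have e : ∀ Y : Matrix (HomIdx d (m + 2)) (HomIdx d m) ℝ, Y.map (C : ℝ →+* MvPolynomial (Fin d) ℝ) =
    (Yᵀ.map (C : ℝ →+* MvPolynomial (Fin d) ℝ))ᵀ := fun Y => rfl
  rw [quadPoly, Matrix.map_mul, Matrix.map_mul, ← mulVec_mulVec, ← mulVec_mulVec, h,
    dotProduct_mulVec, e, vecMul_transpose, h, mulVec_smul, dotProduct_smul, smul_dotProduct,
    smul_smul, ← pow_two]
  rfl

/-- The multinomial theorem. The factor `1/m!` is the gain from the Fischer normalisation that later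
compensates powers of `t`. -/
theorem sum_homBasis_sq (m : ℕ) : ∑ β : HomIdx d m, homBasis β ^ 2 =
    C ((m ! : ℝ)⁻¹) * normSqPoly d ^ m := by
  have hm : (m ! : ℝ) ≠ 0 := by positivity
  rw [normSqPoly, Finset.sum_pow_eq_sum_piAntidiag, Finset.mul_sum]
  refine Finset.sum_bij' (fun β _ => ⇑β.1) (fun k hk => ⟨Finsupp.equivFunOnFinite.symm k,
    mem_homIdx.2 (by simpa using (Finset.mem_piAntidiag.1 hk).1)⟩) ?_ ?_ ?_ ?_ ?_
  · intro β _; simpa using mem_homIdx.1 β.2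
  · intro k hk; simp
  · intro β _; ext; simp
  · intro k hk; ext; simp
  · intro β _
    have h0 : (0 : ℝ) < ∏ i, ((β.1 i)! : ℝ) := by positivity
    have h1 := Nat.multinomial_spec Finset.univ β.1
    rw [mem_homIdx.1 β.2] at h1
    rw [homBasis, monomial_eq, Finsupp.prod_fintype _ _ (by simp), mul_pow, ← map_pow, inv_pow,
      Real.sq_sqrt h0.le, ← Finset.prod_pow, ← mul_assoc]
    congr 1
    · rw [← map_natCast (C : ℝ →+* MvPolynomial (Fin d) ℝ), ← map_mul]
      congr 1
      rw [← h1]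
      push_cast
      have h2 : (Nat.multinomial Finset.univ β.1 : ℝ) ≠ 0 := by
        have := Nat.multinomial_pos Finset.univ β.1
        positivity
      field_simp
    · exact Finset.prod_congr rfl fun i _ => by rw [← pow_mul, ← pow_mul, mul_comm]

theorem quadPoly_smul_one (m : ℕ) (a : ℝ) : quadPoly (a • (1 : Matrix (HomIdx d m) (HomIdx d m) ℝ)) =
    C (a * (m ! : ℝ)⁻¹) * normSqPoly d ^ m := by
  have e : (a • (1 : Matrix (HomIdx d m) (HomIdx d m) ℝ)).map (C : ℝ →+* MvPolynomial (Fin d) ℝ) =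
      (C a : MvPolynomial (Fin d) ℝ) • 1 := by
    ext1 i j
    by_cases h : i = j <;> simp [h, one_apply]
  rw [quadPoly, e, smul_mulVec, one_mulVec, dotProduct_smul, C_mul, mul_assoc, ← sum_homBasis_sq,
    smul_eq_mul]
  simp only [dotProduct, pow_two]

theorem quadPoly_esymmMatrix (j : ℕ) : ∀ (l : ℕ) (G : Fin j → Fin d → ℝ),
    quadPoly (esymmMatrix l j G) = ∑ S ∈ Finset.powersetCard l (Finset.univ : Finset (Fin j)),
      ∏ i ∈ S, (linForm (G i) ^ 2 - normSqPoly d) ^ 2 := by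
  have h0 : quadPoly (1 : Matrix (HomIdx d (2 * 0)) (HomIdx d (2 * 0)) ℝ) = 1 := by
    simpa using quadPoly_smul_one (d := d) 0 1
  induction j with
  | zero =>
    intro l G
    cases l with
    | zero => simp [esymmMatrix_zero, h0]
    | succ l =>
      rw [esymmMatrix_succ_zero, Finset.powersetCard_eq_empty.2 (by simp)]
      simp [quadPoly]
  | succ j ih =>
    intro l G
    cases l with
    | zero => simp [esymmMatrix_zero, h0]
    | succ l =>
      rw [esymmMatrix_succ_succ, quadPoly_add, sum_powersetCard_univ_succ, ← ih, ← ih]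
      exact congrArg _ (quadPoly_conj _ _)

theorem isSos_quadPoly {m : ℕ} {X : Matrix (HomIdx d m) (HomIdx d m) ℝ} (hX : X.PosSemidef) :
    IsSos (2 * m) (quadPoly X) := by
  obtain ⟨Z, rfl⟩ := hX.exists_transpose_mul_self
  refine .of_fintype (fun a => (Z.map C *ᵥ homBasis) a) (fun a => ?_) ?_
  · refine Nat.mul_le_mul_left 2 ((totalDegree_finsetSum_le fun β _ => ?_))
    have e : (fun j => Z.map C a j) β * homBasis β = Z a β • homBasis β := (smul_eq_C_mul _ _).symm
    exact (congrArg totalDegree e).trans_le <| (totalDegree_smul_le _ _).trans (isHomogeneous_homBasis β).totalDegree_le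
  · rw [quadPoly, Matrix.map_mul, ← mulVec_mulVec, dotProduct_mulVec, transpose_map, vecMul_transpose]
    simp only [dotProduct, pow_two]

/-- Each eigenvalue is nonnegative and its `p`-th power is one summand of the trace. -/
theorem posSemidef_smul_one_sub_of_trace_pow_le {ι : Type*} [Fintype ι] [DecidableEq ι]
    {X : Matrix ι ι ℝ} (hX : X.PosSemidef) {a : ℝ} (ha : 0 ≤ a) {p : ℕ} (hp : p ≠ 0)
    (h : (X ^ p).trace ≤ a ^ p) : (a • (1 : Matrix ι ι ℝ) - X).PosSemidef := by
  obtain ⟨U, hU1, hU2, hU⟩ := hX.1.exists_diagonalization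
  have hle : ∀ i, hX.1.eigenvalues i ≤ a := fun i => by
    refine le_of_pow_le_pow_left₀ hp ha (le_trans ?_ h)
    rw [hU, Matrix.mul_assoc, trace_mul_comm, Matrix.mul_assoc, hU2, Matrix.mul_one, trace_diagonal]
    exact Finset.single_le_sum (f := fun i => hX.1.eigenvalues i ^ p)
      (fun i _ => pow_nonneg (hX.eigenvalues_nonneg i) p) (Finset.mem_univ i)
  have e : a • (1 : Matrix ι ι ℝ) - X = U * diagonal (fun i => a - hX.1.eigenvalues i) * Uᵀ := by
    have h1 := hU 1
    have h2 : diagonal (fun i => a - hX.1.eigenvalues i) =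
        a • (1 : Matrix ι ι ℝ) - diagonal hX.1.eigenvalues := by
      rw [smul_one_eq_diagonal, diagonal_sub]
    simp only [pow_one] at h1
    rw [h2, Matrix.mul_sub, Matrix.sub_mul, Matrix.mul_smul, Matrix.mul_one, Matrix.smul_mul, hU1]
    exact congrArg _ h1
  rw [e]
  have := (PosSemidef.diagonal (d := fun i => a - hX.1.eigenvalues i)
    fun i => sub_nonneg.2 (hle i)).mul_mul_conjTranspose_same U
  simpa using this

theorem isSos_sub_sum_powersetCard {n l p : ℕ} (hp : p ≠ 0) {G : Fin n → Fin d → ℝ} {a : ℝ}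
    (ha : 0 ≤ a) (h : ((esymmMatrix l n G) ^ p).trace ≤ a ^ p) :
    IsSos (4 * l) (C (a * ((2 * l)! : ℝ)⁻¹) * normSqPoly d ^ (2 * l) -
      ∑ S ∈ Finset.powersetCard l (Finset.univ : Finset (Fin n)),
        ∏ i ∈ S, (linForm (G i) ^ 2 - normSqPoly d) ^ 2) := by
  have := isSos_quadPoly (posSemidef_smul_one_sub_of_trace_pow_le (posSemidef_esymmMatrix n l G)
    ha hp h)
  rw [quadPoly_sub, quadPoly_smul_one, quadPoly_esymmMatrix] at this
  exact this.mono (by omega)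

theorem isSos_normSqPoly_pow (k : ℕ) : IsSos (4 * k) (normSqPoly d ^ (2 * k)) := by
  rw [mul_comm 2 k, pow_mul]
  refine .sq ?_
  have := (isHomogeneous_normSqPoly (d := d)).pow k |>.totalDegree_le
  omega

/-- Three certificates are added: `ℓ⁴ ≤ 2((ℓ² - ‖y‖²)² + ‖y‖⁴)`, with difference `(ℓ² - 2‖y‖²)²`,
multiplied over `S`; the spectral bound for each `e_k` in the expansion of the shifted products; and
the slack in `b`. -/
theorem sosLe_distinctProductsPoly {n t : ℕ} (ht : t ≤ n) {G : Fin n → Fin d → ℝ} {a : ℕ → ℝ}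
    {p : ℕ → ℕ} (ha : ∀ k, 0 ≤ a k) (hp : ∀ k, p k ≠ 0)
    (h : ∀ k ≤ t, ((esymmMatrix k n G) ^ p k).trace ≤ a k ^ p k) {b : ℝ}
    (hb : t ! * 2 ^ t * ∑ k ∈ Finset.range (t + 1), (n - k).choose (t - k) * a k / (2 * k)! ≤ b) :
    SosLe (4 * t) (distinctProductsPoly t G) (C b * normSqPoly d ^ (2 * t)) := by
  have hr2 := (isHomogeneous_normSqPoly (d := d)).totalDegree_le
  have h1 : IsSos (4 * t) (∑ S ∈ Finset.powersetCard t (Finset.univ : Finset (Fin n)),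
      ∏ i ∈ S, C (2 : ℝ) * ((linForm (G i) ^ 2 - normSqPoly d) ^ 2 + normSqPoly d ^ 2) -
      ∑ S ∈ Finset.powersetCard t (Finset.univ : Finset (Fin n)), ∏ i ∈ S, linForm (G i) ^ 4) := by
    rw [← Finset.sum_sub_distrib]
    refine .sum fun S hS => ?_
    rw [← (Finset.mem_powersetCard.1 hS).2]
    have hl : ∀ i, (linForm (G i) ^ 2).IsHomogeneous 2 := fun i => (isHomogeneous_linForm (G i)).pow 2
    refine IsSos.prod_sub_prod (fun i _ => ?_) fun i _ => ?_
    · rw [show linForm (G i) ^ 4 = (linForm (G i) ^ 2) ^ 2 by ring]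
      exact .sq (Nat.mul_le_mul_left 2 (hl i).totalDegree_le)
    · rw [show C (2 : ℝ) * ((linForm (G i) ^ 2 - normSqPoly d) ^ 2 + normSqPoly d ^ 2) -
        linForm (G i) ^ 4 = (linForm (G i) ^ 2 - C (2 : ℝ) * normSqPoly d) ^ 2 by
          rw [map_ofNat]; ring]
      refine .sq (Nat.mul_le_mul_left 2 (IsHomogeneous.totalDegree_le ((hl i).sub ?_)))
      simpa using (isHomogeneous_C (Fin d) (2 : ℝ)).mul (isHomogeneous_normSqPoly (d := d))
  have e1 : ∑ S ∈ Finset.powersetCard t (Finset.univ : Finset (Fin n)),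
      ∏ i ∈ S, C (2 : ℝ) * ((linForm (G i) ^ 2 - normSqPoly d) ^ 2 + normSqPoly d ^ 2) =
      C (2 ^ t) * ∑ k ∈ Finset.range (t + 1), ((n - k).choose (t - k) : MvPolynomial (Fin d) ℝ) *
        (normSqPoly d ^ 2) ^ (t - k) * ∑ S ∈ Finset.powersetCard k Finset.univ,
          ∏ i ∈ S, (linForm (G i) ^ 2 - normSqPoly d) ^ 2 := by
    rw [← sum_powersetCard_prod_add ht, Finset.mul_sum]
    refine Finset.sum_congr rfl fun S hS => ?_
    rw [Finset.prod_mul_distrib, Finset.prod_const, (Finset.mem_powersetCard.1 hS).2, map_pow]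
  have h2 : IsSos (4 * t) (∑ k ∈ Finset.range (t + 1),
      ((n - k).choose (t - k) : MvPolynomial (Fin d) ℝ) * (normSqPoly d ^ 2) ^ (t - k) *
        (C (a k * ((2 * k)! : ℝ)⁻¹) * normSqPoly d ^ (2 * k) -
          ∑ S ∈ Finset.powersetCard k Finset.univ,
            ∏ i ∈ S, (linForm (G i) ^ 2 - normSqPoly d) ^ 2)) := by
    refine .sum fun k hk => ?_
    have hkt := Finset.mem_range.1 hk
    rw [← map_natCast (C : ℝ →+* MvPolynomial (Fin d) ℝ), mul_assoc, ← pow_mul]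
    refine .C_mul (Nat.cast_nonneg _) (((isSos_normSqPoly_pow (t - k)).mul
      (isSos_sub_sum_powersetCard (hp k) (ha k) (h k (by omega)))).mono (by omega))
  have e2 : ∑ k ∈ Finset.range (t + 1),
      ((n - k).choose (t - k) : MvPolynomial (Fin d) ℝ) * (normSqPoly d ^ 2) ^ (t - k) *
        (C (a k * ((2 * k)! : ℝ)⁻¹) * normSqPoly d ^ (2 * k)) =
      C (∑ k ∈ Finset.range (t + 1), (n - k).choose (t - k) * a k / (2 * k)!) *
        normSqPoly d ^ (2 * t) := by
    rw [map_sum, Finset.sum_mul]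
    refine Finset.sum_congr rfl fun k hk => ?_
    have hkt := Finset.mem_range.1 hk
    rw [div_eq_mul_inv, mul_assoc ((n - k).choose (t - k) : ℝ), C_mul (a := ((n - k).choose (t - k) : ℝ)), map_natCast,
      show 2 * t = 2 * (t - k) + 2 * k by omega, pow_add, pow_mul]
    ring
  have h3 : IsSos (4 * t) (C (b - t ! * 2 ^ t * ∑ k ∈ Finset.range (t + 1),
      (n - k).choose (t - k) * a k / (2 * k)!) * normSqPoly d ^ (2 * t)) :=
    .C_mul (sub_nonneg.2 hb) (isSos_normSqPoly_pow t)
  have h4 := ((h1.C_mul (Nat.cast_nonneg (α := ℝ) t !)).add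
    (h2.C_mul (show (0 : ℝ) ≤ t ! * 2 ^ t by positivity))).add h3
  rw [e1] at h4
  simp only [mul_sub, Finset.sum_sub_distrib, e2] at h4
  simp only [C_sub, C_mul, sub_mul] at h4
  refine (congrArg (IsSos (4 * t)) ?_).mp h4
  rw [distinctProductsPoly]
  ring

end SumOfSquares

/-! ### Numerical estimates: the step constant `Θ` and the final sum over `k`. -/

section Numerics

theorem pow_le_mul_exp {y s : ℝ} (hy : 0 ≤ y) (hs : 0 < s) (m : ℕ) :
    y ^ m ≤ s ^ m * m ! * Real.exp (y / s) := by
  have h := Real.pow_div_factorial_le_exp (y / s) (by positivity) m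
  rw [div_pow, div_div, div_le_iff₀ (by positivity)] at h
  linarith

theorem le_pow_of_le_of_one_le {a b : ℝ} {p : ℕ} (hp : p ≠ 0) (hb : 1 ≤ b) (hab : a ≤ b) : a ≤ b ^ p :=
  hab.trans (le_self_pow₀ hb hp)

theorem add_pow_le_two_mul_add_pow {a b : ℝ} {p : ℕ} (ha : 0 ≤ a) (hb : 0 ≤ b) (hp : p ≠ 0) :
    a ^ p + b ^ p ≤ (2 * (a + b)) ^ p := by
  have h1 : a ^ p ≤ (a + b) ^ p := by gcongr; linarith
  have h2 : b ^ p ≤ (a + b) ^ p := by gcongr; linarith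
  have h3 : (2 : ℝ) ≤ 2 ^ p := le_self_pow₀ (by norm_num) hp
  have h4 : 0 ≤ (a + b) ^ p := by positivity
  rw [mul_pow]
  nlinarith

/-- The Young weight `1/(24kn)` leaves `(24kn)^(p-1)` times a multiple of `B²`. As `d² ≤ n² =
(n/k)(nk)` and `n/k ≤ e^p`, one has `B² ≲ e^p nk`, so the total is a constant to the `p` times
`(nk)^p`. Here `473 = 9 + 16·4 + 25·16`, and `9` bounds `e²`. -/
theorem conj_term_le {n d k p : ℕ} {B z U : ℝ} (hp : 2 ≤ p) (hz0 : 0 ≤ z) (hz4 : z ≤ 4)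
    (hk0 : (1 : ℝ) ≤ k) (hdn' : (d : ℝ) ≤ n) (hnk : (1 : ℝ) ≤ n * k)
    (hBsq : B ^ 2 ≤ 18 * d ^ 2 + 12800 * p ^ 2) (hxp : (n / k : ℝ) ≤ Real.exp p)
    (hU1 : (n * k : ℝ) ≤ U) :
    3 * p * ((1 / (24 * k * n) : ℝ)⁻¹) ^ (p - 1) *
        (2 * ((2 * B) ^ 2 * ∑ j ∈ Finset.range (2 + 1), (j + 3) ^ 2 * z ^ j)) ≤
      (3 * 3784 * 25618 * 9 * 24 * U) ^ p := by
  have h1 : ∑ j ∈ Finset.range (2 + 1), ((j : ℝ) + 3) ^ 2 * z ^ j ≤ 473 := by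
    simp only [Finset.sum_range_succ, Finset.sum_range_zero]
    norm_num
    nlinarith
  have h2 : B ^ 2 ≤ 25618 * Real.exp p * (n * k) := by
    have h3 : (d : ℝ) ^ 2 ≤ Real.exp p * (n * k) := by
      calc (d : ℝ) ^ 2 ≤ (n : ℝ) ^ 2 := by gcongr
        _ = (n / k : ℝ) * (n * k) := by field_simp
        _ ≤ _ := by gcongr
    have h4 := pow_le_mul_exp (show (0 : ℝ) ≤ p by positivity) one_pos 2
    norm_num at h4
    have h5 : Real.exp p ≤ Real.exp p * (n * k) := le_mul_of_one_le_right (by positivity) hnk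
    linarith
  have h6 : (p : ℝ) ≤ Real.exp p := by linarith [Real.add_one_le_exp (p : ℝ)]
  have h7 : Real.exp p * Real.exp p ≤ 9 ^ p := by
    rw [← Real.exp_one_pow, ← mul_pow]
    have := Real.exp_one_lt_d9
    have := Real.exp_pos 1
    gcongr
    nlinarith
  rw [one_div, inv_inv]
  calc 3 * p * (24 * k * n : ℝ) ^ (p - 1) *
        (2 * ((2 * B) ^ 2 * ∑ j ∈ Finset.range (2 + 1), ((j : ℝ) + 3) ^ 2 * z ^ j))
      ≤ 3 * Real.exp p * (24 * k * n : ℝ) ^ (p - 1) *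
        (2 * (4 * (25618 * Real.exp p * (n * k)) * 473)) := by
        have h8 : (2 * B) ^ 2 ≤ 4 * (25618 * Real.exp p * (n * k)) := by
          rw [mul_pow]; linarith
        gcongr
    _ = 3 * 3784 * 25618 / 24 * (Real.exp p * Real.exp p) *
          ((24 * k * n : ℝ) ^ (p - 1) * (24 * k * n)) := by ring
    _ = 3 * 3784 * 25618 / 24 * (Real.exp p * Real.exp p) * (24 * k * n : ℝ) ^ p := by
        rw [← pow_succ, Nat.sub_add_cancel (by omega)]
    _ ≤ (3 * 3784 * 25618) ^ p * 9 ^ p * (24 * U) ^ p := by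
        have h8 : (3 * 3784 * 25618 / 24 : ℝ) ≤ (3 * 3784 * 25618) ^ p :=
          le_pow_of_le_of_one_le (by omega) (by norm_num) (by norm_num)
        have h9 : (24 * k * n : ℝ) ≤ 24 * U := by linarith
        gcongr
    _ = _ := by rw [← mul_pow, ← mul_pow]; ring

/-- The number of summands, `2p + 1`, is at most `3^p`, so a uniform bound `V^p` on them is enough;
`96 = 8·4·3`. -/
theorem pow_mul_sum_le {p : ℕ} {B z U C V : ℝ} (hV : 0 ≤ V)
    (hV1 : p * B ^ 2 * V ≤ C * U) (hV2 : ∀ j ≤ 2 * p, ((j : ℝ) + 3) ^ (2 * p) * z ^ j ≤ V ^ p) :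
    (8 * p : ℝ) ^ p * ((2 * B) ^ (2 * p) *
        ∑ j ∈ Finset.range (2 * p + 1), (j + 3) ^ (2 * p) * z ^ j) ≤ (96 * C * U) ^ p := by
  have h1 : ∑ j ∈ Finset.range (2 * p + 1), ((j : ℝ) + 3) ^ (2 * p) * z ^ j ≤ (3 * V) ^ p := by
    refine (Finset.sum_le_card_nsmul _ _ _ fun j hj =>
      hV2 j (by have := Finset.mem_range.1 hj; omega)).trans ?_
    rw [Finset.card_range, nsmul_eq_mul, mul_pow]
    have h3 := one_add_mul_le_pow (show (-2 : ℝ) ≤ 2 by norm_num) p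
    have h4 : ((2 * p + 1 : ℕ) : ℝ) ≤ 3 ^ p := by
      push_cast; norm_num at h3; linarith
    gcongr
  calc _ ≤ (8 * p : ℝ) ^ p * (((2 * B) ^ 2) ^ p * (3 * V) ^ p) := by rw [pow_mul]; gcongr
    _ = (96 * (p * B ^ 2 * V)) ^ p := by rw [← mul_pow, ← mul_pow]; ring
    _ ≤ _ := by rw [mul_assoc 96]; gcongr

theorem numberOp_term_le {n d k p : ℕ} {B z U x : ℝ} (hp : 2 ≤ p) (hz0 : 0 ≤ z) (hz4 : z ≤ 4)
    (hk0 : (1 : ℝ) ≤ k) (hd0 : (1 : ℝ) ≤ d) (hn0 : (1 : ℝ) ≤ n) (hx : x = n / k)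
    (hzsq : z ^ 2 ≤ 16 * (k / d)) (hp5 : (p : ℝ) ^ 5 ≤ 368640 * (n * k))
    (hBsq : B ^ 2 ≤ 18 * d ^ 2 + 12800 * p ^ 2) (hxl : Real.exp (p / 4) ≤ 3 * x)
    (hU : U = n * k + d ^ 2 * p ^ 2) :
    (8 * p : ℝ) ^ p * ((2 * B) ^ (2 * p) *
        ∑ j ∈ Finset.range (2 * p + 1), (j + 3) ^ (2 * p) * z ^ j) ≤
      (96 * (6553600 * (12800 * 368640 + 18)) * U) ^ p := by
  have hp' : (2 : ℝ) ≤ p := by exact_mod_cast hp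
  have hx0 : 0 < x := by rw [hx]; positivity
  have hp3 : (p : ℝ) ^ 3 ≤ (p : ℝ) ^ 5 := pow_le_pow_right₀ (by linarith) (by norm_num)
  have hnk0 : (0 : ℝ) ≤ n * k := by positivity
  -- If `p³d² ≤ nk`, there is room for the crude bound `V = 256 p²` coming from `j ≤ 2p` and `z ≤
  -- 4`. Otherwise `(k/d)² ≤ p³ k/n`, and since `n/k` is exponentially large in `p`, the ratio `z`
  -- is at most `40 e^(-p/32)`; then `z^j` beats `(j+3)^(2p)` and `V` can be a constant.
  rcases le_total ((p : ℝ) ^ 3 * d ^ 2) (n * k) with hc | hc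
  · refine pow_mul_sum_le (C := 6553600 * (12800 * 368640 + 18))
      (V := 256 * p ^ 2) (by positivity) ?_ fun j hj => ?_
    · have e : p * B ^ 2 * (256 * p ^ 2) = 256 * (p ^ 3 * B ^ 2) := by ring
      have h1 : (p : ℝ) ^ 3 * B ^ 2 ≤ p ^ 3 * (18 * d ^ 2 + 12800 * p ^ 2) := by gcongr
      have e2 : (p : ℝ) ^ 3 * (18 * d ^ 2 + 12800 * p ^ 2) = 18 * (p ^ 3 * d ^ 2) + 12800 * p ^ 5 := by
        ring
      have hU1 : (n * k : ℝ) ≤ U := by rw [hU]; exact le_add_of_nonneg_right (by positivity)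
      rw [e]
      linarith
    · have hj' : (j : ℝ) ≤ 2 * p := by exact_mod_cast hj
      calc ((j : ℝ) + 3) ^ (2 * p) * z ^ j ≤ (4 * p) ^ (2 * p) * 4 ^ (2 * p) := by
            have h1 : z ^ j ≤ 4 ^ (2 * p) := (pow_le_pow_left₀ hz0 hz4 j).trans
              (pow_le_pow_right₀ (by norm_num) hj)
            gcongr
            linarith
        _ = _ := by rw [pow_mul, pow_mul, ← mul_pow]; ring
  · refine pow_mul_sum_le (C := 6553600 * (12800 * 368640 + 18))
      (V := 6553600) (by norm_num) ?_ fun j hj => ?_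
    · have h1 : p * B ^ 2 ≤ p * (18 * d ^ 2 + 12800 * p ^ 2) := by gcongr
      have h2 : (p : ℝ) * d ^ 2 ≤ d ^ 2 * p ^ 2 := by nlinarith [sq_nonneg (d : ℝ)]
      have e2 : (p : ℝ) * (18 * d ^ 2 + 12800 * p ^ 2) = 18 * (p * d ^ 2) + 12800 * p ^ 3 := by ring
      have h3 : 0 ≤ (d : ℝ) ^ 2 * p ^ 2 := by positivity
      rw [hU]
      linarith
    · have hj' : (j : ℝ) ≤ 2 * p := by exact_mod_cast hj
      have hkd2 : ((k : ℝ) / d) ^ 2 ≤ p ^ 3 / x := by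
        rw [hx, div_div_eq_mul_div, div_pow, div_le_div_iff₀ (by positivity) (by positivity)]
        nlinarith [mul_le_mul_of_nonneg_right hc (show (0 : ℝ) ≤ k by positivity)]
      have hz4' : z ^ 4 ≤ (40 * Real.exp (-(p / 32))) ^ 4 := by
        have h1 := pow_le_mul_exp (show (0 : ℝ) ≤ p by positivity) (show (0 : ℝ) < 8 by norm_num) 3
        norm_num [Nat.factorial] at h1
        have h2 : (p : ℝ) ^ 3 / x ≤ 9216 * Real.exp (-(p / 8)) := by
          rw [div_le_iff₀ hx0]
          have h3 : Real.exp (-(p / 8)) * Real.exp (p / 4) = Real.exp (p / 8) := by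
            rw [← Real.exp_add]; ring_nf
          have h4 : Real.exp (-(p / 8)) * Real.exp (p / 4) ≤ Real.exp (-(p / 8)) * (3 * x) := by
            gcongr
          linarith
        have e : (40 * Real.exp (-(p / 32))) ^ 4 = 2560000 * Real.exp (-(p / 8)) := by
          rw [mul_pow, ← Real.exp_nat_mul]; ring_nf
        have h5 : (z ^ 2) ^ 2 ≤ (16 * (k / d)) ^ 2 := by gcongr
        have h6 : 0 < Real.exp (-((p : ℝ) / 8)) := Real.exp_pos _
        rw [e]
        nlinarith
      have hz' : z ≤ 40 * Real.exp (-(p / 32)) :=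
        le_of_pow_le_pow_left₀ four_ne_zero (by positivity) hz4'
      have hzj : z ^ j ≤ 1600 ^ p * Real.exp (-(j / 32)) ^ p := by
        calc z ^ j ≤ (40 * Real.exp (-(p / 32))) ^ j := by gcongr
          _ = 40 ^ j * Real.exp (-(j / 32)) ^ p := by
              rw [mul_pow, ← Real.exp_nat_mul, ← Real.exp_nat_mul]; ring_nf
          _ ≤ 40 ^ (2 * p) * Real.exp (-(j / 32)) ^ p := by gcongr; norm_num
          _ = _ := by rw [pow_mul]; norm_num
      -- The decay `z^j ≤ 1600^p (e^(-j/32))^p` is a `p`-th power, so the supremum over `j` is taken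
      -- inside that power.
      have hj3 : ((j : ℝ) + 3) ^ 2 * Real.exp (-(j / 32)) ≤ 4096 := by
        have h1 := pow_le_mul_exp (show (0 : ℝ) ≤ j + 3 by positivity)
          (show (0 : ℝ) < 32 by norm_num) 2
        norm_num [Nat.factorial] at h1
        have h2 : Real.exp ((j + 3) / 32) * Real.exp (-(j / 32)) ≤ 2 := by
          rw [← Real.exp_add]
          have : ((j : ℝ) + 3) / 32 + -(j / 32) = 3 / 32 := by ring
          rw [this]
          have h3 : Real.exp (3 / 32) ^ 4 ≤ 2 ^ 4 := by
            rw [← Real.exp_nat_mul]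
            refine (Real.exp_le_exp.2 (show _ ≤ (1 : ℝ) by norm_num)).trans ?_
            linarith [Real.exp_one_lt_d9]
          exact le_of_pow_le_pow_left₀ four_ne_zero (by norm_num) h3
        have h3 := mul_le_mul_of_nonneg_right h1 (Real.exp_pos (-(j / 32))).le
        linarith
      calc ((j : ℝ) + 3) ^ (2 * p) * z ^ j ≤
            ((j : ℝ) + 3) ^ (2 * p) * (1600 ^ p * Real.exp (-(j / 32)) ^ p) := by gcongr
        _ = (1600 * (((j : ℝ) + 3) ^ 2 * Real.exp (-(j / 32)))) ^ p := by
            rw [pow_mul, mul_pow, mul_pow]; ring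
        _ ≤ (1600 * 4096) ^ p := by gcongr
        _ = _ := by norm_num

/-- The constant in one step of the moment recursion is at most `(C (n k + d² p²))^p`. -/
theorem exists_step_const_le : ∃ C : ℝ, 1 ≤ C ∧ ∀ n d k p : ℕ, 1 ≤ k → k ≤ d → d ≤ n → 2 ≤ p →
    1 + Real.log (n / k) ≤ p → (p : ℝ) ≤ 4 * (1 + Real.log (n / k)) → ∀ B D : ℝ,
    B = 3 * d + 80 * p → D = 3 * √(k * d) →
    3 * p * ((1 / (24 * k * n) : ℝ)⁻¹) ^ (p - 1) *
        (2 * ((2 * B) ^ 2 * ∑ j ∈ Finset.range (2 + 1), (j + 3) ^ 2 * (4 * D / B) ^ j)) +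
      (8 * p) ^ p * ((2 * B) ^ (2 * p) *
        ∑ j ∈ Finset.range (2 * p + 1), (j + 3) ^ (2 * p) * (4 * D / B) ^ j) ≤
      (C * (n * k + d ^ 2 * p ^ 2)) ^ p := by
  refine ⟨2 * (3 * 3784 * 25618 * 9 * 24 + 96 * (6553600 * (12800 * 368640 + 18))), by norm_num, ?_⟩
  intro n d k p hk hkd hdn hp hp1 hp2 B D hB hD
  have hk0 : (1 : ℝ) ≤ k := by exact_mod_cast hk
  have hkd' : (k : ℝ) ≤ d := by exact_mod_cast hkd
  have hdn' : (d : ℝ) ≤ n := by exact_mod_cast hdn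
  have hp' : (2 : ℝ) ≤ p := by exact_mod_cast hp
  have hd0 : (1 : ℝ) ≤ d := hk0.trans hkd'
  have hn0 : (1 : ℝ) ≤ n := hd0.trans hdn'
  have hnk : (1 : ℝ) ≤ n * k := one_le_mul_of_one_le_of_one_le hn0 hk0
  have hB0 : 0 < B := by rw [hB]; positivity
  have hBsq : B ^ 2 ≤ 18 * d ^ 2 + 12800 * p ^ 2 := by
    rw [hB]; nlinarith [sq_nonneg ((3 : ℝ) * d - 80 * p)]
  have hD0 : 0 ≤ D := by rw [hD]; positivity
  have hDsq : D ^ 2 = 9 * (k * d) := by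
    rw [hD, mul_pow, Real.sq_sqrt (by positivity)]; norm_num
  set x : ℝ := n / k with hx
  have hx0 : 0 < x := by positivity
  have hxnk : x ≤ n * k := by
    rw [hx, div_le_iff₀ (by positivity)]; nlinarith
  have hxp : x ≤ Real.exp p := by
    rw [← Real.exp_log hx0]; exact Real.exp_le_exp.2 (by linarith)
  have hxl : Real.exp (p / 4) ≤ 3 * x := by
    have h1 : Real.exp (p / 4) ≤ Real.exp 1 * x := by
      conv_rhs => rw [← Real.exp_log hx0, ← Real.exp_add]
      exact Real.exp_le_exp.2 (by linarith)
    nlinarith [Real.exp_one_lt_d9]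
  set z : ℝ := 4 * D / B with hz
  have hz0 : 0 ≤ z := by positivity
  have hzsq : z ^ 2 ≤ 16 * (k / d) := by
    rw [hz, div_pow, mul_pow, hDsq, div_le_iff₀ (by positivity)]
    have h1 : (3 * d : ℝ) ^ 2 ≤ B ^ 2 := by
      rw [hB]; gcongr; linarith
    calc (4 : ℝ) ^ 2 * (9 * (k * d)) = 16 * (k / d) * (3 * d) ^ 2 := by field_simp; ring
      _ ≤ _ := by gcongr
  have hz4 : z ≤ 4 := by
    have h1 : (k : ℝ) / d ≤ 1 := (div_le_one (by positivity)).2 hkd'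
    exact le_of_pow_le_pow_left₀ two_ne_zero (by norm_num) (by linarith)
  set U : ℝ := n * k + d ^ 2 * p ^ 2 with hU
  have hU1 : n * k ≤ U := by rw [hU]; nlinarith [sq_nonneg ((d : ℝ) * p)]
  have hU0 : 1 ≤ U := hnk.trans hU1
  have hp5 : (p : ℝ) ^ 5 ≤ 368640 * (n * k) := by
    have h1 := pow_le_mul_exp (show (0 : ℝ) ≤ p by positivity) (show (0 : ℝ) < 4 by norm_num) 5
    norm_num [Nat.factorial] at h1
    linarith
  have hW : (2 * (3 * 3784 * 25618 * 9 * 24 + 96 * (6553600 * (12800 * 368640 + 18))) * U : ℝ) =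
      2 * (3 * 3784 * 25618 * 9 * 24 * U + 96 * (6553600 * (12800 * 368640 + 18)) * U) := by ring
  rw [hW]
  refine le_trans ?_ (add_pow_le_two_mul_add_pow (by positivity) (by positivity)
    (show p ≠ 0 by omega))
  exact add_le_add (conj_term_le hp hz0 hz4 hk0 hdn' hnk hBsq hxp hU1)
    (numberOp_term_le hp hz0 hz4 hk0 hd0 hn0 hx hzsq hp5 hBsq hxl hU)

/-- `t! C(n-k, t-k) ≤ t^k n^(t-k)`, and `nk + d²L ≤ tY` with `Y = n + d²L/t`. This produces
`t^(2k)`, which `1/(2k)!` reduces to at most `e^t`. The `t + 1` summands and the prefactor `2^t`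
together cost `4^t`. -/
theorem factorial_mul_sum_le {n d t : ℕ} (ht : 1 ≤ t) {M L : ℝ} (hM : 1 ≤ M)
    (hL : 0 ≤ L) :
    t ! * 2 ^ t * ∑ k ∈ Finset.range (t + 1),
      (n - k).choose (t - k) * (M * (n * k + d ^ 2 * L)) ^ k / (2 * k)! ≤
      (4 * Real.exp 1 * M * (n + d ^ 2 / t * L)) ^ t := by
  have ht0 : (0 : ℝ) < t := by exact_mod_cast ht
  set Y : ℝ := n + d ^ 2 / t * L with hY
  have hYn : (n : ℝ) ≤ Y := by rw [hY]; exact le_add_of_nonneg_right (by positivity)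
  have hY0 : 0 ≤ Y := le_trans (Nat.cast_nonneg n) hYn
  have key : ∀ k ∈ Finset.range (t + 1),
      (n - k).choose (t - k) * (M * (n * k + d ^ 2 * L)) ^ k / (2 * k)! ≤
      (Real.exp 1 * M * Y) ^ t / t ! := fun k hk => by
    have hkt : k ≤ t := by have := Finset.mem_range.1 hk; omega
    have hkt' : (k : ℝ) ≤ t := by exact_mod_cast hkt
    have h1 : ((n - k).choose (t - k) : ℝ) ≤ n ^ (t - k) / (t - k)! := by
      refine (Nat.choose_le_pow_div (t - k) (n - k)).trans ?_
      gcongr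
      simp
    have h2 : (t ! : ℝ) ≤ t ^ k * (t - k)! := by
      have := Nat.factorial_mul_descFactorial hkt
      have h3 := Nat.descFactorial_le_pow t k
      have h4 : t ! ≤ t ^ k * (t - k)! := by rw [← this, mul_comm]; exact Nat.mul_le_mul_right _ h3
      exact_mod_cast h4
    have h3 : (n * k + d ^ 2 * L : ℝ) ≤ t * Y := by
      rw [hY, mul_add]
      have : (t : ℝ) * (d ^ 2 / t * L) = d ^ 2 * L := by field_simp
      rw [this, mul_comm (t : ℝ)]
      have h4 : (n : ℝ) * k ≤ n * t := by gcongr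
      linarith
    have h4 : (t : ℝ) ^ (2 * k) / (2 * k)! ≤ Real.exp 1 ^ t := by
      rw [Real.exp_one_pow]; exact Real.pow_div_factorial_le_exp _ ht0.le _
    rw [le_div_iff₀ (by positivity)]
    have hf : (0 : ℝ) < (t - k)! := by positivity
    calc (n - k).choose (t - k) * (M * (n * k + d ^ 2 * L)) ^ k / (2 * k)! * t !
        ≤ (n ^ (t - k) / (t - k)!) * (M * (t * Y)) ^ k / (2 * k)! * (t ^ k * (t - k)!) := by
          gcongr
      _ = n ^ (t - k) * (M ^ k * Y ^ k) * (t ^ (2 * k) / (2 * k)!) := by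
          rw [mul_pow, mul_pow, two_mul k, pow_add]; field_simp
      _ ≤ Y ^ (t - k) * (M ^ t * Y ^ k) * Real.exp 1 ^ t := by gcongr
      _ = (Real.exp 1 * M) ^ t * (Y ^ (t - k) * Y ^ k) := by rw [mul_pow]; ring
      _ = _ := by rw [← pow_add, Nat.sub_add_cancel hkt, ← mul_pow]
  have h5 := Finset.sum_le_card_nsmul _ _ _ key
  rw [Finset.card_range, nsmul_eq_mul] at h5
  have h6 : ((t + 1 : ℕ) : ℝ) ≤ 2 ^ t := by exact_mod_cast Nat.lt_two_pow_self (n := t)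
  have hW : 0 ≤ (Real.exp 1 * M * Y) ^ t := by positivity
  calc _ ≤ t ! * 2 ^ t * ((t + 1 : ℕ) * ((Real.exp 1 * M * Y) ^ t / t !)) := by gcongr
    _ = 2 ^ t * ((t + 1 : ℕ) * (Real.exp 1 * M * Y) ^ t) := by field_simp
    _ ≤ 2 ^ t * (2 ^ t * (Real.exp 1 * M * Y) ^ t) := by gcongr
    _ = _ := by rw [← mul_pow, ← mul_pow]; ring

end Numerics

/-! ### Markov's inequality for the trace moments, and rescaling of the Gaussian law. -/

section TailBound
open MvPolynomial Matrix
variable {d : ℕ}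

theorem choose_le_exp {n k : ℕ} (hk : 1 ≤ k) (hkn : k ≤ n) :
    (n.choose k : ℝ) ≤ Real.exp (k * (1 + Real.log (n / k))) := by
  have hk0 : (0 : ℝ) < k := by exact_mod_cast hk
  have hn0 : (0 : ℝ) < n := by exact_mod_cast hk.trans hkn
  calc (n.choose k : ℝ) ≤ n ^ k / k ! := Nat.choose_le_pow_div k n
    _ = (n / k) ^ k * (k ^ k / k !) := by rw [div_pow]; field_simp
    _ ≤ (n / k) ^ k * Real.exp k := by
        gcongr; exact Real.pow_div_factorial_le_exp _ hk0.le _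
    _ = _ := by
        conv_lhs => rw [← Real.exp_log (div_pos hn0 hk0), ← Real.exp_nat_mul, ← Real.exp_add]
        ring_nf

/-- Since `log k ≤ k - 1`. It allows `n^(c+1)` to be paid for by `e^((c+1)pk)`. -/
theorem log_le_mul_one_add_log_div {n k : ℕ} (hk : 1 ≤ k) (hkn : k ≤ n) :
    Real.log n ≤ k * (1 + Real.log (n / k)) := by
  have hk0 : (1 : ℝ) ≤ k := by exact_mod_cast hk
  have hn0 : (0 : ℝ) < n := by exact_mod_cast hk.trans hkn
  have h1 : 0 ≤ Real.log (n / k) :=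
    Real.log_nonneg ((one_le_div (by linarith)).2 (by exact_mod_cast hkn))
  have h2 : Real.log n = Real.log (n / k) + Real.log k := by
    rw [← Real.log_mul (by positivity) (by positivity), div_mul_cancel₀ _ (by positivity)]
  have h3 := Real.log_le_sub_one_of_pos (show (0 : ℝ) < k by linarith)
  nlinarith

/-- `(1 + pk/n)^n` and `C(n,k)` are each at most `e^(pk)`, and `n^(c+1) ≤ e^((c+1)pk)`. Together
they cost `e^((c+3)pk)`, the `p`-th power of `(e^(c+3))^k`, which only changes the constant in front
of `W`. -/
theorem moment_le_rpow_mul {n k p : ℕ} {c C U W Θ : ℝ} (hc : 0 ≤ c) (hC : 0 ≤ C) (hk : 1 ≤ k)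
    (hkn : k ≤ n) (hlp : 1 + Real.log (n / k) ≤ p) (hU : 0 ≤ U) (hUW : U ≤ 25 * W) (hΘ0 : 0 ≤ Θ)
    (hΘ : Θ ≤ (C * U) ^ p) :
    (1 + p * k / n : ℝ) ^ n * n.choose k * Θ ^ k ≤
      (n : ℝ) ^ (-(c + 1)) * ((25 * C * Real.exp (c + 3) * W) ^ k) ^ p := by
  have hk0 : (1 : ℝ) ≤ k := by exact_mod_cast hk
  have hn0 : (0 : ℝ) < n := by exact_mod_cast hk.trans hkn
  have h1 : (1 + p * k / n : ℝ) ^ n ≤ Real.exp (p * k) := by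
    have : (1 + p * k / n : ℝ) ≤ Real.exp (p * k / n) := by
      linarith [Real.add_one_le_exp (p * k / n : ℝ)]
    calc (1 + p * k / n : ℝ) ^ n ≤ Real.exp (p * k / n) ^ n := by gcongr
      _ = _ := by rw [← Real.exp_nat_mul]; congr 1; field_simp
  have hlk : k * (1 + Real.log (n / k)) ≤ p * k := by rw [mul_comm]; gcongr
  have h2 : (n.choose k : ℝ) ≤ Real.exp (p * k) :=
    (choose_le_exp hk hkn).trans (Real.exp_le_exp.2 hlk)
  have h3 : Real.log n ≤ p * k := (log_le_mul_one_add_log_div hk hkn).trans hlk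
  have h4 : (n : ℝ) ^ (-(c + 1)) = Real.exp (-(c + 1) * Real.log n) := by
    rw [Real.rpow_def_of_pos hn0, mul_comm]
  have h5 : Real.exp (-(c + 1) * (p * k)) ≤ Real.exp (-(c + 1) * Real.log n) :=
    Real.exp_le_exp.2 (mul_le_mul_of_nonpos_left h3 (by linarith))
  have h6 : Real.exp (p * k) * Real.exp (p * k) =
      Real.exp (-(c + 1) * (p * k)) * (Real.exp (c + 3) ^ p) ^ k := by
    rw [← Real.exp_nat_mul, ← Real.exp_nat_mul, ← Real.exp_add, ← Real.exp_add]
    congr 1; ring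
  have h7 : Real.exp (c + 3) * (C * U) ≤ 25 * C * Real.exp (c + 3) * W := by
    have : C * U ≤ C * (25 * W) := by gcongr
    have h8 := mul_le_mul_of_nonneg_left this (Real.exp_pos (c + 3)).le
    linarith
  calc (1 + p * k / n : ℝ) ^ n * n.choose k * Θ ^ k
      ≤ Real.exp (p * k) * Real.exp (p * k) * ((C * U) ^ p) ^ k := by gcongr
    _ = Real.exp (-(c + 1) * (p * k)) * ((Real.exp (c + 3) * (C * U)) ^ k) ^ p := by
        rw [h6, mul_assoc, ← mul_pow, ← mul_pow, pow_right_comm]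
    _ ≤ Real.exp (-(c + 1) * Real.log n) * ((25 * C * Real.exp (c + 3) * W) ^ k) ^ p := by
        gcongr
    _ = _ := by rw [h4]

/-- Tail bound for the trace of a power of `esymmMatrix` at standard Gaussian rows. -/
theorem exists_measure_esymmMatrix_le (c : ℝ) (hc : 0 < c) : ∃ M : ℝ, 1 ≤ M ∧ ∀ n d k : ℕ, 2 ≤ n →
    1 ≤ k → k ≤ d → d ≤ n → ∃ p : ℕ, p ≠ 0 ∧
      Measure.pi (fun _ : Fin n => stdGaussianPi d) {G |
        ENNReal.ofReal (((M * (n * k + d ^ 2 * Real.log n ^ 2)) ^ k) ^ p) ≤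
          ENNReal.ofReal ((esymmMatrix k n G) ^ p).trace} ≤
        ENNReal.ofReal ((n : ℝ) ^ (-(c + 1))) := by
  obtain ⟨C, hC1, hC⟩ := exists_step_const_le
  refine ⟨25 * C * Real.exp (c + 3), ?_, ?_⟩
  · have := Real.one_le_exp (show 0 ≤ c + 3 by linarith)
    nlinarith
  intro n d k hn hk hkd hdn
  have hk0 : (1 : ℝ) ≤ k := by exact_mod_cast hk
  have hkd' : (k : ℝ) ≤ d := by exact_mod_cast hkd
  have hn0 : (2 : ℝ) ≤ n := by exact_mod_cast hn
  have hkn : k ≤ n := hkd.trans hdn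
  have hkn' : (k : ℝ) ≤ n := by exact_mod_cast hkn
  have hl0 : 0 ≤ Real.log (n / k) := Real.log_nonneg ((one_le_div (by linarith)).2 hkn')
  -- The exponent `p` must be a power of two for Lieb–Thirring; `2^(s+1)` lies between `1 + log
  -- (n/k)` and twice that number.
  obtain ⟨s, hs1, hs2⟩ := exists_nat_pow_near (show 1 ≤ 1 + Real.log (n / k) by linarith)
    (one_lt_two (α := ℝ))
  obtain ⟨p, hp⟩ : ∃ p : ℕ, p = 2 ^ (s + 1) := ⟨_, rfl⟩
  have hpr : (p : ℝ) = 2 * 2 ^ s := by rw [hp]; push_cast; ring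
  have hp2 : 2 ≤ p := by rw [hp, pow_succ]; have := Nat.one_le_two_pow (n := s); omega
  have hlp : 1 + Real.log (n / k) ≤ p := by rw [hpr, ← pow_succ']; exact hs2.le
  have hpl : (p : ℝ) ≤ 2 * (1 + Real.log (n / k)) := by rw [hpr]; linarith
  have hp0 : (0 : ℝ) < p := by positivity
  refine ⟨p, by omega, ?_⟩
  have hΘ := hC n d k p hk hkd hdn hp2 hlp (by linarith) (3 * d + 80 * p) (3 * √(k * d)) rfl rfl
  set Θ : ℝ := 3 * p * ((1 / (24 * k * n) : ℝ)⁻¹) ^ (p - 1) *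
        (2 * ((2 * (3 * d + 80 * p)) ^ 2 * ∑ j ∈ Finset.range (2 + 1),
          (j + 3) ^ 2 * (4 * (3 * √(k * d)) / (3 * d + 80 * p)) ^ j)) +
      (8 * p) ^ p * ((2 * (3 * d + 80 * p)) ^ (2 * p) *
        ∑ j ∈ Finset.range (2 * p + 1),
          (j + 3) ^ (2 * p) * (4 * (3 * √(k * d)) / (3 * d + 80 * p)) ^ j) with hΘ'
  have hΘ0 : 0 ≤ Θ := by positivity
  have hkk : (2 * k * (2 * k + d) : ℝ) ≤ 6 * (k * d) := by nlinarith
  -- The Young weight `1/(24kn)` makes `a = pk/n`. Since `k ≤ d`, one has `2k(2k + d) ≤ 6kd`, hence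
  -- the choices `κ = 3d` and `D = 3√(kd)`; `B = 3d + 80p` dominates `κ`, `d + 4p` and `80p`.
  have hm := lintegral_trace_esymmMatrix_pow_le (d := d) (p := p) (k := k)
    (a := 24 * p * (1 / (24 * k * n)) * k ^ 2) (by positivity) hΘ0
    (fun l hl {X R} hX hR => lintegral_trace_esymmMatrix_step (κ := 3 * d) hp hp2
      (by push_cast; linarith) (by push_cast; linarith) (by positivity) (by positivity)
      (by positivity) (by linarith) (by positivity)
      (by nlinarith) (by rw [mul_pow, Real.sq_sqrt (by positivity)]; nlinarith) hl hX hR)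
    (by omega) n k le_rfl
  have e1 : 24 * p * (1 / (24 * k * n)) * (k : ℝ) ^ 2 = p * k / n := by field_simp
  rw [e1] at hm
  set U : ℝ := n * k + d ^ 2 * p ^ 2 with hU
  set W : ℝ := n * k + d ^ 2 * Real.log n ^ 2 with hW
  have hL2 : (2 / 3 : ℝ) ≤ Real.log n := by
    have h1 := Real.log_le_log (by norm_num) hn0
    linarith [Real.log_two_gt_d9]
  -- `p ≤ 2 + 2 log n`, and `2 ≤ 3 log n` because `n ≥ 2`. This replaces `p²` by `25 log² n`.
  have hpL : (p : ℝ) ≤ 5 * Real.log n := by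
    have h1 : Real.log (n / k) ≤ Real.log n :=
      Real.log_le_log (by positivity) (div_le_self (by positivity) hk0)
    linarith
  have hUW : U ≤ 25 * W := by
    have h1 : (p : ℝ) ^ 2 ≤ (5 * Real.log n) ^ 2 := by gcongr
    have h2 : (d : ℝ) ^ 2 * p ^ 2 ≤ d ^ 2 * (5 * Real.log n) ^ 2 := by gcongr
    have h3 : (0 : ℝ) ≤ n * k := by positivity
    rw [hU, hW]; nlinarith
  have hU0 : 0 ≤ U := by positivity
  have hW0 : 0 < W := by positivity
  have hreal := moment_le_rpow_mul (C := C) (by linarith : (0 : ℝ) ≤ c) (by linarith) hk hkn hlp hU0 hUW hΘ0 hΘ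
  have hε : 0 < ((25 * C * Real.exp (c + 3) * W) ^ k) ^ p := by positivity
  refine (meas_ge_le_lintegral_div (measurable_trace_esymmMatrix_pow k n p).aemeasurable
    (ENNReal.ofReal_pos.2 hε).ne' ENNReal.ofReal_ne_top).trans
      (ENNReal.div_le_of_le_mul (hm.trans ?_))
  rw [← ENNReal.ofReal_mul (by positivity)]
  exact ENNReal.ofReal_le_ofReal hreal

theorem gaussianMatrixLaw_eq_map (n d : ℕ) :
    gaussianMatrixLaw n d = (Measure.pi fun _ : Fin n => stdGaussianPi d).map
      fun G => (√(n : ℝ))⁻¹ • G := by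
  have h1 : (gaussianReal 0 1).map ((√(n : ℝ))⁻¹ * ·) = gaussianReal 0 ((n : ℝ≥0)⁻¹) := by
    rw [gaussianReal_map_const_mul]
    congr 1
    · simp
    · ext
      simp [Real.sq_sqrt]
  have h2 : (stdGaussianPi d).map (fun g α => (√(n : ℝ))⁻¹ * g α) =
      Measure.pi fun _ : Fin d => gaussianReal 0 ((n : ℝ≥0)⁻¹) := by
    have : ∀ i : Fin d, SigmaFinite ((gaussianReal 0 1).map ((√(n : ℝ))⁻¹ * ·)) := fun i => by
      rw [h1]; infer_instance
    rw [stdGaussianPi, Measure.pi_map_pi fun i => (measurable_const_mul _).aemeasurable]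
    simp only [h1]
  have hm : Measurable fun (g : Fin d → ℝ) (α : Fin d) => (√(n : ℝ))⁻¹ * g α := by fun_prop
  have : ∀ i : Fin n, SigmaFinite ((stdGaussianPi d).map fun g α => (√(n : ℝ))⁻¹ * g α) :=
    fun i => by rw [h2]; infer_instance
  have h3 := Measure.pi_map_pi (μ := fun _ : Fin n => stdGaussianPi d)
    (f := fun _ g α => (√(n : ℝ))⁻¹ * g α) fun i => hm.aemeasurable
  rw [gaussianMatrixLaw, ← h2, ← h3]
  rfl

theorem distinctProductsPoly_smul {n d : ℕ} (t : ℕ) (s : ℝ) (G : Fin n → Fin d → ℝ) :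
    distinctProductsPoly t (s • G) = C (s ^ (4 * t)) * distinctProductsPoly t G := by
  have h : ∀ i, linForm ((s • G) i) = C s * linForm (G i) := fun i => by
    simp [linForm, Finset.mul_sum, mul_assoc]
  simp only [distinctProductsPoly, h, mul_pow, Finset.prod_mul_distrib, Finset.prod_const]
  rw [mul_left_comm, Finset.mul_sum (a := C (s ^ (4 * t)))]
  congr 1
  refine Finset.sum_congr rfl fun S hS => ?_
  rw [(Finset.mem_powersetCard.1 hS).2, map_pow, pow_mul]

theorem sosLe_distinctProductsPoly_smul {n d t : ℕ} {G : Fin n → Fin d → ℝ} {b : ℝ} (s : ℝ)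
    (h : SosLe (4 * t) (distinctProductsPoly t G) (C b * normSqPoly d ^ (2 * t))) :
    SosLe (4 * t) (distinctProductsPoly t (s • G))
      (C (s ^ (4 * t) * b) * normSqPoly d ^ (2 * t)) := by
  have h1 : IsSos (4 * t) (C b * normSqPoly d ^ (2 * t) - distinctProductsPoly t G) := h
  have h2 := h1.C_mul (a := s ^ (4 * t)) (by rw [mul_comm, pow_mul']; positivity)
  rw [mul_sub, ← mul_assoc, ← C_mul, ← distinctProductsPoly_smul] at h2
  exact h2

end TailBound

/-! ### Union bound over `k`, and return to variance `1/n`. -/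

theorem lemma4p11 (c : ℝ) (hc : 0 < c) :
    ∃ K : ℝ, 0 < K ∧
      ∀ n d t : ℕ, 1 ≤ t → t ≤ d → d ≤ n →
        (t : ℝ) * Real.log n ^ 6 ≤ (n : ℝ) + (d : ℝ) ^ 2 / t * Real.log n ^ 2 →
        gaussianMatrixLaw n d
            {A | ¬ SosLe (4 * t) (distinctProductsPoly t A)
              (MvPolynomial.C
                  ((K * (1 / (n : ℝ) + (d : ℝ) ^ 2 / ((n : ℝ) ^ 2 * t) * Real.log n ^ 2)) ^ t) *
                normSqPoly d ^ (2 * t))}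
          ≤ ENNReal.ofReal ((n : ℝ) ^ (-c)) := by
  obtain ⟨M, hM1, hM⟩ := exists_measure_esymmMatrix_le c hc
  refine ⟨4 * Real.exp 1 * M, by positivity, ?_⟩
  intro n d t ht htd hdn _
  have hprob : IsProbabilityMeasure (gaussianMatrixLaw n d) := by
    rw [gaussianMatrixLaw]; infer_instance
  rcases Nat.lt_or_ge n 2 with hn | hn
  -- For `n = 1` the claimed failure probability is `1`.
  · obtain rfl : n = 1 := by omega
    refine prob_le_one.trans ?_
    simp
  have hn0 : (0 : ℝ) < n := by positivity
  have hnt : t ≤ n := htd.trans hdn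
  choose! p hp0 hp using fun k (h : 1 ≤ k ∧ k ≤ d) => hM n d k hn h.1 h.2 hdn
  set a : ℕ → ℝ := fun k => (M * (n * k + d ^ 2 * Real.log n ^ 2)) ^ k with ha
  have ha0 : ∀ k, 0 ≤ a k := fun k => by positivity
  set T : ℕ → Set (Fin n → Fin d → ℝ) := fun k => {G |
    ENNReal.ofReal (a k ^ p k) ≤ ENNReal.ofReal ((esymmMatrix k n G) ^ p k).trace} with hT
  have hTm : ∀ k, MeasurableSet (T k) := fun k =>
    measurableSet_le measurable_const (measurable_trace_esymmMatrix_pow k n (p k))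
  -- The failure event is covered by finitely many measurable trace-tail events, so its own
  -- measurability plays no role.
  have hsub : {A | ¬ SosLe (4 * t) (distinctProductsPoly t A) (MvPolynomial.C
      ((4 * Real.exp 1 * M * (1 / (n : ℝ) + (d : ℝ) ^ 2 / ((n : ℝ) ^ 2 * t) * Real.log n ^ 2)) ^ t) *
        normSqPoly d ^ (2 * t))} ⊆
      (fun A => √(n : ℝ) • A) ⁻¹' ⋃ k ∈ Finset.Icc 1 t, T k := by
    intro A hA
    by_contra hA'
    simp only [Set.mem_preimage, Set.mem_iUnion, not_exists, hT, Set.mem_ofPred_eq, not_le,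
      Finset.mem_Icc] at hA'
    refine hA ?_
    -- `p k` is only controlled for `1 ≤ k ≤ d`; the maximum with `1` keeps the exponent nonzero for
    -- every `k`. At `k = 0` the matrix is the `1 × 1` identity, whatever the exponent.
    have htr : ∀ k ≤ t, ((esymmMatrix k n (√(n : ℝ) • A)) ^ (max (p k) 1)).trace ≤
        a k ^ (max (p k) 1) := fun k hk => by
      rcases Nat.eq_zero_or_pos k with rfl | hk1
      · rw [esymmMatrix_zero, one_pow, Matrix.trace_one]
        simp only [ha, pow_zero, one_pow]
        exact_mod_cast homIdx_zero_card.le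
      · rw [max_eq_left (Nat.one_le_iff_ne_zero.2 (hp0 k ⟨hk1, hk.trans htd⟩))]
        exact (ENNReal.ofReal_lt_ofReal_iff'.1 (hA' k ⟨hk1, hk⟩)).1.le
    have h1 := sosLe_distinctProductsPoly_smul (√(n : ℝ))⁻¹ (sosLe_distinctProductsPoly hnt ha0
      (fun k => by simp) htr (factorial_mul_sum_le (n := n) (d := d) ht hM1
        (sq_nonneg (Real.log n))))
    rw [inv_smul_smul₀ (Real.sqrt_pos.2 hn0).ne'] at h1
    refine (congrArg (fun x => SosLe (4 * t) (distinctProductsPoly t A)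
      (MvPolynomial.C x * normSqPoly d ^ (2 * t))) ?_).mp h1
    -- `P_t` has degree `4t` in the rows, so undoing the scaling by `√n` contributes `n^(-2t)`,
    -- which turns `n + (d²/t) log² n` into `1/n + (d²/(n²t)) log² n` inside the `t`-th power.
    rw [pow_mul, ← mul_pow, show ((√(n : ℝ))⁻¹) ^ 4 = ((n : ℝ) ^ 2)⁻¹ by
      rw [inv_pow, show 4 = 2 * 2 by norm_num, pow_mul, Real.sq_sqrt hn0.le]]
    congr 1
    field_simp
  have hmeas : Measurable fun A : Fin n → Fin d → ℝ => √(n : ℝ) • A := measurable_const_smul _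
  calc _ ≤ gaussianMatrixLaw n d ((fun A => √(n : ℝ) • A) ⁻¹' ⋃ k ∈ Finset.Icc 1 t, T k) :=
        measure_mono hsub
    _ = Measure.pi (fun _ : Fin n => stdGaussianPi d) (⋃ k ∈ Finset.Icc 1 t, T k) := by
        rw [gaussianMatrixLaw_eq_map, Measure.map_apply (measurable_const_smul _)
          (hmeas (Finset.measurableSet_biUnion _ fun k _ => hTm k)), ← Set.preimage_comp]
        congr 1
        ext G
        simp only [Set.mem_preimage, Function.comp_apply, smul_inv_smul₀ (Real.sqrt_pos.2 hn0).ne']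
    _ ≤ ∑ k ∈ Finset.Icc 1 t, Measure.pi (fun _ : Fin n => stdGaussianPi d) (T k) :=
        measure_biUnion_finset_le _ _
    _ ≤ ∑ k ∈ Finset.Icc 1 t, ENNReal.ofReal ((n : ℝ) ^ (-(c + 1))) :=
        Finset.sum_le_sum fun k hk => by
          obtain ⟨h1, h2⟩ := Finset.mem_Icc.1 hk
          exact hp k ⟨h1, h2.trans htd⟩
    -- There are `t ≤ n` events, which is why each tail was made to decay with exponent `c + 1`.
    _ ≤ n * ENNReal.ofReal ((n : ℝ) ^ (-(c + 1))) := by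
        rw [Finset.sum_const, Nat.card_Icc, nsmul_eq_mul, Nat.add_sub_cancel]
        gcongr
    _ = _ := by
        rw [← ENNReal.ofReal_natCast, ← ENNReal.ofReal_mul (by positivity)]
        congr 1
        nth_rw 1 [← Real.rpow_one (n : ℝ)]
        rw [← Real.rpow_add hn0]
        congr 1; ring
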